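/- Labels are $\pm1$. A concept class is a set $\mathcal C$ of functions $X\to\{\pm1\}$; its VC dimension is the largest size of a finite set on which $\mathcal C$ realizes all labelings. A randomized hypothesis $\mathbf h$ has error $\Pr_{x\sim D,\mathbf h}[\mathbf h(x)\ne c^\star(x)]$. $\mathrm{Maj}_7(\mathcal C)$ is the class of functions $x\mapsto\mathrm{sign}(c_1(x)+\dots+c_7(x))$ with $c_1,\dots,c_7\in\mathcal C$. An ERM oracle for $\mathcal C$ answers each finite labeled dataset by some $c\in\mathcal C$ maximizing $\sum_i c(x_i)y_i$ (ties broken arbitrarily). Malicious noise of rate $\eta$: the sample $(x_1,y_1),\dots,(x_n,y_n)$ is generated sequentially. In each round, with probability $1-\eta$, $x_i\sim D$ is drawn independently of the past and $y_i=c^\star(x_i)$; with probability $\eta$, an adversary, which knows the past rounds and may randomize, sets $(x_i,y_i)$ to any labeled point. A learner $(\tau,\delta)$-learns $\mathcal C$ with $\eta$-malicious noise if for every distribution $D$ on $X$, every target $c^\star\in\mathcal C$ and every adversary, the hypothesis that it outputs has error at most $\tau$ except with probability at most $\delta$. Here the usual measurability is assumed: concepts are $D$-measurable and, for all $m$ and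 $b\in\{\pm1\}^m$, the set $\{x\in X^m:\exists c\in\mathcal C\ \forall i\ c(x_i)=b_i\}$ is $D^m$-measurable up to null sets. Theorem. There are a constant $K$ and a program $P$ with the following property. Let $\mathcal C$ be a concept class of VC dimension $d$ with an ERM oracle, let $\varepsilon,\delta\in(0,1)$ and $\alpha\in[0,1)$, and let $$n\ \ge\ K\cdot\frac{d\log(2+\alpha/\varepsilon)+\log(1/\delta)}{\varepsilon(\alpha+\varepsilon)} .$$ Then $P$, given the number $\lceil 1/\varepsilon\rceil$, $n$ labeled points and the oracle, implements a learner that, for every $\eta\in[0,1)$, $$\Big(\big(\tfrac12+\alpha\big)\tfrac{\eta}{1-\eta}+\varepsilon,\ \delta\Big)\text{-learns }\mathcal C\text{ with }\eta\text{-malicious noise}$$ (so $\alpha=0$ gives error $\frac{\eta}{2(1-\eta)}+\varepsilon$ from $O((d+\log(1/\delta))/\varepsilon^2)$ samples). On every sample, $P$ makes at most $K/\varepsilon$ oracle calls and runs in time at most $K(n+1/\varepsilon)^K$, where integer arithmetic is charged by bit length, building a dataset for the oracle is charged point by point, and points and concepts are opaque: a program can only look up labels, evaluate returned concepts at sample points,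 and submit labeled sample points to the oracle. It outputs a finite list of concepts of $\mathcal C$; with $\mu$ the uniform distribution on this list, the learner's hypothesis is the following mixture of functions in $\mathrm{Maj}_7(\mathcal C)$: with probability $16/19$ the majority of seven independent draws from $\mu$, and with probability $3/19$ a single draw from $\mu$. Its mean at each point $x$ is $g\big(\mathbb E_{c\sim\mu}[c(x)]\big)$, where $$g(t)=\tfrac{16}{19}M_7(t)+\tfrac{3}{19}t,\qquad M_7(t)=\mathbb E[\mathrm{sign}(z_1+\dots+z_7)]\ \text{ for independent signs } z_i \text{ of mean } t.$$ -/

import Mathlib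

open MeasureTheory ProbabilityTheory
open scoped ENNReal NNReal

namespace MaliciousLearning

/-! ### Labels, concepts, majorities.
Labels are Booleans: `true` stands for `+1` and `false` for `-1`. A concept over `X` is a map
`X → Bool`, a concept class is a set of concepts. -/

/-- The sign `+1` or `-1` that a label stands for. -/
def sgn (b : Bool) : ℤ := if b then 1 else -1

/-- The label of the sign of `z_1 + ⋯ + z_k`, with `sign 0 = +1`. -/
def signSum {k : ℕ} (z : Fin k → Bool) : Bool := decide (0 ≤ ∑ i, sgn (z i))

/-- The pointwise majority of `k` concepts. -/
def maj {X : Type*} {k : ℕ} (c : Fin k → X → Bool) : X → Bool := fun x => signSum fun i => c i x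

/-- The class of all `k`-wise majorities of concepts of `C`. -/
def Maj {X : Type*} (k : ℕ) (C : Set (X → Bool)) : Set (X → Bool) :=
  {h | ∃ c : Fin k → X → Bool, (∀ i, c i ∈ C) ∧ h = maj c}

/-- `C` takes on all labelings of the finite set `s`. -/
def Shatters {X : Type*} (C : Set (X → Bool)) (s : Finset X) : Prop :=
  ∀ f : X → Bool, ∃ c ∈ C, ∀ x ∈ s, c x = f x

/-- The VC dimension: the supremum of the cardinalities of the finite sets shattered by `C`. -/
noncomputable def vcDim {X : Type*} (C : Set (X → Bool)) : ℕ∞ :=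
  ⨆ s ∈ {s : Finset X | Shatters C s}, (s.card : ℕ∞)

/-! ### Randomized hypotheses -/

/-- The law of `k` independent draws from `μ`. -/
noncomputable def iidDraws {A : Type*} (μ : PMF A) : (k : ℕ) → PMF (Fin k → A)
  | 0 => PMF.pure Fin.elim0
  | k + 1 => μ.bind fun a => (iidDraws μ k).map fun v => Fin.cons a v

/-- With probability `16/19`, the majority of seven independent draws from `μ`; with probability
`3/19`, the majority of seven copies of a single draw from `μ`. -/
noncomputable def majMixture {X : Type*} (μ : PMF (X → Bool)) : PMF (X → Bool) :=
  (PMF.ofFintype (fun b : Bool => if b then (16 / 19 : ℝ≥0∞) else 3 / 19) (by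
      simp only [Fintype.sum_bool, if_true, Bool.false_eq_true, if_false]
      rw [ENNReal.div_add_div_same]
      norm_num
      exact ENNReal.div_self (by norm_num) (by norm_num))).bind fun b =>
    if b then (iidDraws μ 7).map fun c => maj c
    else μ.map fun c => maj fun _ : Fin 7 => c

/-- The mean `E_{h ∼ H}[h(x)]` in `[-1,1]` of a randomized hypothesis at a point. -/
noncomputable def mean {X : Type*} (H : PMF (X → Bool)) (x : X) : ℝ :=
  ∑' h, (H h).toReal * (sgn (h x) : ℝ)

/-- `M_k(t)`: the expected sign of the sum of `k` independent signs of mean `t`. -/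
noncomputable def M (k : ℕ) (t : ℝ) : ℝ :=
  ∑ z : Fin k → Bool, (∏ i, (1 + t * (sgn (z i) : ℝ)) / 2) * (sgn (signSum z) : ℝ)

/-- The polynomial `g(t) = (16/19) M_7(t) + (3/19) t`. -/
noncomputable def g (t : ℝ) : ℝ := 16 / 19 * M 7 t + 3 / 19 * t

/-- The error rate `Pr_{x ∼ D, h ∼ H}[h(x) ≠ c(x)]`. -/
noncomputable def error {X : Type*} [MeasurableSpace X] (D : Measure X) (H : PMF (X → Bool))
    (c : X → Bool) : ℝ≥0∞ :=
  ∑' h, H h * D {x | h x ≠ c x}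

/-! ### Malicious noise -/

/-- What is known of a round: whether it was given to the adversary, and the resulting labeled
point. -/
abbrev Round (X : Type*) := Bool × (X × Bool)

/-- An adaptive, possibly randomized adversary: given the first `i` rounds, a law for the labeled
point that it puts in round `i` if that round is given to it. -/
structure Adversary (X : Type*) [MeasurableSpace X] where
  play : (i : ℕ) → Kernel (Fin i → Round X) (X × Bool)
  markov : ∀ i, IsMarkovKernel (play i)

/-- The law of the first `n` rounds. Each round is clean with probability `1 - η`, and then is
`(x, c x)` with `x ∼ D` independent of the past; otherwise the adversary chooses it. -/
noncomputable def roundsLaw {X : Type*} [MeasurableSpace X] (D : Measure X) (c : X → Bool) (η : ℝ)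
    (adv : Adversary X) : (n : ℕ) → Measure (Fin n → Round X)
  | 0 => Measure.dirac Fin.elim0
  | n + 1 =>
    ENNReal.ofReal (1 - η) •
      (((roundsLaw D c η adv n).prod (D.map fun x => (x, c x))).map
        fun p => Fin.snoc (α := fun _ => Round X) p.1 (false, p.2)) +
    ENNReal.ofReal η •
      (((roundsLaw D c η adv n).compProd (adv.play n)).map
        fun p => Fin.snoc (α := fun _ => Round X) p.1 (true, p.2))

/-- The measurability convention for concept classes: every concept of `C` is measurable, and so,
for all `m` and `b`, is the set of the `m`-tuples of points on which some concept of `C` takes the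
labels `b` (up to null sets). The second part follows from the first if `C` is countable, or if some
countable part of `C` has every concept of `C` as a pointwise limit of a sequence; both parts hold if
`X` is countable, or `D` is carried by a countable set, with measurable points. -/
def MeasurableClass {X : Type*} [MeasurableSpace X] (C : Set (X → Bool)) (D : Measure X) : Prop :=
  (∀ c ∈ C, AEMeasurable c D) ∧
    ∀ (m : ℕ) (b : Fin m → Bool),
      NullMeasurableSet {x : Fin m → X | ∃ c ∈ C, ∀ i, c (x i) = b i} (Measure.pi fun _ => D)

/-- The learner `A`, which maps `n` labeled points to a randomized hypothesis, `(τ, δ)`-learns `C`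
with `η`-malicious noise: for every distribution, target in `C` and adversary, its error exceeds `τ`
with probability at most `δ`. -/
def LearnsMalicious {X : Type*} [MeasurableSpace X] (C : Set (X → Bool)) {n : ℕ}
    (A : (Fin n → X × Bool) → PMF (X → Bool)) (η τ δ : ℝ) : Prop :=
  ∀ (D : Measure X) [IsProbabilityMeasure D], MeasurableClass C D →
    ∀ c ∈ C, ∀ adv : Adversary X,
      roundsLaw D c η adv n {r | ENNReal.ofReal τ < error D (A fun i => (r i).2) c} ≤
        ENNReal.ofReal δ

/-! ### ERM oracles and oracle programs -/

/-- The agreement `∑ c(x_i) y_i` of a concept with a dataset. -/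
def agreement {X : Type*} (c : X → Bool) (S : List (X × Bool)) : ℤ :=
  (S.map fun p => sgn (c p.1) * sgn p.2).sum

/-- `O` is an ERM oracle for `C`: it answers every dataset by some concept of `C` of maximal
agreement. -/
def IsERMOracle {X : Type*} (C : Set (X → Bool)) (O : List (X × Bool) → X → Bool) : Prop :=
  ∀ S, O S ∈ C ∧ ∀ c ∈ C, agreement c S ≤ agreement (O S) S

/-- Integer expressions of the programming language. `label i` is the label of sample point `i`, and
`value j i` the value at sample point `i` of the `j`-th concept that the oracle has returned. -/
inductive Expr
  | lit (z : ℤ)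
  | var (v : ℕ)
  | add (a b : Expr)
  | sub (a b : Expr)
  | mul (a b : Expr)
  | div (a b : Expr)
  | label (i : Expr)
  | value (j i : Expr)

/-- Programs. Branching and looping test whether an expression is positive. -/
inductive Cmd
  | skip
  | assign (v : ℕ) (e : Expr)
  /-- append sample point `i`, labeled by the sign of `b`, to the dataset under construction -/
  | push (i b : Expr)
  /-- submit the dataset under construction to the ERM oracle, and empty it -/
  | call
  /-- append the `j`-th concept returned by the oracle to the output -/
  | emit (j : Expr)
  | seq (p q : Cmd)
  | ite (e : Expr) (p q : Cmd)
  | loop (e : Expr) (p : Cmd)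

/-- Memory of a run. Points and concepts are opaque to a program: it only refers to them by their
indices. -/
structure State (X : Type*) where
  /-- integer variables -/
  vars : ℕ → ℤ
  /-- dataset under construction -/
  query : List (X × Bool)
  /-- the concepts returned by the oracle so far, one for each call -/
  concepts : List (X → Bool)
  /-- the concepts output so far -/
  output : List (X → Bool)

/-- The start: variable `0` holds the sample size `n`, variable `1` the accuracy parameter `k`. -/
def start (X : Type*) (n k : ℕ) : State X where
  vars := fun v => if v = 0 then n else if v = 1 then k else 0
  query := []
  concepts := []
  output := []

/-- The number of binary digits of an integer, plus one. -/
def width (z : ℤ) : ℕ := z.natAbs.size + 1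

/-- The entry of a list at an integer index, if there is one. -/
def entry {A : Type*} (l : List A) (z : ℤ) : Option A := if 0 ≤ z then l[z.toNat]? else none

/-- The value of an expression in a state, for the sample `S`. -/
def Expr.eval {X : Type*} (S : List (X × Bool)) (s : State X) : Expr → ℤ
  | lit z => z
  | var v => s.vars v
  | add a b => a.eval S s + b.eval S s
  | sub a b => a.eval S s - b.eval S s
  | mul a b => a.eval S s * b.eval S s
  | div a b => a.eval S s / b.eval S s
  | label i => ((entry S (i.eval S s)).map fun p => sgn p.2).getD 0
  | value j i =>
    (((entry s.concepts (j.eval S s)).bind fun c =>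
      (entry S (i.eval S s)).map fun p => sgn (c p.1))).getD 0

/-- The bit cost of evaluating an expression: an arithmetic operation costs the product of the
lengths of its operands, a lookup the lengths of its indices. -/
def Expr.cost {X : Type*} (S : List (X × Bool)) (s : State X) : Expr → ℕ
  | lit z => width z
  | var v => width (s.vars v)
  | add a b => a.cost S s + b.cost S s + width (a.eval S s) * width (b.eval S s)
  | sub a b => a.cost S s + b.cost S s + width (a.eval S s) * width (b.eval S s)
  | mul a b => a.cost S s + b.cost S s + width (a.eval S s) * width (b.eval S s)
  | div a b => a.cost S s + b.cost S s + width (a.eval S s) * width (b.eval S s)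
  | label i => i.cost S s + width (i.eval S s)
  | value j i => j.cost S s + i.cost S s + width (j.eval S s) + width (i.eval S s)

/-- `Exec O S p s t s'`: with oracle `O` and sample `S`, program `p` started in state `s` halts in
state `s'` after time `t`. Here an oracle call takes unit time, on top of the time spent on building
its dataset point by point. -/
inductive Exec {X : Type*} (O : List (X × Bool) → X → Bool) (S : List (X × Bool)) :
    Cmd → State X → ℕ → State X → Prop
  | skip (s : State X) : Exec O S .skip s 1 s
  | assign (s : State X) (v : ℕ) (e : Expr) :
      Exec O S (.assign v e) s (1 + e.cost S s)
        { s with vars := Function.update s.vars v (e.eval S s) }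
  | push (s : State X) (i b : Expr) (p : X × Bool) (hp : entry S (i.eval S s) = some p) :
      Exec O S (.push i b) s (1 + i.cost S s + b.cost S s)
        { s with query := s.query ++ [(p.1, decide (0 < b.eval S s))] }
  | call (s : State X) :
      Exec O S .call s 1 { s with query := [], concepts := s.concepts ++ [O s.query] }
  | emit (s : State X) (j : Expr) (c : X → Bool) (hc : entry s.concepts (j.eval S s) = some c) :
      Exec O S (.emit j) s (1 + j.cost S s) { s with output := s.output ++ [c] }
  | seq (p q : Cmd) (s₁ s₂ s₃ : State X) (t₁ t₂ : ℕ) (h₁ : Exec O S p s₁ t₁ s₂)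
      (h₂ : Exec O S q s₂ t₂ s₃) : Exec O S (.seq p q) s₁ (t₁ + t₂) s₃
  | ite_pos (e : Expr) (p q : Cmd) (s s' : State X) (t : ℕ) (he : 0 < e.eval S s)
      (h : Exec O S p s t s') : Exec O S (.ite e p q) s (1 + e.cost S s + t) s'
  | ite_neg (e : Expr) (p q : Cmd) (s s' : State X) (t : ℕ) (he : e.eval S s ≤ 0)
      (h : Exec O S q s t s') : Exec O S (.ite e p q) s (1 + e.cost S s + t) s'
  | loop_step (e : Expr) (p : Cmd) (s₁ s₂ s₃ : State X) (t₁ t₂ : ℕ) (he : 0 < e.eval S s₁)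
      (h₁ : Exec O S p s₁ t₁ s₂) (h₂ : Exec O S (.loop e p) s₂ t₂ s₃) :
      Exec O S (.loop e p) s₁ (1 + e.cost S s₁ + t₁ + t₂) s₃
  | loop_done (e : Expr) (p : Cmd) (s : State X) (he : e.eval S s ≤ 0) :
      Exec O S (.loop e p) s (1 + e.cost S s) s

/-- With oracle `O` and accuracy parameter `k`, the program `P` on the sample `S` halts within time
`T` and `Q` oracle calls, and outputs a nonempty list of concepts whose uniform distribution
(counted with multiplicity) is `μ`. -/
def RunsTo {X : Type*} (P : Cmd) (O : List (X × Bool) → X → Bool) (k : ℕ) {n : ℕ}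
    (S : Fin n → X × Bool) (T Q : ℝ) (μ : PMF (X → Bool)) : Prop :=
  ∃ (t : ℕ) (s : State X) (hs : (s.output : Multiset (X → Bool)) ≠ 0),
    Exec O (List.ofFn S) P (start X n k) t s ∧
      (t : ℝ) ≤ T ∧ (s.concepts.length : ℝ) ≤ Q ∧ μ = PMF.ofMultiset s.output hs

end MaliciousLearning

open MaliciousLearning

namespace MaliciousLearning

/-! ### Traces of a class of bounded VC dimension -/

section Traces
variable {X : Type*} {C : Set (X → Bool)} {d : ℕ}

/-! Let m_i be the margin of sample point i: its label y_i times the mean, at that point, of the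
uniform distribution on the output list. The program minimises the sum of `potential` (m_i) over
mixtures of concepts by the Frank–Wolfe method. The derivative of `potential` is minus `weight`, so
the linear step is one ERM call on the sample with multiplicities proportional to `weight` (m_i). It
stops when the Frank–Wolfe gap is at most n/(4k), where k = ⌈1/ε⌉; smoothness gives this after O(k)
rounds (`exists_small_gap`). Then every c in C satisfies ∑ weight(m_i) (y_i c(x_i) - m_i) ≤ n/(4k),
which is the conclusion of `exists_runsTo`.

Take the target for c. A clean point contributes weight(m)(1 - m) ≥ 2(1 - g(m)), four times the
probability (1 - g(m))/2 that the hypothesis errs there. A corrupted point contributes at least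
-weight(m)(1 + m) ≥ -2. So the errors on clean points, divided by n, amount to at most half the
corrupted fraction plus 1/(16k) (`sum_clean_one_sub_g_le`). The ratio 2/4 is the constant 1/2 of the
theorem. The functions `g` and `weight` are matched so that both inequalities hold, with equality at
m = 0 and m = 1.

To pass to the true error, note that every hypothesis in the mixture is a majority of seven
concepts. So it suffices that, uniformly over 7-tuples, n times the probability of a clean wrong
round is at most (1 + a) times the number of such rounds plus e n, with a = α/4 and e = ε/8
(`measure_deviation_le`). The proof compares with a ghost sample, swaps the two halves at random,
and chains over nets of the traces of C on the double sample. The nets come from Sauer–Shelah by a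
packing argument (`card_packing_le`). Chaining, instead of a union bound over all traces, avoids a
logarithmic factor when α = 0. The multiplicative slack a pays for the variance of the swaps, so the
exponent is of order e(a + e)n.

The adversary is adaptive, but redrawing the content of every corrupted round as a fresh example,
while keeping its flag, yields independent rounds (`map_redraw_eq`). The number of corrupted rounds
and the errors on clean rounds do not change under redrawing, so bad events transfer to the
independent model (`roundsLaw_le_pi`).

Two cases are trivial: for d = 0 the class has one concept, and for η ≥ 2/3 the claimed error bound
is at least 1. The program keeps all weights integral by giving concept number j the multiplicity j
+ 1; `runs_learner` bounds its running time. -/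

lemma card_le_of_shatters (hd : vcDim C = d) {s : Finset X} (hs : Shatters C s) : s.card ≤ d := by
  have h : (s.card : ℕ∞) ≤ vcDim C :=
    le_iSup₂ (f := fun (s : Finset X) (_ : s ∈ {s : Finset X | Shatters C s}) => (s.card : ℕ∞)) s hs
  rw [hd] at h
  exact_mod_cast h

/-- Sauer–Shelah for the traces, viewed as a set family on the indices: a shattered set of indices
gives a set of points of the same size that C shatters. -/
lemma card_traces_le (hd : vcDim C = d) {m : ℕ} (y : Fin m → X) (𝒜 : Finset (Finset (Fin m)))
    (h𝒜 : ∀ A ∈ 𝒜, ∃ c ∈ C, ∀ j, j ∈ A ↔ c (y j) = true) :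
    𝒜.card ≤ ∑ k ∈ Finset.Iic d, m.choose k := by
  classical
  have hvc : 𝒜.vcDim ≤ d := by
    refine Finset.sup_le fun s hs => ?_
    rw [Finset.mem_shatterer] at hs
    -- Indices of equal points receive equal labels from every concept, so a shattered set of
    -- indices repeats no point.
    have hinj : Set.InjOn y s := by
      intro j hj j' hj' hjj
      obtain ⟨u, hu, hsu⟩ := hs.exists_inter_eq_singleton hj
      obtain ⟨c, -, hc⟩ := h𝒜 u hu
      have h1 : j ∈ u := Finset.mem_of_mem_inter_right (hsu ▸ Finset.mem_singleton_self j)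
      have h2 : j' ∈ u := by rw [hc, ← hjj, ← hc]; exact h1
      have h3 : j' ∈ s ∩ u := Finset.mem_inter.2 ⟨hj', h2⟩
      rw [hsu, Finset.mem_singleton] at h3
      exact h3.symm
    rw [← Finset.card_image_of_injOn hinj]
    refine card_le_of_shatters hd fun f => ?_
    obtain ⟨u, hu, hsu⟩ := hs (Finset.filter_subset (fun j => f (y j) = true) s)
    obtain ⟨c, hcC, hc⟩ := h𝒜 u hu
    refine ⟨c, hcC, fun x hx => ?_⟩
    obtain ⟨j, hj, rfl⟩ := Finset.mem_image.1 hx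
    have h1 := hc j
    have h2 : j ∈ u ↔ f (y j) = true := by
      have := Finset.ext_iff.1 hsu j
      simpa [hj] using this
    rw [Bool.eq_iff_iff, ← h1, h2]
  calc 𝒜.card ≤ 𝒜.shatterer.card := Finset.card_le_card_shatterer 𝒜
    _ ≤ ∑ k ∈ Finset.Iic 𝒜.vcDim, (Fintype.card (Fin m)).choose k :=
      Finset.card_shatterer_le_sum_vcDim
    _ ≤ ∑ k ∈ Finset.Iic d, m.choose k := by
      rw [Fintype.card_fin]
      exact Finset.sum_le_sum_of_subset (Finset.Iic_subset_Iic.2 hvc)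

/-- As x ≤ 1, multiplying the sum by x^d leaves at most ∑ x^k C(m,k) = (1 + x)^m ≤ exp(x m). Keeping
x free lets the packing bound make the term x m a small part of the logarithm being estimated. -/
lemma sum_choose_le_exp (d m : ℕ) {x : ℝ} (hx : 0 < x) (hx1 : x ≤ 1) :
    ((∑ k ∈ Finset.Iic d, m.choose k : ℕ) : ℝ) ≤ Real.exp (d * Real.log (1 / x) + x * m) := by
  have h1 : x ^ d * ((∑ k ∈ Finset.Iic d, m.choose k : ℕ) : ℝ) ≤ Real.exp (x * m) := by
    push_cast
    rw [Finset.mul_sum]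
    calc ∑ k ∈ Finset.Iic d, x ^ d * (m.choose k : ℝ)
        ≤ ∑ k ∈ Finset.Iic d, x ^ k * (m.choose k : ℝ) := by
          refine Finset.sum_le_sum fun k hk => ?_
          exact mul_le_mul_of_nonneg_right
            (pow_le_pow_of_le_one hx.le hx1 (Finset.mem_Iic.1 hk)) (Nat.cast_nonneg _)
      _ ≤ ∑ k ∈ Finset.range (m + d + 1), x ^ k * (m.choose k : ℝ) := by
          refine Finset.sum_le_sum_of_subset_of_nonneg (fun k hk => ?_) fun _ _ _ => by positivity
          rw [Finset.mem_Iic] at hk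
          rw [Finset.mem_range]
          omega
      _ = ∑ k ∈ Finset.range (m + 1), x ^ k * (m.choose k : ℝ) := by
          refine (Finset.sum_subset (fun k hk => ?_) fun k _ hk => ?_).symm
          · rw [Finset.mem_range] at hk ⊢
            omega
          · rw [Finset.mem_range, not_lt] at hk
            rw [Nat.choose_eq_zero_of_lt (by omega)]
            simp
      _ = (x + 1) ^ m := by rw [add_pow]; simp
      _ ≤ Real.exp x ^ m := by gcongr; exact Real.add_one_le_exp x
      _ = Real.exp (x * m) := by rw [← Real.exp_nat_mul, mul_comm]
  have h2 : Real.exp (d * Real.log (1 / x)) = (x ^ d)⁻¹ := by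
    rw [Real.exp_nat_mul, Real.exp_log (by positivity)]
    simp
  rw [Real.exp_add, h2, inv_mul_eq_div, le_div_iff₀ (by positivity), mul_comm]
  exact h1

variable {ι : Type*} [Fintype ι] [DecidableEq ι]

/-- The probabilistic method, phrased as counting: a random m-tuple of coordinates fails to separate
a given pair with probability at most exp(-ρm) ≤ |P|⁻², and there are fewer than |P|² ordered pairs
of distinct elements. -/
lemma exists_separating_sample (P : Finset (ι → Bool)) {ρ : ℝ}
    (hsep : ∀ a ∈ P, ∀ b ∈ P, a ≠ b → ρ * Fintype.card ι < hammingDist a b)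
    (hP : 2 ≤ P.card) {m : ℕ} (hm : 2 * Real.log P.card ≤ ρ * m) :
    ∃ t : Fin m → ι, ∀ a ∈ P, ∀ b ∈ P, (∀ j, a (t j) = b (t j)) → a = b := by
  by_contra! hcon
  have hM : (0 : ℝ) < P.card := by exact_mod_cast (by omega : 0 < P.card)
  have hN : 0 < Fintype.card ι := by
    obtain ⟨a, ha, b, hb, hab⟩ := Finset.one_lt_card.1 (by omega : 1 < P.card)
    obtain ⟨i, -⟩ := Function.ne_iff.1 hab
    exact Fintype.card_pos_iff.2 ⟨i⟩
  have hcov : (Finset.univ : Finset (Fin m → ι)) ⊆ P.offDiag.biUnion fun p =>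
      Fintype.piFinset fun _ : Fin m => Finset.univ.filter fun i => p.1 i = p.2 i := by
    intro t _
    obtain ⟨a, ha, b, hb, hab, hne⟩ := hcon t
    rw [Finset.mem_biUnion]
    refine ⟨(a, b), Finset.mem_offDiag.2 ⟨ha, hb, hne⟩, ?_⟩
    simpa [Fintype.mem_piFinset] using hab
  have hcard := (Finset.card_le_card hcov).trans Finset.card_biUnion_le
  simp only [Finset.card_univ, Fintype.card_fun, Fintype.card_fin, Fintype.card_piFinset_const]
    at hcard
  have hagree : ∀ p ∈ P.offDiag, (((Finset.univ.filter fun i => p.1 i = p.2 i).card ^ m : ℕ) : ℝ) ≤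
      Real.exp (-(ρ * m)) * (Fintype.card ι : ℝ) ^ m := by
    rintro ⟨a, b⟩ hp
    obtain ⟨ha, hb, hab⟩ := Finset.mem_offDiag.1 hp
    have h1 := hsep a ha b hb hab
    have h2 : (Finset.univ.filter fun i => a i = b i).card + hammingDist a b = Fintype.card ι := by
      rw [hammingDist, Finset.card_filter_add_card_filter_not, Finset.card_univ]
    have h3 : ((Finset.univ.filter fun i => a i = b i).card : ℝ) ≤
        Real.exp (-ρ) * Fintype.card ι := by
      have h4 : ((Finset.univ.filter fun i => a i = b i).card : ℝ) + hammingDist a b =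
        Fintype.card ι := by exact_mod_cast h2
      have h5 := Real.add_one_le_exp (-ρ)
      have h6 : (0 : ℝ) ≤ Fintype.card ι := Nat.cast_nonneg _
      nlinarith
    push_cast
    calc _ ≤ (Real.exp (-ρ) * Fintype.card ι) ^ m := by gcongr
      _ = _ := by rw [mul_pow, ← Real.exp_nat_mul]; ring_nf
  have hreal : (Fintype.card ι : ℝ) ^ m ≤
      (P.card * P.card - P.card : ℝ) * (Real.exp (-(ρ * m)) * (Fintype.card ι : ℝ) ^ m) := by
    calc ((Fintype.card ι : ℝ)) ^ m = ((Fintype.card ι ^ m : ℕ) : ℝ) := by push_cast; rfl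
      _ ≤ _ := Nat.cast_le.2 hcard
      _ ≤ _ := by
        rw [Nat.cast_sum]
        refine (Finset.sum_le_card_nsmul _ _ _ hagree).trans_eq ?_
        rw [nsmul_eq_mul, Finset.offDiag_card, Nat.cast_sub (Nat.le_mul_self _)]
        push_cast
        rfl
  have hexp : Real.exp (-(ρ * m)) ≤ ((P.card : ℝ) * P.card)⁻¹ := by
    rw [← Real.log_le_log_iff (Real.exp_pos _) (by positivity), Real.log_exp, Real.log_inv,
      Real.log_mul hM.ne' hM.ne']
    linarith
  have hpos : 0 < (Fintype.card ι : ℝ) ^ m := by positivity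
  have hlt : (P.card * P.card - P.card : ℝ) * Real.exp (-(ρ * m)) < 1 := by
    have h7 : (0 : ℝ) ≤ P.card * P.card - P.card := by
      have : (2 : ℝ) ≤ P.card := by exact_mod_cast hP
      nlinarith
    calc _ ≤ (P.card * P.card - P.card : ℝ) * ((P.card : ℝ) * P.card)⁻¹ := by gcongr
      _ < 1 := by
        rw [← div_eq_mul_inv, div_lt_one (by positivity)]
        linarith
  nlinarith

/-- A packing bound for the traces of a class of VC dimension `d`. -/
lemma card_packing_le (hd : vcDim C = d) (x : ι → X) (P : Finset (ι → Bool))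
    (htr : ∀ a ∈ P, ∃ c ∈ C, ∀ i, a i = c (x i)) {ρ : ℝ} (hρ : 0 < ρ) (hρ1 : ρ ≤ 1)
    (hsep : ∀ a ∈ P, ∀ b ∈ P, a ≠ b → ρ * Fintype.card ι < hammingDist a b) :
    (P.card : ℝ) ≤ Real.exp (2 * d * Real.log (8 / ρ)) := by
  have hlog : 0 ≤ Real.log (8 / ρ) := Real.log_nonneg (by rw [le_div_iff₀ hρ]; linarith)
  rcases Nat.lt_or_ge P.card 2 with hP | hP
  · refine le_trans ?_ (Real.one_le_exp (by positivity))
    exact_mod_cast Nat.lt_succ_iff.1 hP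
  have hM : (2 : ℝ) ≤ P.card := by exact_mod_cast hP
  have hlM : Real.log 2 ≤ Real.log P.card := Real.log_le_log (by norm_num) hM
  have hl2 := Real.log_two_gt_d9
  set m := ⌈2 * Real.log P.card / ρ⌉₊ with hm
  have hm1 : 2 * Real.log P.card ≤ ρ * m := by
    rw [mul_comm ρ, ← div_le_iff₀ hρ]
    exact Nat.le_ceil _
  have hm2 : ρ * m ≤ 2 * Real.log P.card + ρ := by
    have h := (Nat.ceil_lt_add_one (a := 2 * Real.log P.card / ρ) (by positivity)).le
    rw [← hm] at h
    calc ρ * m ≤ ρ * (2 * Real.log P.card / ρ + 1) := by gcongr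
      _ = _ := by field_simp
  obtain ⟨t, ht⟩ := exists_separating_sample P hsep hP hm1
  have hinj : Set.InjOn (fun a : ι → Bool => Finset.univ.filter fun j => a (t j) = true) P := by
    intro a ha b hb hab
    refine ht a ha b hb fun j => ?_
    have := Finset.ext_iff.1 hab j
    simp only [Finset.mem_filter, Finset.mem_univ, true_and] at this
    exact Bool.eq_iff_iff.2 this
  have hcard := card_traces_le hd (fun j => x (t j))
    (P.image fun a : ι → Bool => Finset.univ.filter fun j => a (t j) = true) (by
      intro A hA
      obtain ⟨a, ha, rfl⟩ := Finset.mem_image.1 hA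
      obtain ⟨c, hc, hac⟩ := htr a ha
      exact ⟨c, hc, fun j => by simp [hac]⟩)
  rw [Finset.card_image_of_injOn hinj] at hcard
  -- With x = ρ/8 the term x m is at most log|P|/4 + 1/8. The first part is absorbed on the left,
  -- and log|P| ≥ log 2 absorbs the 1/8.
  have h1 : (P.card : ℝ) ≤ _ := (Nat.cast_le.2 hcard).trans
    (sum_choose_le_exp d m (x := ρ / 8) (by positivity) (by linarith))
  rw [one_div_div] at h1
  rw [← Real.log_le_log_iff (by positivity) (Real.exp_pos _), Real.log_exp] at h1 ⊢
  nlinarith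

/-- A net of controlled size of the traces of a class of VC dimension `d`. -/
lemma exists_net (hd : vcDim C = d) (x : ι → X) (F : Finset (ι → Bool))
    (htr : ∀ a ∈ F, ∃ c ∈ C, ∀ i, a i = c (x i)) {ρ : ℝ} (hρ : 0 < ρ) (hρ1 : ρ ≤ 1) :
    ∃ (P : Finset (ι → Bool)) (π : (ι → Bool) → ι → Bool), P ⊆ F ∧
      (∀ a ∈ F, π a ∈ P ∧ (hammingDist (π a) a : ℝ) ≤ ρ * Fintype.card ι) ∧
      (P.card : ℝ) ≤ Real.exp (2 * d * Real.log (8 / ρ)) := by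
  classical
  -- A separated family of maximal size is a net, since a trace far from all its members could be
  -- added to it.
  obtain ⟨P, hP, hmax⟩ := Finset.exists_max_image
    (F.powerset.filter fun P => ∀ a ∈ P, ∀ b ∈ P, a ≠ b →
      ρ * Fintype.card ι < hammingDist a b) Finset.card ⟨∅, by simp⟩
  rw [Finset.mem_filter, Finset.mem_powerset] at hP
  have hnear : ∀ a ∈ F, ∃ b ∈ P, (hammingDist b a : ℝ) ≤ ρ * Fintype.card ι := by
    intro a ha
    by_contra! hfar
    have haP : a ∉ P := fun h => by
      have := hfar a h
      rw [hammingDist_self, Nat.cast_zero] at this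
      exact absurd this (not_lt.2 (by positivity))
    have := hmax (insert a P) (by
      rw [Finset.mem_filter, Finset.mem_powerset]
      refine ⟨Finset.insert_subset ha hP.1, ?_⟩
      intro b hb c hc hbc
      rcases Finset.mem_insert.1 hb with hba | hbP <;>
        rcases Finset.mem_insert.1 hc with hca | hcP
      · exact absurd (hba.trans hca.symm) hbc
      · rw [hammingDist_comm, hba]; exact hfar c hcP
      · rw [hca]; exact hfar b hbP
      · exact hP.2 b hbP c hcP hbc)
    rw [Finset.card_insert_of_notMem haP] at this
    omega
  choose! π hπ using hnear
  exact ⟨P, π, hP.1, hπ, card_packing_le hd x P (fun a ha => htr a (hP.1 ha)) hρ hρ1 hP.2⟩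

end Traces

/-! ### Rademacher sums -/

/-- Exponential Markov with cosh x ≤ exp(x²/2). The parameter l stays free because the base of the
chain and its links choose it differently. -/
lemma card_rademacher_ge_le {ι : Type*} [Fintype ι] [DecidableEq ι] (v : ι → ℝ) {V s l : ℝ}
    (hV : ∑ i, v i ^ 2 ≤ V) (hl : 0 ≤ l) :
    ((Finset.univ.filter fun σ : ι → Bool => s ≤ ∑ i, (sgn (σ i) : ℝ) * v i).card : ℝ) ≤
      2 ^ Fintype.card ι * Real.exp (l ^ 2 * V / 2 - l * s) := by
  have hmgf : ∑ σ : ι → Bool, Real.exp (l * ∑ i, (sgn (σ i) : ℝ) * v i) ≤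
      2 ^ Fintype.card ι * Real.exp (l ^ 2 * V / 2) := by
    calc ∑ σ : ι → Bool, Real.exp (l * ∑ i, (sgn (σ i) : ℝ) * v i)
        = ∑ σ : ι → Bool, ∏ i, Real.exp (l * ((sgn (σ i) : ℝ) * v i)) := by
          refine Finset.sum_congr rfl fun σ _ => ?_
          rw [Finset.mul_sum, Real.exp_sum]
      _ = ∏ i, ∑ b : Bool, Real.exp (l * ((sgn b : ℝ) * v i)) :=
          (Fintype.prod_sum fun i (b : Bool) => Real.exp (l * ((sgn b : ℝ) * v i))).symm
      _ ≤ ∏ i, (2 * Real.exp ((l * v i) ^ 2 / 2)) := by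
          refine Finset.prod_le_prod (fun i _ => by positivity) fun i _ => ?_
          have h := Real.cosh_le_exp_half_sq (l * v i)
          rw [Real.cosh_eq] at h
          simp only [Fintype.sum_bool, sgn]
          norm_num
          linarith
      _ = 2 ^ Fintype.card ι * Real.exp (l ^ 2 * (∑ i, v i ^ 2) / 2) := by
          rw [Finset.prod_mul_distrib, Finset.prod_const, Finset.card_univ, ← Real.exp_sum]
          congr 2
          rw [Finset.mul_sum, Finset.sum_div]
          exact Finset.sum_congr rfl fun i _ => by ring
      _ ≤ _ := by gcongr
  have hmarkov : ((Finset.univ.filter fun σ : ι → Bool =>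
      s ≤ ∑ i, (sgn (σ i) : ℝ) * v i).card : ℝ) * Real.exp (l * s) ≤
      ∑ σ : ι → Bool, Real.exp (l * ∑ i, (sgn (σ i) : ℝ) * v i) := by
    rw [← nsmul_eq_mul]
    refine (Finset.card_nsmul_le_sum _ _ _ fun σ hσ => ?_).trans
      (Finset.sum_le_sum_of_subset_of_nonneg (Finset.filter_subset _ _) fun _ _ _ => by positivity)
    have := (Finset.mem_filter.1 hσ).2
    gcongr
  rw [Real.exp_sub, mul_div_assoc', le_div_iff₀ (Real.exp_pos _)]
  exact hmarkov.trans hmgf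

/-! ### Chaining over the traces of a class on a double sample -/

/-- The indicator of a Boolean, as a real number. -/
def ind (b : Bool) : ℝ := if b then 1 else 0

lemma ind_nonneg (b : Bool) : 0 ≤ ind b := by cases b <;> simp [ind]

lemma ind_le_one (b : Bool) : ind b ≤ 1 := by cases b <;> simp [ind]

/-- For e ≤ a take l = a/3: then l²W/2 cancels l·(a/6)W exactly and -aen/36 is left. For a ≤ e take
l = e/24 and use W ≤ 2n. Either exponent is of order e(a + e)n. -/
lemma card_base_le {n : ℕ} {a e W : ℝ} (ha : 0 ≤ a) (he : 0 < e) (v : Fin n → ℝ)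
    (hv : ∑ i, v i ^ 2 ≤ W) (hW : W ≤ 2 * n) :
    ((Finset.univ.filter fun σ : Fin n → Bool =>
      a / 6 * W + e / 12 * n ≤ ∑ i, (sgn (σ i) : ℝ) * v i).card : ℝ) ≤
      2 ^ n * Real.exp (-(e * (a + e) * n) / 1152) := by
  have hn : (0 : ℝ) ≤ n := Nat.cast_nonneg n
  have hW0 : 0 ≤ W := (Finset.sum_nonneg fun i _ => sq_nonneg (v i)).trans hv
  rcases le_total e a with h | h
  · refine (card_rademacher_ge_le v hv (l := a / 3) (by positivity)).trans ?_
    rw [Fintype.card_fin]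
    gcongr
    have : 0 ≤ (a - e) * (e * n) := mul_nonneg (by linarith) (by positivity)
    have : 0 ≤ a * e * n := by positivity
    nlinarith
  · refine (card_rademacher_ge_le v hv (l := e / 24) (by positivity)).trans ?_
    rw [Fintype.card_fin]
    gcongr
    have h1 : 0 ≤ (e - a) * (e * n) := mul_nonneg (by linarith) (by positivity)
    have h2 : 0 ≤ e ^ 2 * (2 * n - W) := mul_nonneg (by positivity) (by linarith)
    have h3 : 0 ≤ e * a * W := by positivity
    nlinarith

/-- The choice of l is threshold over variance bound. The variance falls like 2^(-k) but the squared
threshold only like (9/16)^k, so the exponent grows like (9/8)^k ≥ 1 + k/8. This outweighs the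
logarithms of the net sizes, which grow linearly in k. -/
lemma card_level_le {n : ℕ} {a e : ℝ} (ha : 0 ≤ a) (he : 0 < e) (k : ℕ) (v : Fin n → ℝ)
    (hv : ∑ i, v i ^ 2 ≤ 42 * (e / (28 * (a + e)) / 2 ^ k) * n) :
    ((Finset.univ.filter fun σ : Fin n → Bool =>
      e / 24 * (3 / 4) ^ k * n ≤ ∑ i, (sgn (σ i) : ℝ) * v i).card : ℝ) ≤
      2 ^ n * Real.exp (-(e * (a + e) * n) / 1728 * (1 + k / 8)) := by
  have hae : 0 < a + e := by linarith
  refine (card_rademacher_ge_le v hv (l := (a + e) * (3 / 2) ^ k / 36) (by positivity)).trans ?_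
  rw [Fintype.card_fin]
  gcongr
  have h1 : (1 : ℝ) + k / 8 ≤ (9 / 8) ^ k := by
    have := one_add_mul_le_pow (a := (1 / 8 : ℝ)) (by norm_num) k
    norm_num at this ⊢
    linarith
  have h2 : ((a + e) * (3 / 2) ^ k / 36) ^ 2 * (42 * (e / (28 * (a + e)) / 2 ^ k) * n) / 2 -
      (a + e) * (3 / 2) ^ k / 36 * (e / 24 * (3 / 4) ^ k * n) =
      -(e * (a + e) * n) / 1728 * (9 / 8) ^ k := by
    have h3 : (9 / 8 : ℝ) ^ k = (3 / 2) ^ k * (3 / 4) ^ k := by rw [← mul_pow]; norm_num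
    have h4 : ((3 / 2 : ℝ) ^ k) ^ 2 / 2 ^ k = (3 / 2) ^ k * (3 / 4) ^ k := by
      rw [← pow_mul, mul_comm k 2, pow_mul, ← div_pow, ← mul_pow]; norm_num
    rw [h3]
    calc _ = (a + e) * e * n / 1728 * (2 * ((((3 / 2 : ℝ) ^ k) ^ 2 / 2 ^ k) / 2) -
          2 * ((3 / 2) ^ k * (3 / 4) ^ k)) := by field_simp; ring
      _ = _ := by rw [h4]; ring
  rw [h2]
  have : 0 ≤ e * (a + e) * n := by positivity
  nlinarith

/-- The argument of the logarithm is 224·2^k·(1 + a/e), with 224 ≤ 2^8 and both 2 and 1 + a/e at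
most 2 + a/e. -/
lemma two_mul_log_net_le {d : ℕ} {a e : ℝ} (ha : 0 ≤ a) (he : 0 < e) (k : ℕ) :
    2 * d * Real.log (8 / (e / (28 * (a + e)) / 2 ^ k)) ≤
      2 * (d * Real.log (2 + a / e)) * (k + 9) := by
  have hae : 0 < a + e := by linarith
  have h1 : 8 / (e / (28 * (a + e)) / 2 ^ k) = 224 * 2 ^ k * ((a + e) / e) := by
    field_simp; ring
  have h0 : (a + e) / e = 1 + a / e := by field_simp; ring
  have hr : 0 ≤ a / e := by positivity
  have h2 : Real.log (8 / (e / (28 * (a + e)) / 2 ^ k)) ≤ Real.log (2 + a / e) * (k + 9) := by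
    rw [h1, h0, Real.log_mul (by positivity) (by positivity), Real.log_mul (by positivity)
      (by positivity), Real.log_pow]
    have h3 : Real.log 224 ≤ 8 * Real.log 2 := by
      rw [← Real.log_rpow (by norm_num)]
      exact Real.log_le_log (by norm_num) (by norm_num)
    have h4 : Real.log 2 ≤ Real.log (2 + a / e) := Real.log_le_log (by norm_num) (by linarith)
    have h5 : Real.log (1 + a / e) ≤ Real.log (2 + a / e) :=
      Real.log_le_log (by linarith) (by linarith)
    have h6 : (0 : ℝ) ≤ k := Nat.cast_nonneg k
    nlinarith
  have hd : (0 : ℝ) ≤ d := Nat.cast_nonneg d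
  nlinarith

section Chaining
variable {n : ℕ} (ψ : Fin n ⊕ Fin n → (Fin 7 → Bool) → Bool)

/-- The indicator vector on the double sample of a tuple of traces combined by `ψ`. -/
def combined (b : Fin 7 → Fin n ⊕ Fin n → Bool) (q : Fin n ⊕ Fin n) : ℝ :=
  ind (ψ q fun j => b j q)

/-- The difference between the two halves of the combined indicator vector. -/
def halfDiff (b : Fin 7 → Fin n ⊕ Fin n → Bool) (i : Fin n) : ℝ :=
  combined ψ b (.inr i) - combined ψ b (.inl i)

/-- The Hamming distance of tuples. -/
def tupleDist (b b' : Fin 7 → Fin n ⊕ Fin n → Bool) : ℕ := ∑ j, hammingDist (b j) (b' j)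

lemma abs_combined_sub_le (b b' : Fin 7 → Fin n ⊕ Fin n → Bool) (q : Fin n ⊕ Fin n) :
    |combined ψ b q - combined ψ b' q| ≤ ∑ j, if b j q ≠ b' j q then (1 : ℝ) else 0 := by
  by_cases h : ∀ j, b j q = b' j q
  · simp [combined, h]
  · push Not at h
    obtain ⟨j, hj⟩ := h
    have h1 : |combined ψ b q - combined ψ b' q| ≤ 1 := by
      unfold combined
      rw [abs_le]
      constructor <;> linarith [ind_nonneg (ψ q fun j => b j q), ind_le_one (ψ q fun j => b j q),
        ind_nonneg (ψ q fun j => b' j q), ind_le_one (ψ q fun j => b' j q)]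
    refine h1.trans ?_
    calc (1 : ℝ) = if b j q ≠ b' j q then (1 : ℝ) else 0 := by rw [if_pos hj]
      _ ≤ _ := Finset.single_le_sum (f := fun j => if b j q ≠ b' j q then (1 : ℝ) else 0)
        (fun _ _ => by split_ifs <;> norm_num) (Finset.mem_univ j)

lemma sum_abs_combined_sub_le (b b' : Fin 7 → Fin n ⊕ Fin n → Bool) :
    ∑ q, |combined ψ b q - combined ψ b' q| ≤ tupleDist b b' := by
  calc _ ≤ ∑ q, ∑ j, (if b j q ≠ b' j q then (1 : ℝ) else 0) :=
        Finset.sum_le_sum fun q _ => abs_combined_sub_le ψ b b' q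
    _ = tupleDist b b' := by
        rw [Finset.sum_comm, tupleDist, Nat.cast_sum]
        refine Finset.sum_congr rfl fun j _ => ?_
        rw [hammingDist, Finset.sum_boole]

lemma sum_combined_le (b b' : Fin 7 → Fin n ⊕ Fin n → Bool) :
    ∑ q, combined ψ b q ≤ ∑ q, combined ψ b' q + tupleDist b b' := by
  have h := sum_abs_combined_sub_le ψ b b'
  have h2 : ∑ q, (combined ψ b q - combined ψ b' q) ≤ ∑ q, |combined ψ b q - combined ψ b' q| :=
    Finset.sum_le_sum fun q _ => le_abs_self _
  rw [Finset.sum_sub_distrib] at h2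
  linarith

/-- Each half difference is -1, 0 or 1, so its square is at most the sum of the two indicators.
Bounding the variance by the number of errors is what makes the deviation relative. -/
lemma sum_sq_halfDiff_le (b : Fin 7 → Fin n ⊕ Fin n → Bool) :
    ∑ i, halfDiff ψ b i ^ 2 ≤ ∑ q, combined ψ b q := by
  rw [Fintype.sum_sum_type, ← Finset.sum_add_distrib]
  refine Finset.sum_le_sum fun i _ => ?_
  unfold halfDiff combined
  generalize ψ (.inr i) _ = y
  generalize ψ (.inl i) _ = z
  cases y <;> cases z <;> norm_num [ind]

/-- The differences are at most 2 in absolute value, so a square costs at most a factor 2 over the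
absolute value. -/
lemma sum_sq_halfDiff_sub_le (b b' : Fin 7 → Fin n ⊕ Fin n → Bool) :
    ∑ i, (halfDiff ψ b i - halfDiff ψ b' i) ^ 2 ≤ 2 * (tupleDist b b' : ℝ) := by
  have h := sum_abs_combined_sub_le ψ b b'
  rw [Fintype.sum_sum_type, ← Finset.sum_add_distrib] at h
  refine le_trans ?_ (mul_le_mul_of_nonneg_left h zero_le_two)
  rw [Finset.mul_sum]
  refine Finset.sum_le_sum fun i _ => ?_
  unfold halfDiff combined
  generalize ψ (.inr i) (fun j => b j (.inr i)) = y
  generalize ψ (.inl i) (fun j => b j (.inl i)) = z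
  generalize ψ (.inr i) (fun j => b' j (.inr i)) = y'
  generalize ψ (.inl i) (fun j => b' j (.inl i)) = z'
  cases y <;> cases z <;> cases y' <;> cases z' <;> norm_num [ind]

lemma sum_combined_le_two_mul (b : Fin 7 → Fin n ⊕ Fin n → Bool) :
    ∑ q, combined ψ b q ≤ 2 * n := by
  calc ∑ q, combined ψ b q ≤ ∑ _q : Fin n ⊕ Fin n, (1 : ℝ) :=
        Finset.sum_le_sum fun q _ => ind_le_one _
    _ = 2 * n := by simp; ring

lemma tupleDist_triangle (b b' b'' : Fin 7 → Fin n ⊕ Fin n → Bool) :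
    tupleDist b b'' ≤ tupleDist b b' + tupleDist b' b'' := by
  rw [tupleDist, tupleDist, tupleDist, ← Finset.sum_add_distrib]
  exact Finset.sum_le_sum fun j _ => hammingDist_triangle _ _ _

lemma tupleDist_comm (b b' : Fin 7 → Fin n ⊕ Fin n → Bool) : tupleDist b b' = tupleDist b' b :=
  Finset.sum_congr rfl fun _ _ => hammingDist_comm _ _

lemma tupleDist_map_le {π : (Fin n ⊕ Fin n → Bool) → Fin n ⊕ Fin n → Bool} {ρ : ℝ}
    {b : Fin 7 → Fin n ⊕ Fin n → Bool} (h : ∀ j, (hammingDist (π (b j)) (b j) : ℝ) ≤ ρ) :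
    (tupleDist (fun j => π (b j)) b : ℝ) ≤ 7 * ρ := by
  rw [tupleDist, Nat.cast_sum]
  calc _ ≤ ∑ _j : Fin 7, ρ := Finset.sum_le_sum fun j _ => h j
    _ = _ := by simp

/-- If all net points and all links between nets of consecutive levels behave, then so does every
tuple of traces. -/
lemma chain_lt {a e : ℝ} (ha : 0 ≤ a) (he : 0 < e) (hn : 0 < n) (F : Finset (Fin n ⊕ Fin n → Bool))
    (P : ℕ → Finset (Fin n ⊕ Fin n → Bool))
    (π : ℕ → (Fin n ⊕ Fin n → Bool) → Fin n ⊕ Fin n → Bool)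
    (hπ : ∀ k, ∀ b ∈ F, π k b ∈ P k ∧
      (hammingDist (π k b) b : ℝ) ≤ e / (28 * (a + e)) / 2 ^ k * (2 * n)) (m : ℕ)
    (hm : e / (28 * (a + e)) / 2 ^ m * (2 * n) < 1) (σ : Fin n → Bool)
    (hbase : ∀ b ∈ Fintype.piFinset fun _ : Fin 7 => P 0,
      ∑ i, (sgn (σ i) : ℝ) * halfDiff ψ b i < a / 6 * ∑ q, combined ψ b q + e / 12 * n)
    (hlink : ∀ k < m, ∀ b ∈ Fintype.piFinset fun _ : Fin 7 => P k,
      ∀ b' ∈ Fintype.piFinset fun _ : Fin 7 => P (k + 1),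
      ∑ i, (halfDiff ψ b' i - halfDiff ψ b i) ^ 2 ≤ 42 * (e / (28 * (a + e)) / 2 ^ k) * n →
      ∑ i, (sgn (σ i) : ℝ) * (halfDiff ψ b' i - halfDiff ψ b i) < e / 24 * (3 / 4) ^ k * n)
    (b : Fin 7 → Fin n ⊕ Fin n → Bool) (hb : ∀ j, b j ∈ F) :
    ∑ i, (sgn (σ i) : ℝ) * halfDiff ψ b i < a / 6 * ∑ q, combined ψ b q + e / 3 * n := by
  have hae : 0 < a + e := by linarith
  have hn' : (0 : ℝ) < n := by exact_mod_cast hn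
  set p : ℕ → Fin 7 → Fin n ⊕ Fin n → Bool := fun k j => π k (b j) with hp
  have hmem : ∀ k, p k ∈ Fintype.piFinset fun _ : Fin 7 => P k := fun k =>
    Fintype.mem_piFinset.2 fun j => (hπ k _ (hb j)).1
  have hdist : ∀ k, (tupleDist (p k) b : ℝ) ≤ 7 * (e / (28 * (a + e)) / 2 ^ k * (2 * n)) := fun k =>
    tupleDist_map_le fun j => (hπ k _ (hb j)).2
  -- The net radius at level m is below one, so the chain ends at the traces themselves.
  have hend : p m = b := by
    funext j
    have h := ((hπ m _ (hb j)).2).trans_lt hm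
    have h0 : hammingDist (π m (b j)) (b j) = 0 := by
      have : hammingDist (π m (b j)) (b j) < 1 := by exact_mod_cast h
      omega
    exact hammingDist_eq_zero.1 h0
  have hind : ∀ k ≤ m, ∑ i, (sgn (σ i) : ℝ) * halfDiff ψ (p k) i <
      a / 6 * ∑ q, combined ψ (p 0) q + e / 12 * n + e / 6 * n * (1 - (3 / 4) ^ k) := by
    intro k
    induction k with
    | zero => intro _; simpa using hbase _ (hmem 0)
    | succ k ih =>
      intro hk
      have h1 := ih (by omega)
      -- The constant 42 is 2·7·(1 + 1/2)·2: the factor of `sum_sq_halfDiff_sub_le`, the seven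
      -- traces, the radii of two consecutive levels, and the 2n coordinates.
      have hsq : ∑ i, (halfDiff ψ (p (k + 1)) i - halfDiff ψ (p k) i) ^ 2 ≤
          42 * (e / (28 * (a + e)) / 2 ^ k) * n := by
        refine (sum_sq_halfDiff_sub_le ψ _ _).trans ?_
        have h3 : (tupleDist (p (k + 1)) (p k) : ℝ) ≤
            tupleDist (p (k + 1)) b + tupleDist (p k) b := by
          rw [tupleDist_comm (p k) b]
          exact_mod_cast tupleDist_triangle _ _ _
        have h4 := hdist k
        have h5 := hdist (k + 1)
        have h6 : e / (28 * (a + e)) / 2 ^ (k + 1) = e / (28 * (a + e)) / 2 ^ k / 2 := by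
          rw [pow_succ, div_div, div_div, div_div]
        rw [h6] at h5
        linarith
      have h2 := hlink k (by omega) _ (hmem k) _ (hmem (k + 1)) hsq
      simp only [mul_sub, Finset.sum_sub_distrib] at h2
      rw [pow_succ]
      linarith
  have hfin := hind m le_rfl
  rw [hend] at hfin
  have hW := sum_combined_le ψ (p 0) b
  have h0 := hdist 0
  -- The coarsest radius is chosen for this: replacing the weight of the base point by that of b
  -- costs only (e/12)n. With the base threshold e/12 and the links, which sum to at most e/6, the
  -- total is e/3.
  have h7 : a / 6 * (7 * (e / (28 * (a + e)) / 2 ^ 0 * (2 * n))) ≤ e / 12 * n := by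
    have : a / (a + e) ≤ 1 := (div_le_one hae).2 (by linarith)
    calc a / 6 * (7 * (e / (28 * (a + e)) / 2 ^ 0 * (2 * n))) = a / (a + e) * (e / 12 * n) := by
          field_simp; ring
      _ ≤ 1 * (e / 12 * n) := by gcongr
      _ = _ := one_mul _
  have h8 : a / 6 * ∑ q, combined ψ (p 0) q ≤ a / 6 * ∑ q, combined ψ b q + e / 12 * n := by
    have := mul_le_mul_of_nonneg_left (hW.trans (add_le_add_right h0 _))
      (by positivity : 0 ≤ a / 6)
    linarith
  have h9 : 0 ≤ e / 6 * n * (3 / 4) ^ m := by positivity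
  linarith

variable {X : Type*} {C : Set (X → Bool)} {d : ℕ}

/-- The fraction of the sign vectors for which the relative deviation of some combination of
concepts on the double sample is large. -/
lemma card_deviating_signs_le (hd : vcDim C = d) (hd1 : 1 ≤ d) (hn : 0 < n)
    (x : Fin n ⊕ Fin n → X) {a e l : ℝ} (ha : 0 ≤ a) (he : 0 < e) (hl : 0 ≤ l)
    (hN : 691200 * (d * Real.log (2 + a / e) + l) ≤ e * (a + e) * n)
    (bad : Finset (Fin n → Bool))
    (hbad : ∀ σ ∈ bad, ∃ c : Fin 7 → X → Bool, (∀ j, c j ∈ C) ∧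
      a / 6 * ∑ q, combined ψ (fun j q => c j (x q)) q + e / 3 * n ≤
        ∑ i, (sgn (σ i) : ℝ) * halfDiff ψ (fun j q => c j (x q)) i) :
    (bad.card : ℝ) ≤ 2 ^ n * (Real.exp (-l) / 8) := by
  classical
  have hae : 0 < a + e := by linarith
  have hn' : (0 : ℝ) < n := by exact_mod_cast hn
  set F : Finset (Fin n ⊕ Fin n → Bool) :=
    Finset.univ.filter fun b => ∃ c ∈ C, ∀ q, b q = c (x q) with hF
  have hnet := fun k : ℕ => exists_net (ρ := e / (28 * (a + e)) / 2 ^ k) hd x F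
    (fun b hb => (Finset.mem_filter.1 hb).2) (by positivity) (by
      rw [div_le_one (by positivity), div_le_iff₀ (by positivity)]
      have : (1 : ℝ) ≤ 2 ^ k := one_le_pow₀ (by norm_num)
      nlinarith)
  choose P π _ hπ hcard using hnet
  have hcardι : (Fintype.card (Fin n ⊕ Fin n) : ℝ) = 2 * n := by simp; ring
  rw [hcardι] at hπ
  obtain ⟨m, hm⟩ : ∃ m : ℕ, e / (28 * (a + e)) / 2 ^ m * (2 * n) < 1 := by
    obtain ⟨m, hm⟩ := pow_unbounded_of_one_lt (e / (28 * (a + e)) * (2 * n)) (one_lt_two (α := ℝ))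
    refine ⟨m, ?_⟩
    rw [div_mul_eq_mul_div, div_lt_one (by positivity)]
    exact hm
  set L := d * Real.log (2 + a / e) with hL
  have hL0 : 0.69 ≤ L := by
    have h1 : Real.log 2 ≤ Real.log (2 + a / e) :=
      Real.log_le_log (by norm_num) (by have : 0 ≤ a / e := by positivity
                                        linarith)
    have h2 : (1 : ℝ) ≤ d := by exact_mod_cast hd1
    have := Real.log_two_gt_d9
    nlinarith
  -- The nets are taken for C and used in 7-tuples, which multiplies the exponent 2 by 7; the VC
  -- dimension of the class of majorities is never needed.
  have hcardN : ∀ k, ((Fintype.piFinset fun _ : Fin 7 => P k).card : ℝ) ≤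
      Real.exp (14 * L * (k + 9)) := by
    intro k
    rw [Fintype.card_piFinset_const, Nat.cast_pow]
    calc ((P k).card : ℝ) ^ 7 ≤ Real.exp (2 * L * (k + 9)) ^ 7 := by
          gcongr
          exact (hcard k).trans (Real.exp_le_exp.2 (two_mul_log_net_le ha he k))
      _ = _ := by rw [← Real.exp_nat_mul]; push_cast; ring_nf
  set B0 : Finset (Fin n → Bool) := (Fintype.piFinset fun _ : Fin 7 => P 0).biUnion fun b =>
    Finset.univ.filter fun σ => a / 6 * ∑ q, combined ψ b q + e / 12 * n ≤
      ∑ i, (sgn (σ i) : ℝ) * halfDiff ψ b i with hB0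
  set B : ℕ → Finset (Fin n → Bool) := fun k =>
    (((Fintype.piFinset fun _ : Fin 7 => P k) ×ˢ (Fintype.piFinset fun _ : Fin 7 => P (k + 1))).filter
      fun p => ∑ i, (halfDiff ψ p.2 i - halfDiff ψ p.1 i) ^ 2 ≤
        42 * (e / (28 * (a + e)) / 2 ^ k) * n).biUnion fun p =>
      Finset.univ.filter fun σ => e / 24 * (3 / 4) ^ k * n ≤
        ∑ i, (sgn (σ i) : ℝ) * (halfDiff ψ p.2 i - halfDiff ψ p.1 i) with hB
  have hsub : bad ⊆ B0 ∪ (Finset.range m).biUnion B := by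
    intro σ hσ
    by_contra hnot
    rw [Finset.mem_union, not_or] at hnot
    obtain ⟨c, hc, hdev⟩ := hbad σ hσ
    refine absurd hdev (not_le.2 (chain_lt ψ ha he hn F P π hπ m hm σ ?_ ?_ _ fun j => ?_))
    · intro b hb
      by_contra hcon
      exact hnot.1 (Finset.mem_biUnion.2 ⟨b, hb, by simpa using hcon⟩)
    · intro k hk b hb b' hb' hsq
      by_contra hcon
      refine hnot.2 (Finset.mem_biUnion.2 ⟨k, Finset.mem_range.2 hk, Finset.mem_biUnion.2
        ⟨(b, b'), Finset.mem_filter.2 ⟨Finset.mem_product.2 ⟨hb, hb'⟩, hsq⟩, by simpa using hcon⟩⟩)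
    · exact Finset.mem_filter.2 ⟨Finset.mem_univ _, c j, hc j, fun _ => rfl⟩
  have hB0card : (B0.card : ℝ) ≤ 2 ^ n * (Real.exp (-l) / 16) := by
    have h1 : (B0.card : ℝ) ≤ ∑ b ∈ Fintype.piFinset fun _ : Fin 7 => P 0,
        2 ^ n * Real.exp (-(e * (a + e) * n) / 1152) := by
      refine (Nat.cast_le.2 Finset.card_biUnion_le).trans ?_
      rw [Nat.cast_sum]
      exact Finset.sum_le_sum fun b _ => card_base_le ha he _ (sum_sq_halfDiff_le ψ b)
        (sum_combined_le_two_mul ψ b)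
    rw [Finset.sum_const, nsmul_eq_mul] at h1
    calc (B0.card : ℝ) ≤ Real.exp (14 * L * ((0 : ℕ) + 9)) *
          (2 ^ n * Real.exp (-(e * (a + e) * n) / 1152)) := by
          refine h1.trans ?_
          gcongr
          exact hcardN 0
      _ = 2 ^ n * Real.exp (14 * L * ((0 : ℕ) + 9) + -(e * (a + e) * n) / 1152) := by
          rw [Real.exp_add]; ring
      _ ≤ 2 ^ n * Real.exp (-l + -(4 : ℕ)) := by
          refine mul_le_mul_of_nonneg_left (Real.exp_le_exp.2 ?_) (by positivity)
          push_cast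
          linarith
      _ ≤ _ := by
          rw [Real.exp_add, Real.exp_neg ((4 : ℕ) : ℝ), ← Real.exp_one_pow]
          have h3 : (16 : ℝ) ≤ Real.exp 1 ^ 4 := by
            calc (16 : ℝ) = 2 ^ 4 := by norm_num
              _ ≤ _ := by gcongr; linarith [Real.exp_one_gt_d9]
          rw [← div_eq_mul_inv]
          gcongr
  have hBcard : ∀ k, ((B k).card : ℝ) ≤ 2 ^ n * (Real.exp (-l) / 32 * (1 / 2) ^ k) := by
    intro k
    have h1 : ((B k).card : ℝ) ≤ (((Fintype.piFinset fun _ : Fin 7 => P k) ×ˢ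
        (Fintype.piFinset fun _ : Fin 7 => P (k + 1))).card : ℝ) *
        (2 ^ n * Real.exp (-(e * (a + e) * n) / 1728 * (1 + k / 8))) := by
      refine (Nat.cast_le.2 Finset.card_biUnion_le).trans ?_
      rw [Nat.cast_sum]
      refine (Finset.sum_le_card_nsmul _ _ _ fun p hp =>
        card_level_le ha he k _ (Finset.mem_filter.1 hp).2).trans ?_
      rw [nsmul_eq_mul]
      gcongr
      exact Finset.filter_subset _ _
    rw [Finset.card_product, Nat.cast_mul] at h1
    calc ((B k).card : ℝ) ≤ (Real.exp (14 * L * (k + 9)) * Real.exp (14 * L * ((k + 1 : ℕ) + 9))) *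
          (2 ^ n * Real.exp (-(e * (a + e) * n) / 1728 * (1 + k / 8))) := by
          refine h1.trans ?_
          gcongr
          · exact hcardN k
          · exact hcardN (k + 1)
      _ = 2 ^ n * Real.exp (14 * L * (k + 9) + 14 * L * ((k + 1 : ℕ) + 9) +
          -(e * (a + e) * n) / 1728 * (1 + k / 8)) := by
          rw [Real.exp_add, Real.exp_add]; ring
      _ ≤ 2 ^ n * Real.exp (-l + -((k + 5 : ℕ) : ℝ)) := by
          refine mul_le_mul_of_nonneg_left (Real.exp_le_exp.2 ?_) (by positivity)
          push_cast
          have hk : (0 : ℝ) ≤ k := Nat.cast_nonneg k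
          -- Here 400 = 691200/1728. Of (400 + 50k)L the two nets use (266 + 28k)L, and by L ≥ 0.69
          -- the rest exceeds the k + 5 that makes the levels summable.
          have h2 : 400 * (L + l) * (1 + k / 8) ≤ e * (a + e) * n / 1728 * (1 + k / 8) := by
            gcongr
            linarith
          have h3 : 0 ≤ k * (L - 0.69) := mul_nonneg hk (by linarith)
          have h4 : 0 ≤ k * l := mul_nonneg hk hl
          have h5 : -(e * (a + e) * n) / 1728 * (1 + (k : ℝ) / 8) =
            -(e * (a + e) * n / 1728 * (1 + k / 8)) := by ring
          rw [h5]
          nlinarith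
      _ ≤ _ := by
          rw [Real.exp_add, Real.exp_neg ((k + 5 : ℕ) : ℝ), ← Real.exp_one_pow]
          have h3 : (32 : ℝ) * 2 ^ k ≤ Real.exp 1 ^ (k + 5) := by
            calc (32 : ℝ) * 2 ^ k = 2 ^ (k + 5) := by rw [pow_add]; norm_num; ring
              _ ≤ _ := by gcongr; linarith [Real.exp_one_gt_d9]
          have h4 : Real.exp (-l) / 32 * (1 / 2) ^ k = Real.exp (-l) / (32 * 2 ^ k) := by
            rw [one_div, inv_pow]; field_simp
          rw [← div_eq_mul_inv, h4]
          gcongr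
  have hgeom : ∑ k ∈ Finset.range m, (1 / 2 : ℝ) ^ k ≤ 2 := by
    rw [geom_sum_eq (by norm_num), div_le_iff_of_neg (by norm_num)]
    have : (0 : ℝ) ≤ (1 / 2) ^ m := by positivity
    linarith
  calc (bad.card : ℝ) ≤ ((B0.card + ∑ k ∈ Finset.range m, (B k).card : ℕ) : ℝ) := by
        refine Nat.cast_le.2 ((Finset.card_le_card hsub).trans ((Finset.card_union_le _ _).trans ?_))
        exact Nat.add_le_add_left Finset.card_biUnion_le _
    _ ≤ 2 ^ n * (Real.exp (-l) / 16) +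
        ∑ k ∈ Finset.range m, 2 ^ n * (Real.exp (-l) / 32 * (1 / 2) ^ k) := by
        push_cast
        gcongr with k _
        exact hBcard k
    _ = 2 ^ n * (Real.exp (-l) / 16) +
        2 ^ n * (Real.exp (-l) / 32) * ∑ k ∈ Finset.range m, (1 / 2 : ℝ) ^ k := by
        rw [Finset.mul_sum]
        congr 1
        exact Finset.sum_congr rfl fun k _ => by ring
    _ ≤ 2 ^ n * (Real.exp (-l) / 16) + 2 ^ n * (Real.exp (-l) / 32) * 2 := by gcongr
    _ = _ := by ring

end Chaining

/-! ### Chernoff bounds -/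

section Chernoff
variable {Z : Type*} [MeasurableSpace Z] {ν : Measure Z}

lemma measurable_ind : Measurable ind := Measurable.of_discrete

lemma integral_ind {f : Z → Bool} (hf : AEMeasurable f ν) :
    ∫ z, ind (f z) ∂ν = ν.real {z | f z = true} := by
  have hs : NullMeasurableSet {z | f z = true} ν :=
    hf.nullMeasurableSet_preimage (measurableSet_singleton true)
  have : (fun z => ind (f z)) = {z | f z = true}.indicator 1 := by
    funext z
    simp only [Set.indicator, Set.mem_ofPred_eq, ind, Pi.one_apply]
  rw [this, integral_indicator₀ hs]
  simp

variable [IsProbabilityMeasure ν]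

lemma integrable_ind {f : Z → Bool} (hf : AEMeasurable f ν) : Integrable (fun z => ind (f z)) ν := by
  refine Integrable.of_bound (measurable_ind.comp_aemeasurable hf).aestronglyMeasurable 1
    (Filter.Eventually.of_forall fun z => ?_)
  rw [Real.norm_of_nonneg (ind_nonneg _)]
  exact ind_le_one _

lemma exp_mul_ind (t : ℝ) (b : Bool) : Real.exp (t * ind b) = 1 + ind b * (Real.exp t - 1) := by
  cases b <;> simp [ind]

lemma integral_exp_ind {f : Z → Bool} (hf : AEMeasurable f ν) (t : ℝ) :
    ∫ z, Real.exp (t * ind (f z)) ∂ν = 1 + ν.real {z | f z = true} * (Real.exp t - 1) := by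
  simp_rw [exp_mul_ind]
  rw [integral_add (integrable_const _) ((integrable_ind hf).mul_const _), integral_mul_const,
    integral_ind hf]
  simp

/-- The exponential Markov inequality for the number of hits of an event in an i.i.d. sample. -/
lemma measureReal_sum_ind_le {f : Z → Bool} (hf : AEMeasurable f ν) (n : ℕ) (t s : ℝ) :
    (Measure.pi fun _ : Fin n => ν).real {z | s ≤ t * ∑ i, ind (f (z i))} ≤
      Real.exp (n * (ν.real {z | f z = true} * (Real.exp t - 1)) - s) := by
  have hint : Integrable (fun z => Real.exp (t * ind (f z))) ν := by
    simp_rw [exp_mul_ind]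
    exact (integrable_const _).add ((integrable_ind hf).mul_const _)
  have hmk := mul_meas_ge_le_integral_of_nonneg
    (μ := Measure.pi fun _ : Fin n => ν) (f := fun z => ∏ i, Real.exp (t * ind (f (z i))))
    (Filter.Eventually.of_forall fun z => Finset.prod_nonneg fun i _ => (Real.exp_pos _).le)
    (Integrable.fintype_prod fun _ => hint) (Real.exp s)
  rw [integral_fintype_prod_eq_pow (𝕜 := ℝ) (ι := Fin n) (fun z => Real.exp (t * ind (f z))),
    integral_exp_ind hf, Fintype.card_fin] at hmk
  have hset : {z : Fin n → Z | Real.exp s ≤ ∏ i, Real.exp (t * ind (f (z i)))} =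
      {z | s ≤ t * ∑ i, ind (f (z i))} := by
    ext z
    rw [Set.mem_ofPred_eq, Set.mem_ofPred_eq, ← Real.exp_sum, Real.exp_le_exp, Finset.mul_sum]
  rw [hset] at hmk
  have hp0 : 0 ≤ ν.real {z | f z = true} := measureReal_nonneg
  have hp1 : ν.real {z | f z = true} ≤ 1 := measureReal_le_one
  have hpow : (1 + ν.real {z | f z = true} * (Real.exp t - 1)) ^ n ≤
      Real.exp (n * (ν.real {z | f z = true} * (Real.exp t - 1))) := by
    rw [Real.exp_nat_mul]
    refine pow_le_pow_left₀ ?_ ?_ n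
    · nlinarith [Real.exp_pos t]
    · linarith [Real.add_one_le_exp (ν.real {z | f z = true} * (Real.exp t - 1))]
  rw [Real.exp_sub, le_div_iff₀ (Real.exp_pos _), mul_comm]
  exact hmk.trans hpow

/-- From exp x ≥ 1 + x + x²/2 and (1 + x + x²/2)(1 - x + x²/2) = 1 + x⁴/4 ≥ 1. -/
lemma exp_neg_le_quadratic {x : ℝ} (hx : 0 ≤ x) : Real.exp (-x) ≤ 1 - x + x ^ 2 / 2 := by
  have h := Real.quadratic_le_exp_of_nonneg hx
  rw [Real.exp_neg, inv_le_comm₀ (Real.exp_pos _) (by nlinarith [sq_nonneg (x - 1)])]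
  refine le_trans ?_ h
  rw [inv_le_iff_one_le_mul₀ (by nlinarith [sq_nonneg (x - 1)])]
  nlinarith [sq_nonneg (x ^ 2)]

/-- A relative Chernoff bound for the upper tail. -/
lemma measureReal_upper_tail_le {f : Z → Bool} (hf : AEMeasurable f ν) (n : ℕ) {a e : ℝ}
    (ha : 0 ≤ a) (ha1 : a ≤ 1) (he : 0 < e) (he1 : e ≤ 1) :
    (Measure.pi fun _ : Fin n => ν).real
      {z | n * ((1 + a) * ν.real {z | f z = true} + e) ≤ ∑ i, ind (f (z i))} ≤
      Real.exp (-(e * (a + e) * n) / 8) := by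
  set p := ν.real {z | f z = true} with hp
  have hp0 : 0 ≤ p := measureReal_nonneg
  have hp1 : p ≤ 1 := measureReal_le_one
  have hn : (0 : ℝ) ≤ n := Nat.cast_nonneg n
  obtain ⟨t, ht0, ht1, ht⟩ : ∃ t : ℝ, 0 < t ∧ t ≤ 1 ∧
      p * (t + t ^ 2) - t * ((1 + a) * p + e) ≤ -(e * (a + e)) / 8 := by
    -- When a dominates, the tilt t = a makes p(t + t²) cancel t(1 + a)p and leaves -ae. Otherwise t
    -- = e/2 gives the usual additive bound.
    rcases le_total a (e / 2) with h | h
    · refine ⟨e / 2, by positivity, by linarith, ?_⟩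
      have h1 : 0 ≤ (1 - p) * e ^ 2 := mul_nonneg (by linarith) (by positivity)
      have h2 : 0 ≤ e * (e / 2 - a) := mul_nonneg he.le (by linarith)
      have h3 : 0 ≤ e * a * p := by positivity
      nlinarith
    · refine ⟨a, by linarith, ha1, ?_⟩
      have h2 : 0 ≤ e * (a - e / 2) := mul_nonneg he.le (by linarith)
      nlinarith
  have hset : {z : Fin n → Z | n * ((1 + a) * p + e) ≤ ∑ i, ind (f (z i))} =
      {z | t * (n * ((1 + a) * p + e)) ≤ t * ∑ i, ind (f (z i))} := by
    ext z
    simp only [Set.mem_ofPred_eq]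
    rw [mul_le_mul_iff_right₀ ht0]
  rw [hset]
  refine (measureReal_sum_ind_le hf n t _).trans (Real.exp_le_exp.2 ?_)
  have h1 : Real.exp t - 1 ≤ t + t ^ 2 := by
    have := (abs_le.1 (Real.abs_exp_sub_one_sub_id_le (x := t) (by rw [abs_of_pos ht0]; exact ht1))).2
    linarith
  have h2 : p * (Real.exp t - 1) ≤ p * (t + t ^ 2) := mul_le_mul_of_nonneg_left h1 hp0
  rw [← hp]
  nlinarith

/-- A relative Chernoff bound for the lower tail. -/
lemma measureReal_lower_tail_le {f : Z → Bool} (hf : AEMeasurable f ν) (n : ℕ) {a e : ℝ}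
    (ha : 0 ≤ a) (he : 0 < e) (hp : 0 < ν.real {z | f z = true}) :
    (Measure.pi fun _ : Fin n => ν).real
      {z | ∑ i, ind (f (z i)) ≤
        n * (ν.real {z | f z = true} - (a * ν.real {z | f z = true} + e) / 4)} ≤
      Real.exp (-(e * (a + e) * n) / 32) := by
  set p := ν.real {z | f z = true} with hpdef
  have hp1 : p ≤ 1 := measureReal_le_one
  have hn : (0 : ℝ) ≤ n := Nat.cast_nonneg n
  set s := (a * p + e) / 4 with hs
  have hs0 : 0 < s := by positivity
  -- The tilt -s/p minimises the quadratic bound and gives the exponent -ns²/(2p).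
  have ht0 : 0 < s / p := by positivity
  have hset : {z : Fin n → Z | ∑ i, ind (f (z i)) ≤ n * (p - s)} =
      {z | -(s / p) * (n * (p - s)) ≤ -(s / p) * ∑ i, ind (f (z i))} := by
    ext z
    simp only [Set.mem_ofPred_eq]
    rw [neg_mul, neg_mul, neg_le_neg_iff, mul_le_mul_iff_right₀ ht0]
  rw [hset]
  refine (measureReal_sum_ind_le hf n _ _).trans (Real.exp_le_exp.2 ?_)
  rw [← hpdef]
  have h1 : p * (Real.exp (-(s / p)) - 1) ≤ p * (-(s / p) + (s / p) ^ 2 / 2) :=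
    mul_le_mul_of_nonneg_left (by linarith [exp_neg_le_quadratic ht0.le]) hp.le
  have h2 : p * (-(s / p) + (s / p) ^ 2 / 2) + s / p * (p - s) = -(s ^ 2 / p) / 2 := by
    field_simp; ring
  have h3 : e * (a + e) / 16 ≤ s ^ 2 / p := by
    rw [le_div_iff₀ hp, hs]
    have : 0 ≤ (1 - p) * e ^ 2 := mul_nonneg (by linarith) (by positivity)
    have : 0 ≤ e * a * p := by positivity
    nlinarith [sq_nonneg (a * p)]
  have h4 : p * (Real.exp (-(s / p)) - 1) + s / p * (p - s) ≤ -(e * (a + e)) / 32 := by linarith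
  nlinarith

end Chernoff

/-! ### Reindexing and swapping i.i.d. samples -/

section Reindex
variable {Z : Type*} [MeasurableSpace Z]

lemma measurePreserving_reindex {ι ι' : Type*} [Fintype ι] [Fintype ι'] (ν : Measure Z)
    [SigmaFinite ν] (e : ι' ≃ ι) :
    MeasurePreserving (fun (z : ι → Z) i => z (e i)) (Measure.pi fun _ => ν)
      (Measure.pi fun _ => ν) := by
  refine ⟨by fun_prop, (Measure.pi_eq fun s hs => ?_).symm⟩
  rw [Measure.map_apply (by fun_prop) (MeasurableSet.univ_pi hs)]
  have : (fun (z : ι → Z) i => z (e i)) ⁻¹' Set.univ.pi s = Set.univ.pi fun i => s (e.symm i) := by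
    ext z
    simp only [Set.mem_preimage, Set.mem_univ_pi]
    exact ⟨fun h i => by simpa using h (e.symm i), fun h i => by simpa using h (e i)⟩
  rw [this, Measure.pi_pi, Equiv.prod_comp e.symm fun i => ν (s i)]

/-- Exchange the two copies of the coordinate `i` of a double sample whenever `σ i` is false. -/
def swapHalves {n : ℕ} (σ : Fin n → Bool) : Fin n ⊕ Fin n ≃ Fin n ⊕ Fin n where
  toFun := Sum.elim (fun i => if σ i then .inl i else .inr i)
    (fun i => if σ i then .inr i else .inl i)
  invFun := Sum.elim (fun i => if σ i then .inl i else .inr i)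
    (fun i => if σ i then .inr i else .inl i)
  left_inv := by rintro (i | i) <;> cases h : σ i <;> simp [h]
  right_inv := by rintro (i | i) <;> cases h : σ i <;> simp [h]

/-- Swaps preserve the product measure, so 2^n times the measure of J is the integral of the number
of swaps that carry z into J. This turns a bound for each fixed double sample into one in
probability. -/
lemma measure_le_of_card_swaps_le {n : ℕ} (ν : Measure Z) [IsProbabilityMeasure ν]
    {J : Set (Fin n ⊕ Fin n → Z)} (hJ : NullMeasurableSet J (Measure.pi fun _ => ν)) {r : ℝ}
    (hcard : ∀ (z : Fin n ⊕ Fin n → Z) (B : Finset (Fin n → Bool)),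
      (∀ σ ∈ B, (fun q => z (swapHalves σ q)) ∈ J) → (B.card : ℝ) ≤ 2 ^ n * r) :
    (Measure.pi fun _ => ν) J ≤ ENNReal.ofReal r := by
  classical
  set μ := Measure.pi fun _ : Fin n ⊕ Fin n => ν with hμ
  set S : (Fin n → Bool) → Set (Fin n ⊕ Fin n → Z) := fun σ =>
    {z | (fun q => z (swapHalves σ q)) ∈ J} with hS
  have hpre : ∀ σ : Fin n → Bool, NullMeasurableSet (S σ) μ ∧ μ (S σ) = μ J := fun σ =>
    ⟨hJ.preimage (measurePreserving_reindex ν (swapHalves σ)).quasiMeasurePreserving,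
      (measurePreserving_reindex ν (swapHalves σ)).measure_preimage hJ⟩
  have h1 : (2 ^ n : ℝ≥0∞) * μ J =
      ∫⁻ z, ∑ σ : Fin n → Bool, (S σ).indicator (fun _ => (1 : ℝ≥0∞)) z ∂μ := by
    rw [lintegral_finsetSum' _ fun σ _ => (aemeasurable_indicator_const_iff 1).2 (hpre σ).1]
    simp_rw [lintegral_indicator_const₀ (hpre _).1, (hpre _).2]
    simp
  have h2 : ∀ z, ∑ σ : Fin n → Bool, (S σ).indicator (fun _ => (1 : ℝ≥0∞)) z ≤
      2 ^ n * ENNReal.ofReal r := by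
    intro z
    have h3 := hcard z (Finset.univ.filter fun σ => z ∈ S σ)
      fun σ hσ => (Finset.mem_filter.1 hσ).2
    calc _ = ((Finset.univ.filter fun σ : Fin n → Bool => z ∈ S σ).card : ℝ≥0∞) := by
          rw [Finset.card_filter, Nat.cast_sum]
          refine Finset.sum_congr rfl fun σ _ => ?_
          simp [Set.indicator]
      _ = ENNReal.ofReal ((Finset.univ.filter fun σ : Fin n → Bool => z ∈ S σ).card : ℝ) := by
          rw [ENNReal.ofReal_natCast]
      _ ≤ ENNReal.ofReal (2 ^ n * r) := ENNReal.ofReal_le_ofReal h3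
      _ = _ := by
          rw [ENNReal.ofReal_mul (by positivity), ENNReal.ofReal_pow (by norm_num)]
          norm_num
  have h4 : (2 ^ n : ℝ≥0∞) * μ J ≤ 2 ^ n * ENNReal.ofReal r := by
    rw [h1]
    refine (lintegral_mono h2).trans ?_
    simp [hμ]
  exact (ENNReal.mul_le_mul_iff_right (by positivity) (by simp)).1 h4

end Reindex

/-! ### Uniform relative deviation over the seven-fold majorities -/

section Deviation
variable {X : Type*} {C : Set (X → Bool)}

/-- A clean round whose label differs from the majority of `c`. -/
def wrong (c : Fin 7 → X → Bool) (z : Round X) : Bool := !z.1 && (maj c z.2.1 != z.2.2)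

/-- The double samples on which some majority deviates between the two halves. -/
def deviates (C : Set (X → Bool)) (n : ℕ) (a e : ℝ) : Set (Fin n ⊕ Fin n → Round X) :=
  {z | ∃ c : Fin 7 → X → Bool, (∀ j, c j ∈ C) ∧
    (1 + a / 2) * ∑ i, ind (wrong c (z (.inl i))) + e / 2 * n ≤ ∑ i, ind (wrong c (z (.inr i)))}

/-- With L and R the errors on the swapped halves, R ≥ (1 + a/2)L + (e/2)n gives R - L ≥ (a/6)(L +
R) + (e/3)n after multiplication by 1 - a/6. Now the right side is invariant under swaps and the
left side is a Rademacher sum in σ. -/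
lemma card_swaps_deviates_le {d : ℕ} (hd : vcDim C = d) (hd1 : 1 ≤ d) {n : ℕ} (hn : 0 < n)
    {a e l : ℝ} (ha : 0 ≤ a) (ha1 : a ≤ 1) (he : 0 < e) (hl : 0 ≤ l)
    (hN : 691200 * (d * Real.log (2 + a / e) + l) ≤ e * (a + e) * n)
    (z : Fin n ⊕ Fin n → Round X) (B : Finset (Fin n → Bool))
    (hB : ∀ σ ∈ B, (fun q => z (swapHalves σ q)) ∈ deviates C n a e) :
    (B.card : ℝ) ≤ 2 ^ n * (Real.exp (-l) / 8) := by
  refine card_deviating_signs_le (fun q v => !(z q).1 && (signSum v != (z q).2.2)) hd hd1 hn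
    (fun q => (z q).2.1) ha he hl hN B fun σ hσ => ?_
  obtain ⟨c, hc, hdev⟩ := hB σ hσ
  refine ⟨c, hc, ?_⟩
  set ψ : Fin n ⊕ Fin n → (Fin 7 → Bool) → Bool :=
    fun q v => !(z q).1 && (signSum v != (z q).2.2) with hψ
  have hcomb : ∀ q, combined ψ (fun j q => c j (z q).2.1) q = ind (wrong c (z q)) := fun q => rfl
  have hn0 : (0 : ℝ) ≤ n := Nat.cast_nonneg n
  have hsub : ∑ i, (sgn (σ i) : ℝ) * halfDiff ψ (fun j q => c j (z q).2.1) i =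
      ∑ i, ind (wrong c (z (swapHalves σ (.inr i)))) -
        ∑ i, ind (wrong c (z (swapHalves σ (.inl i)))) := by
    rw [← Finset.sum_sub_distrib]
    refine Finset.sum_congr rfl fun i _ => ?_
    rw [halfDiff, hcomb, hcomb]
    cases h : σ i <;> simp [swapHalves, h, sgn]
  have hadd : ∑ q, combined ψ (fun j q => c j (z q).2.1) q =
      ∑ i, ind (wrong c (z (swapHalves σ (.inl i)))) +
        ∑ i, ind (wrong c (z (swapHalves σ (.inr i)))) := by
    simp_rw [hcomb]
    rw [← Equiv.sum_comp (swapHalves σ) fun q => ind (wrong c (z q)), Fintype.sum_sum_type]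
  rw [hsub, hadd]
  have hL : 0 ≤ ∑ i, ind (wrong c (z (swapHalves σ (.inl i)))) :=
    Finset.sum_nonneg fun i _ => ind_nonneg _
  generalize ∑ i, ind (wrong c (z (swapHalves σ (.inl i)))) = L at *
  generalize ∑ i, ind (wrong c (z (swapHalves σ (.inr i)))) = R at *
  have h1 := mul_le_mul_of_nonneg_left hdev (by linarith : 0 ≤ 1 - a / 6)
  have h2 : 0 ≤ a * (2 - a) * L := mul_nonneg (mul_nonneg ha (by linarith)) hL
  have h3 : 0 ≤ (2 - a) * (e * n) := mul_nonneg (by linarith) (by positivity)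
  nlinarith

variable [MeasurableSpace X] {ν : Measure (Round X)}

lemma aemeasurable_wrong {c : Fin 7 → X → Bool}
    (hc : ∀ j, AEMeasurable (fun z : Round X => c j z.2.1) ν) : AEMeasurable (wrong c) ν := by
  have h1 : AEMeasurable (fun z : Round X => ((z.1, z.2.2), fun j => c j z.2.1)) ν :=
    AEMeasurable.prodMk (by fun_prop) (aemeasurable_pi_lambda _ hc)
  exact (Measurable.of_discrete (f := fun p : (Bool × Bool) × (Fin 7 → Bool) =>
    !p.1.1 && (signSum p.2 != p.1.2))).comp_aemeasurable h1

variable [IsProbabilityMeasure ν]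

lemma nullMeasurableSet_pattern {ι : Type*} [Fintype ι]
    (hpat : ∀ (m : ℕ) (b : Fin m → Bool),
      NullMeasurableSet {z : Fin m → Round X | ∃ c ∈ C, ∀ i, c (z i).2.1 = b i}
        (Measure.pi fun _ => ν)) (b : ι → Bool) :
    NullMeasurableSet {z : ι → Round X | ∃ c ∈ C, ∀ i, c (z i).2.1 = b i}
      (Measure.pi fun _ => ν) := by
  set e := (Fintype.equivFin ι).symm
  convert! (hpat (Fintype.card ι) fun i => b (e i)).preimage
    (measurePreserving_reindex ν e).quasiMeasurePreserving using 1
  ext z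
  simp only [Set.mem_ofPred_eq, Set.mem_preimage]
  refine exists_congr fun c => and_congr_right fun _ => ⟨fun h i => h (e i), fun h i => ?_⟩
  simpa using h (e.symm i)

/-- Whether the halves deviate depends on the seven concepts only through their labels on the 2n
points. So the event is a finite union over label patterns. -/
lemma nullMeasurableSet_deviates
    (hpat : ∀ (m : ℕ) (b : Fin m → Bool),
      NullMeasurableSet {z : Fin m → Round X | ∃ c ∈ C, ∀ i, c (z i).2.1 = b i}
        (Measure.pi fun _ => ν)) (n : ℕ) (a e : ℝ) :
    NullMeasurableSet (deviates C n a e) (Measure.pi fun _ => ν) := by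
  set f : Bool × Bool → Bool → ℝ := fun p s => ind (!p.1 && (s != p.2)) with hf
  have heq : deviates C n a e = ⋃ b : Fin 7 → Fin n ⊕ Fin n → Bool,
      (⋂ j, {z : Fin n ⊕ Fin n → Round X | ∃ c ∈ C, ∀ q, c (z q).2.1 = b j q}) ∩
      {z | (1 + a / 2) * ∑ i, f ((z (.inl i)).1, (z (.inl i)).2.2) (signSum fun j => b j (.inl i)) +
        e / 2 * n ≤ ∑ i, f ((z (.inr i)).1, (z (.inr i)).2.2) (signSum fun j => b j (.inr i))} := by
    ext z
    simp only [deviates, Set.mem_ofPred_eq, Set.mem_iUnion, Set.mem_inter_iff, Set.mem_iInter]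
    constructor
    · rintro ⟨c, hc, h⟩
      exact ⟨fun j q => c j (z q).2.1, fun j => ⟨c j, hc j, fun _ => rfl⟩, h⟩
    · rintro ⟨b, hb, h⟩
      choose c hc hcb using hb
      refine ⟨c, hc, ?_⟩
      simp only [← hcb] at h
      exact h
  rw [heq]
  refine NullMeasurableSet.iUnion fun b => (NullMeasurableSet.iInter fun j =>
    nullMeasurableSet_pattern hpat (b j)).inter (MeasurableSet.nullMeasurableSet ?_)
  have hm : ∀ (q : Fin n ⊕ Fin n) (s : Bool),
      Measurable fun z : Fin n ⊕ Fin n → Round X => f ((z q).1, (z q).2.2) s := fun q s =>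
    (Measurable.of_discrete (f := fun p : Bool × Bool => f p s)).comp (by fun_prop)
  exact measurableSet_le (by fun_prop) (by fun_prop)

/-- Symmetrization: large deviations from the mean reduce to deviations on a double sample. -/
lemma measure_deviation_le_two_mul {n : ℕ} {a e : ℝ} (ha : 0 ≤ a) (ha1 : a ≤ 1) (he : 0 < e)
    (hE : 32 ≤ e * (a + e) * n)
    (hC : ∀ c ∈ C, AEMeasurable (fun z : Round X => c z.2.1) ν) :
    (Measure.pi fun _ : Fin n => ν) {z | ∃ c : Fin 7 → X → Bool, (∀ j, c j ∈ C) ∧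
      (1 + a) * ∑ i, ind (wrong c (z i)) + e * n < n * ν.real {z | wrong c z = true}} ≤
    2 * (Measure.pi fun _ => ν) (deviates C n a e) := by
  set μ := Measure.pi fun _ : Fin n => ν with hμ
  set ε := MeasurableEquiv.sumPiEquivProdPi fun _ : Fin n ⊕ Fin n => Round X with hε
  have hmp : MeasurePreserving ε.symm (μ.prod μ) (Measure.pi fun _ : Fin n ⊕ Fin n => ν) :=
    measurePreserving_sumPiEquivProdPi_symm fun _ : Fin n ⊕ Fin n => ν
  -- The event is only null measurable. Its measurable hull has the same measure and measurable
  -- sections, so Fubini and Markov apply to it.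
  set T := toMeasurable (μ.prod μ) (ε.symm ⁻¹' deviates C n a e) with hT
  have hTm : MeasurableSet T := measurableSet_toMeasurable _ _
  have hTmeas : μ.prod μ T = (Measure.pi fun _ => ν) (deviates C n a e) := by
    rw [hT, measure_toMeasurable, hmp.measure_preimage_equiv]
  have hn0 : (0 : ℝ) ≤ n := Nat.cast_nonneg n
  have hsub : {z : Fin n → Round X | ∃ c : Fin 7 → X → Bool, (∀ j, c j ∈ C) ∧
      (1 + a) * ∑ i, ind (wrong c (z i)) + e * n < n * ν.real {z | wrong c z = true}} ⊆
      {z | (2 : ℝ≥0∞)⁻¹ ≤ μ (Prod.mk z ⁻¹' T)} := by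
    rintro z ⟨c, hc, hdev⟩
    have hw := aemeasurable_wrong fun j => hC _ (hc j)
    set p := ν.real {z | wrong c z = true} with hp
    have hS : 0 ≤ ∑ i, ind (wrong c (z i)) := Finset.sum_nonneg fun i _ => ind_nonneg _
    have hp0 : 0 < p := by
      by_contra hcon
      have h1 : (n : ℝ) * p ≤ 0 := mul_nonpos_of_nonneg_of_nonpos hn0 (not_lt.1 hcon)
      have h2 : 0 ≤ (1 + a) * ∑ i, ind (wrong c (z i)) := by positivity
      have h3 : 0 ≤ e * n := by positivity
      linarith
    -- The tuple c is fixed by the first half, hence independent of the ghost half, and a tail bound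
    -- for a single event suffices. At least half of the ghost samples then witness a deviation.
    have hlow := measureReal_lower_tail_le hw n ha he hp0
    rw [← hμ, ← hp] at hlow
    set G : Set (Fin n → Round X) :=
      {z' | ∑ i, ind (wrong c (z' i)) ≤ n * (p - (a * p + e) / 4)} with hG
    have hGle : μ G ≤ 2⁻¹ := by
      rw [← ofReal_measureReal, show (2⁻¹ : ℝ≥0∞) = ENNReal.ofReal (2⁻¹) by
        rw [ENNReal.ofReal_inv_of_pos two_pos]; norm_num]
      refine ENNReal.ofReal_le_ofReal (hlow.trans ?_)
      calc Real.exp (-(e * (a + e) * n) / 32) ≤ Real.exp (-1) :=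
            Real.exp_le_exp.2 (by linarith)
        _ ≤ 2⁻¹ := by
            rw [Real.exp_neg]
            gcongr
            linarith [Real.exp_one_gt_d9]
    have hGc : (2 : ℝ≥0∞)⁻¹ ≤ μ Gᶜ := by
      have h1 : (1 : ℝ≥0∞) ≤ μ G + μ Gᶜ := by
        rw [← measure_univ (μ := μ), ← Set.union_compl_self G]
        exact measure_union_le _ _
      have h2 : (2 : ℝ≥0∞)⁻¹ + 2⁻¹ ≤ 2⁻¹ + μ Gᶜ := by
        rw [ENNReal.inv_two_add_inv_two]
        exact h1.trans (by gcongr)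
      exact (ENNReal.add_le_add_iff_left (by simp)).1 h2
    refine hGc.trans (measure_mono fun z' hz' => subset_toMeasurable _ _ ?_)
    have hz'' : n * (p - (a * p + e) / 4) < ∑ i, ind (wrong c (z' i)) := not_le.1 hz'
    refine ⟨c, hc, ?_⟩
    change (1 + a / 2) * ∑ i, ind (wrong c (z i)) + e / 2 * n ≤ ∑ i, ind (wrong c (z' i))
    generalize ∑ i, ind (wrong c (z i)) = s at *
    have h1 : (1 + a / 2) * s ≤ (1 - a / 4) * ((1 + a) * s) := by
      have : 0 ≤ a * (1 - a) * s := mul_nonneg (mul_nonneg ha (by linarith)) hS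
      nlinarith
    have h2 : (1 - a / 4) * ((1 + a) * s) ≤ (1 - a / 4) * (n * p - e * n) :=
      mul_le_mul_of_nonneg_left (by linarith) (by linarith)
    have h3 : 0 ≤ (1 - a) * (e * n) := mul_nonneg (by linarith) (by positivity)
    nlinarith
  have hmk := mul_meas_ge_le_lintegral₀ (μ := μ)
    (measurable_measure_prodMk_left (ν := μ) hTm).aemeasurable (2⁻¹ : ℝ≥0∞)
  rw [← Measure.prod_apply hTm, hTmeas] at hmk
  calc _ ≤ μ {z | (2 : ℝ≥0∞)⁻¹ ≤ μ (Prod.mk z ⁻¹' T)} := measure_mono hsub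
    _ = 2 * (2⁻¹ * μ {z | (2 : ℝ≥0∞)⁻¹ ≤ μ (Prod.mk z ⁻¹' T)}) := by
        rw [← mul_assoc, ENNReal.mul_inv_cancel two_ne_zero ENNReal.ofNat_ne_top, one_mul]
    _ ≤ _ := by gcongr

/-- The uniform relative deviation bound, free of logarithmic factors for `a = 0`. -/
theorem measure_deviation_le {d : ℕ} (hd : vcDim C = d) (hd1 : 1 ≤ d) {n : ℕ}
    {a e l : ℝ} (ha : 0 ≤ a) (ha1 : a ≤ 1) (he : 0 < e) (hl : 0 ≤ l)
    (hN : 691200 * (d * Real.log (2 + a / e) + l) ≤ e * (a + e) * n)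
    (hC : ∀ c ∈ C, AEMeasurable (fun z : Round X => c z.2.1) ν)
    (hpat : ∀ (m : ℕ) (b : Fin m → Bool),
      NullMeasurableSet {z : Fin m → Round X | ∃ c ∈ C, ∀ i, c (z i).2.1 = b i}
        (Measure.pi fun _ => ν)) :
    (Measure.pi fun _ : Fin n => ν) {z | ∃ c : Fin 7 → X → Bool, (∀ j, c j ∈ C) ∧
      (1 + a) * ∑ i, ind (wrong c (z i)) + e * n < n * ν.real {z | wrong c z = true}} ≤
    ENNReal.ofReal (Real.exp (-l) / 4) := by
  have hE : 32 ≤ e * (a + e) * n := by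
    have h1 : Real.log 2 ≤ Real.log (2 + a / e) :=
      Real.log_le_log (by norm_num) (by have : 0 ≤ a / e := by positivity
                                        linarith)
    have h2 : (1 : ℝ) ≤ d := by exact_mod_cast hd1
    have := Real.log_two_gt_d9
    nlinarith
  have hn : 0 < n := by
    rcases Nat.eq_zero_or_pos n with rfl | h
    · norm_num at hE
    · exact h
  refine (measure_deviation_le_two_mul ha ha1 he hE hC).trans ?_
  have := measure_le_of_card_swaps_le ν (nullMeasurableSet_deviates hpat n a e)
    (card_swaps_deviates_le hd hd1 hn ha ha1 he hl hN)
  calc _ ≤ 2 * ENNReal.ofReal (Real.exp (-l) / 8) := by gcongr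
    _ = ENNReal.ofReal (2 * (Real.exp (-l) / 8)) := by
        rw [ENNReal.ofReal_mul zero_le_two]; norm_num
    _ = _ := by ring_nf

end Deviation

/-! ### Malicious rounds as a corruption of independent rounds -/

section Coupling
variable {X : Type*} [MeasurableSpace X]

lemma measurable_snoc_const {W : Type*} [MeasurableSpace W] (n : ℕ) (b : Bool) :
    Measurable fun p : (Fin n → Bool × W) × W =>
      (Fin.snoc (α := fun _ => Bool × W) p.1 (b, p.2) : Fin (n + 1) → Bool × W) := by
  rw [measurable_pi_iff]
  intro i
  refine Fin.lastCases ?_ (fun j => ?_) i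
  · simp only [Fin.snoc_last]
    fun_prop
  · simp only [Fin.snoc_castSucc]
    fun_prop

/-- The law of a labeled example. -/
noncomputable def exampleLaw (D : Measure X) (c : X → Bool) : Measure (X × Bool) :=
  D.map fun x => (x, c x)

lemma isProbabilityMeasure_exampleLaw {D : Measure X} [IsProbabilityMeasure D] {c : X → Bool}
    (hc : AEMeasurable c D) : IsProbabilityMeasure (exampleLaw D c) :=
  Measure.isProbabilityMeasure_map (aemeasurable_id.prodMk hc)

/-- The law of a flag that is raised with probability `η`. -/
noncomputable def flagLaw (η : ℝ) : Measure Bool :=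
  ENNReal.ofReal (1 - η) • Measure.dirac false + ENNReal.ofReal η • Measure.dirac true

lemma isProbabilityMeasure_flagLaw {η : ℝ} (h0 : 0 ≤ η) (h1 : η < 1) :
    IsProbabilityMeasure (flagLaw η) := by
  refine ⟨?_⟩
  simp only [flagLaw, Measure.coe_add, Measure.coe_smul, Pi.add_apply, Pi.smul_apply,
    measure_univ, smul_eq_mul, mul_one]
  rw [← ENNReal.ofReal_add (by linarith) h0]
  simp

/-- The law of an independent example with a flag. -/
noncomputable def flaggedLaw (D : Measure X) (c : X → Bool) (η : ℝ) : Measure (Round X) :=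
  (flagLaw η).prod (exampleLaw D c)

lemma flaggedLaw_apply {D : Measure X} [IsProbabilityMeasure D] {c : X → Bool}
    (hc : AEMeasurable c D) {η : ℝ} (h0 : 0 ≤ η) (h1 : η < 1) {s : Set (Round X)}
    (hs : MeasurableSet s) :
    flaggedLaw D c η s = ENNReal.ofReal (1 - η) * exampleLaw D c (Prod.mk false ⁻¹' s) +
      ENNReal.ofReal η * exampleLaw D c (Prod.mk true ⁻¹' s) := by
  have := isProbabilityMeasure_exampleLaw hc
  have := isProbabilityMeasure_flagLaw h0 h1
  rw [flaggedLaw, Measure.prod_apply hs, flagLaw, lintegral_add_measure, lintegral_smul_measure,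
    lintegral_smul_measure, lintegral_dirac, lintegral_dirac, smul_eq_mul, smul_eq_mul]

lemma isProbabilityMeasure_roundsLaw {D : Measure X} [IsProbabilityMeasure D] {c : X → Bool}
    (hc : AEMeasurable c D) {η : ℝ} (h0 : 0 ≤ η) (h1 : η < 1) (adv : Adversary X) (n : ℕ) :
    IsProbabilityMeasure (roundsLaw D c η adv n) := by
  have := isProbabilityMeasure_exampleLaw hc
  have := adv.markov
  induction n with
  | zero => rw [roundsLaw]; infer_instance
  | succ n ih =>
    refine ⟨?_⟩
    have h2 : IsProbabilityMeasure ((roundsLaw D c η adv n).prod (D.map fun x => (x, c x))) :=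
      inferInstanceAs (IsProbabilityMeasure ((roundsLaw D c η adv n).prod (exampleLaw D c)))
    have h3 := Measure.isProbabilityMeasure_map (μ := (roundsLaw D c η adv n).prod
      (D.map fun x => (x, c x))) (measurable_snoc_const n false).aemeasurable
    have h4 := Measure.isProbabilityMeasure_map (μ := (roundsLaw D c η adv n).compProd
      (adv.play n)) (measurable_snoc_const n true).aemeasurable
    rw [roundsLaw]
    simp only [Measure.coe_add, Measure.coe_smul, Pi.add_apply, Pi.smul_apply, smul_eq_mul]
    rw [h3.measure_univ, h4.measure_univ, mul_one, mul_one, ← ENNReal.ofReal_add (by linarith) h0]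
    simp

/-- The probability that a round lands in `s` after it is redrawn in case that it was corrupted. -/
noncomputable def redrawProb (ν : Measure (X × Bool)) (s : Set (Round X)) (r : Round X) : ℝ≥0∞ :=
  if r.1 = true then ν (Prod.mk true ⁻¹' s) else s.indicator (fun _ => 1) r

lemma measurable_redrawProb (ν : Measure (X × Bool)) {s : Set (Round X)} (hs : MeasurableSet s) :
    Measurable (redrawProb ν s) :=
  Measurable.ite (measurable_fst (measurableSet_singleton true)) measurable_const
    (measurable_const.indicator hs)

/-- Induction on the rounds. The last factor is an indicator on a clean round and a constant on a
corrupted one, so it never sees what the adversary played. The two branches, weighted by 1 - η and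
η, add up to `flaggedLaw`. -/
lemma lintegral_prod_redrawProb {D : Measure X} [IsProbabilityMeasure D] {c : X → Bool}
    (hc : AEMeasurable c D) {η : ℝ} (h0 : 0 ≤ η) (h1 : η < 1) (adv : Adversary X) (n : ℕ)
    (s : Fin n → Set (Round X)) (hs : ∀ i, MeasurableSet (s i)) :
    ∫⁻ r, ∏ i, redrawProb (exampleLaw D c) (s i) (r i) ∂roundsLaw D c η adv n =
      ∏ i, flaggedLaw D c η (s i) := by
  have := isProbabilityMeasure_exampleLaw hc
  have := adv.markov
  induction n with
  | zero => simp [roundsLaw]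
  | succ n ih =>
    have := isProbabilityMeasure_roundsLaw hc h0 h1 adv n
    have hprod : ∀ {m : ℕ} (s : Fin m → Set (Round X)), (∀ i, MeasurableSet (s i)) →
        Measurable fun r : Fin m → Round X => ∏ i, redrawProb (exampleLaw D c) (s i) (r i) :=
      fun s hs => Finset.measurable_prod _ fun i _ =>
        (measurable_redrawProb _ (hs i)).comp (measurable_pi_apply i)
    have hih := ih (fun i => s i.castSucc) fun i => hs _
    have hclean : ∫⁻ r, ∏ i, redrawProb (exampleLaw D c) (s i) (r i)
        ∂(((roundsLaw D c η adv n).prod (D.map fun x => (x, c x))).map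
          fun p => Fin.snoc (α := fun _ => Round X) p.1 (false, p.2)) =
        (∏ i : Fin n, flaggedLaw D c η (s i.castSucc)) *
          exampleLaw D c (Prod.mk false ⁻¹' s (Fin.last n)) := by
      rw [lintegral_map (hprod s hs) (measurable_snoc_const n false)]
      simp only [Fin.prod_univ_castSucc, Fin.snoc_castSucc, Fin.snoc_last]
      change ∫⁻ p, _ ∂((roundsLaw D c η adv n).prod (exampleLaw D c)) = _
      have hm : Measurable fun w : X × Bool =>
          redrawProb (exampleLaw D c) (s (Fin.last n)) (false, w) :=
        (measurable_redrawProb _ (hs _)).comp measurable_prodMk_left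
      rw [lintegral_prod_mul (f := fun r : Fin n → Round X =>
        ∏ i : Fin n, redrawProb (exampleLaw D c) (s i.castSucc) (r i))
        (hprod (fun i => s i.castSucc) fun i => hs _).aemeasurable hm.aemeasurable, hih]
      congr 1
      have h2 : (fun w : X × Bool => redrawProb (exampleLaw D c) (s (Fin.last n)) (false, w)) =
          (Prod.mk false ⁻¹' s (Fin.last n)).indicator fun _ => 1 := by
        funext w
        simp [redrawProb, Set.indicator]
        rfl
      rw [h2, lintegral_indicator_const (measurable_prodMk_left (hs _)), one_mul]
    have hnoisy : ∫⁻ r, ∏ i, redrawProb (exampleLaw D c) (s i) (r i)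
        ∂(((roundsLaw D c η adv n).compProd (adv.play n)).map
          fun p => Fin.snoc (α := fun _ => Round X) p.1 (true, p.2)) =
        (∏ i : Fin n, flaggedLaw D c η (s i.castSucc)) *
          exampleLaw D c (Prod.mk true ⁻¹' s (Fin.last n)) := by
      rw [lintegral_map (hprod s hs) (measurable_snoc_const n true)]
      simp only [Fin.prod_univ_castSucc, Fin.snoc_castSucc, Fin.snoc_last]
      have h2 : ∀ w : X × Bool, redrawProb (exampleLaw D c) (s (Fin.last n)) (true, w) =
          exampleLaw D c (Prod.mk true ⁻¹' s (Fin.last n)) := fun w => by simp [redrawProb]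
      simp only [h2]
      have hm : Measurable fun p : (Fin n → Round X) × (X × Bool) =>
          ∏ i : Fin n, redrawProb (exampleLaw D c) (s i.castSucc) (p.1 i) :=
        (hprod (fun i => s i.castSucc) fun i => hs _).comp measurable_fst
      rw [lintegral_mul_const _ hm, Measure.lintegral_compProd hm]
      simp [hih]
    rw [roundsLaw, lintegral_add_measure, lintegral_smul_measure, lintegral_smul_measure, hclean,
      hnoisy, Fin.prod_univ_castSucc, flaggedLaw_apply hc h0 h1 (hs _)]
    simp only [smul_eq_mul]
    ring

/-- Redraw a corrupted round. -/
def redraw (r : Round X) (w : X × Bool) : Round X := if r.1 = true then (true, w) else r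

lemma measurable_redraw : Measurable fun p : Round X × (X × Bool) => redraw p.1 p.2 :=
  Measurable.ite ((measurable_fst.comp measurable_fst) (measurableSet_singleton true))
    (measurable_const.prodMk measurable_snd) measurable_fst

lemma measurable_redraw_pi (n : ℕ) :
    Measurable fun (p : (Fin n → Round X) × (Fin n → X × Bool)) i => redraw (p.1 i) (p.2 i) := by
  rw [measurable_pi_iff]
  intro i
  have h : Measurable fun p : (Fin n → Round X) × (Fin n → X × Bool) => (p.1 i, p.2 i) := by
    fun_prop
  exact measurable_redraw.comp h

/-- It suffices to test boxes. For given rounds, integrating out the fresh examples over a box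
leaves the product of the `redrawProb`. -/
lemma map_redraw_eq {D : Measure X} [IsProbabilityMeasure D] {c : X → Bool}
    (hc : AEMeasurable c D) {η : ℝ} (h0 : 0 ≤ η) (h1 : η < 1) (adv : Adversary X) (n : ℕ) :
    ((roundsLaw D c η adv n).prod (Measure.pi fun _ : Fin n => exampleLaw D c)).map
      (fun p i => redraw (p.1 i) (p.2 i)) = Measure.pi fun _ => flaggedLaw D c η := by
  have := isProbabilityMeasure_exampleLaw hc
  have := isProbabilityMeasure_flagLaw h0 h1
  have := isProbabilityMeasure_roundsLaw hc h0 h1 adv n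
  have : IsProbabilityMeasure (flaggedLaw D c η) := by unfold flaggedLaw; infer_instance
  have hm := measurable_redraw_pi (X := X) n
  refine (Measure.pi_eq fun s hs => ?_).symm
  rw [Measure.map_apply hm (MeasurableSet.univ_pi hs), Measure.prod_apply
    (hm (MeasurableSet.univ_pi hs)), ← lintegral_prod_redrawProb hc h0 h1 adv n s hs]
  refine lintegral_congr fun r => ?_
  have hbox : Prod.mk r ⁻¹' ((fun (p : (Fin n → Round X) × (Fin n → X × Bool)) i =>
      redraw (p.1 i) (p.2 i)) ⁻¹' Set.univ.pi s) =
      Set.univ.pi fun i => {w | redraw (r i) w ∈ s i} := by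
    ext w
    simp
  rw [hbox, Measure.pi_pi]
  refine Finset.prod_congr rfl fun i _ => ?_
  unfold redrawProb redraw
  split_ifs with h
  · rfl
  · by_cases hr : r i ∈ s i <;> simp [hr]

/-- An event on malicious rounds that persists under redrawing the corrupted rounds is at most as
likely as for independent rounds. -/
theorem roundsLaw_le_pi {D : Measure X} [IsProbabilityMeasure D] {c : X → Bool}
    (hc : AEMeasurable c D) {η : ℝ} (h0 : 0 ≤ η) (h1 : η < 1) (adv : Adversary X) {n : ℕ}
    {B B' : Set (Fin n → Round X)}
    (hB : ∀ r ∈ B, ∀ w : Fin n → X × Bool, (fun i => redraw (r i) (w i)) ∈ B') :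
    roundsLaw D c η adv n B ≤ (Measure.pi fun _ => flaggedLaw D c η) B' := by
  have := isProbabilityMeasure_exampleLaw hc
  have := isProbabilityMeasure_roundsLaw hc h0 h1 adv n
  have hm := measurable_redraw_pi (X := X) n
  rw [← map_redraw_eq hc h0 h1 adv n]
  -- Neither set is assumed measurable: the product formula holds for arbitrary sets, and for the
  -- image measure only the inequality is used.
  calc roundsLaw D c η adv n B = ((roundsLaw D c η adv n).prod
        (Measure.pi fun _ : Fin n => exampleLaw D c)) (B ×ˢ Set.univ) := by
        rw [Measure.prod_prod, measure_univ, mul_one]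
    _ ≤ _ := measure_mono fun p hp => hB p.1 hp.1 p.2
    _ ≤ _ := Measure.le_map_apply hm.aemeasurable B'

end Coupling

/-! ### Means and errors of randomized hypotheses -/

lemma sum_bool_fun_succ {β : Type*} [AddCommMonoid β] {k : ℕ} (F : (Fin (k + 1) → Bool) → β) :
    ∑ z, F z = ∑ b : Bool, ∑ z : Fin k → Bool, F (Fin.cons b z) := by
  rw [← Fintype.sum_prod_type']
  exact (Equiv.sum_comp (Fin.consEquiv fun _ => Bool) F).symm

/-- The mean of the sign of a random label. -/
noncomputable def boolMean (q : PMF Bool) : ℝ := (q true).toReal - (q false).toReal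

lemma toReal_add_toReal (q : PMF Bool) : (q true).toReal + (q false).toReal = 1 := by
  have h := q.tsum_coe
  rw [tsum_bool, add_comm] at h
  rw [← ENNReal.toReal_add (q.apply_ne_top _) (q.apply_ne_top _), h]
  rfl

lemma toReal_apply_eq (q : PMF Bool) (b : Bool) :
    (q b).toReal = (1 + boolMean q * (sgn b : ℝ)) / 2 := by
  have := toReal_add_toReal q
  unfold boolMean
  cases b <;> simp [sgn] <;> linarith

section Mean
variable {X : Type*}

lemma map_eval_apply (H : PMF (X → Bool)) (x : X) (b : Bool) :
    H.map (fun h => h x) b = ∑' h, H h * if h x = b then 1 else 0 := by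
  rw [PMF.map_apply]
  refine tsum_congr fun h => ?_
  by_cases hb : h x = b
  · simp [hb]
  · simp [hb, Ne.symm hb]

lemma mean_eq_boolMean (H : PMF (X → Bool)) (x : X) :
    mean H x = boolMean (H.map fun h => h x) := by
  have hne : ∀ b h, (H h * if h x = b then (1 : ℝ≥0∞) else 0) ≠ ⊤ := fun b h =>
    ENNReal.mul_ne_top (H.apply_ne_top h) (by split_ifs <;> simp)
  have hsum : ∀ b, Summable fun h => (H h * if h x = b then (1 : ℝ≥0∞) else 0).toReal := by
    intro b
    refine ENNReal.summable_toReal ?_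
    rw [← map_eval_apply]
    exact PMF.apply_ne_top _ _
  rw [boolMean, map_eval_apply, map_eval_apply, ENNReal.tsum_toReal_eq (hne true),
    ENNReal.tsum_toReal_eq (hne false), ← (hsum true).tsum_sub (hsum false), mean]
  refine tsum_congr fun h => ?_
  cases hb : h x <;> simp [sgn]

lemma abs_mean_le_one (H : PMF (X → Bool)) (x : X) : |mean H x| ≤ 1 := by
  rw [mean_eq_boolMean]
  have := toReal_add_toReal (H.map fun h => h x)
  unfold boolMean
  rw [abs_le]
  constructor <;>
    linarith [ENNReal.toReal_nonneg (a := H.map (fun h => h x) true),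
      ENNReal.toReal_nonneg (a := H.map (fun h => h x) false)]

lemma tsum_mul_wrong (H : PMF (X → Bool)) (x : X) (y : Bool) :
    ∑' h, H h * (if h x ≠ y then 1 else 0) = ENNReal.ofReal ((1 - mean H x * sgn y) / 2) := by
  have h1 : ∑' h, H h * (if h x ≠ y then (1 : ℝ≥0∞) else 0) = H.map (fun h => h x) (!y) := by
    rw [map_eval_apply]
    refine tsum_congr fun h => ?_
    cases hx : h x <;> cases y <;> simp
  rw [h1, ← ENNReal.ofReal_toReal (PMF.apply_ne_top _ _), toReal_apply_eq, mean_eq_boolMean]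
  congr 2
  cases y <;> simp [sgn]
  ring

lemma iidDraws_map {A B : Type*} (f : A → B) (μ : PMF A) (k : ℕ) :
    (iidDraws μ k).map (fun v i => f (v i)) = iidDraws (μ.map f) k := by
  induction k with
  | zero =>
    rw [iidDraws, iidDraws, PMF.pure_map]
    congr 1
    exact Subsingleton.elim _ _
  | succ k ih =>
    rw [iidDraws, iidDraws, PMF.map_bind, PMF.bind_map]
    congr 1
    funext a
    rw [Function.comp_apply, ← ih, PMF.map_comp, PMF.map_comp]
    congr 1
    funext v i
    refine Fin.cases ?_ (fun j => ?_) i <;> simp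

lemma iidDraws_apply (q : PMF Bool) (k : ℕ) (z : Fin k → Bool) :
    iidDraws q k z = ∏ i, q (z i) := by
  induction k with
  | zero =>
    rw [iidDraws, Subsingleton.elim z Fin.elim0]
    simp
  | succ k ih =>
    have hcons : ∀ a, (iidDraws q k).map (fun v => (Fin.cons a v : Fin (k + 1) → Bool)) z =
        if z 0 = a then ∏ i : Fin k, q (z i.succ) else 0 := by
      intro a
      rw [PMF.map_apply]
      have h1 : ∀ v : Fin k → Bool, (z = Fin.cons a v) ↔ (z 0 = a ∧ v = Fin.tail z) := by
        intro v
        constructor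
        · rintro rfl
          exact ⟨rfl, rfl⟩
        · rintro ⟨rfl, rfl⟩
          exact (Fin.cons_self_tail z).symm
      simp_rw [h1]
      by_cases h : z 0 = a
      · simp only [h, true_and, if_true]
        rw [tsum_ite_eq, ih]
        rfl
      · simp [h]
    rw [iidDraws, PMF.bind_apply, tsum_bool, hcons, hcons, Fin.prod_univ_succ]
    cases h : z 0 <;> simp

lemma boolMean_majority (q : PMF Bool) (k : ℕ) :
    boolMean ((iidDraws q k).map signSum) = M k (boolMean q) := by
  have h1 : ∀ b, ((iidDraws q k).map signSum b).toReal =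
      ∑ z : Fin k → Bool, if b = signSum z then ∏ i, (1 + boolMean q * (sgn (z i) : ℝ)) / 2 else 0 := by
    intro b
    rw [PMF.map_apply, tsum_fintype, ENNReal.toReal_sum fun z _ => by
      split_ifs
      · exact PMF.apply_ne_top _ _
      · simp]
    refine Finset.sum_congr rfl fun z _ => ?_
    split_ifs
    · rw [iidDraws_apply, ENNReal.toReal_prod]
      exact Finset.prod_congr rfl fun i _ => toReal_apply_eq q (z i)
    · rfl
  rw [boolMean, h1, h1, ← Finset.sum_sub_distrib, M]
  refine Finset.sum_congr rfl fun z _ => ?_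
  cases h : signSum z <;> simp [sgn]

lemma signSum_const (b : Bool) : signSum (fun _ : Fin 7 => b) = b := by
  cases b <;> simp [signSum, sgn]

/-- The mean of the mixture of majorities is `g` of the mean of a single draw. -/
theorem mean_majMixture (μ : PMF (X → Bool)) (x : X) : mean (majMixture μ) x = g (mean μ x) := by
  set q := μ.map fun h => h x with hq
  have hmaj : ((iidDraws μ 7).map fun c => maj c).map (fun h => h x) =
      (iidDraws q 7).map signSum := by
    rw [PMF.map_comp, hq, ← iidDraws_map, PMF.map_comp]
    rfl
  have hone : (μ.map fun c => maj fun _ : Fin 7 => c).map (fun h => h x) = q := by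
    rw [PMF.map_comp, hq]
    congr 1
    funext c
    exact signSum_const (c x)
  have hmix : ∀ b, ((majMixture μ).map (fun h => h x) b).toReal =
      16 / 19 * ((iidDraws q 7).map signSum b).toReal + 3 / 19 * (q b).toReal := by
    intro b
    have h19 : ∀ a : ℝ≥0∞, a ≠ ⊤ → a / 19 ≠ ⊤ := fun a ha => ENNReal.div_ne_top ha (by norm_num)
    rw [majMixture, PMF.map_bind, PMF.bind_apply, tsum_bool]
    simp only [PMF.ofFintype_apply, Bool.false_eq_true, if_false, if_true, hmaj, hone]
    rw [ENNReal.toReal_add (ENNReal.mul_ne_top (h19 _ (by simp)) (PMF.apply_ne_top _ _))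
      (ENNReal.mul_ne_top (h19 _ (by simp)) (PMF.apply_ne_top _ _))]
    simp
    ring
  rw [mean_eq_boolMean, boolMean, hmix, hmix, mean_eq_boolMean, ← hq, g, ← boolMean_majority]
  unfold boolMean
  ring

lemma iidDraws_support {A : Type*} (μ : PMF A) (k : ℕ) {v : Fin k → A}
    (hv : v ∈ (iidDraws μ k).support) (i : Fin k) : v i ∈ μ.support := by
  induction k with
  | zero => exact i.elim0
  | succ k ih =>
    rw [iidDraws, PMF.mem_support_bind_iff] at hv
    obtain ⟨a, ha, hv⟩ := hv
    rw [PMF.mem_support_map_iff] at hv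
    obtain ⟨w, hw, rfl⟩ := hv
    refine Fin.cases ?_ (fun j => ?_) i
    · simpa using ha
    · simpa using ih hw j

theorem support_majMixture_subset {C : Set (X → Bool)} {μ : PMF (X → Bool)} (h : μ.support ⊆ C) :
    (majMixture μ).support ⊆ Maj 7 C := by
  intro f hf
  rw [majMixture, PMF.mem_support_bind_iff] at hf
  obtain ⟨b, -, hf⟩ := hf
  cases b
  · simp only [Bool.false_eq_true, if_false, PMF.mem_support_map_iff] at hf
    obtain ⟨c, hc, rfl⟩ := hf
    exact ⟨fun _ => c, fun _ => h hc, rfl⟩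
  · simp only [if_true, PMF.mem_support_map_iff] at hf
    obtain ⟨c, hc, rfl⟩ := hf
    exact ⟨c, fun i => h (iidDraws_support μ 7 hc i), rfl⟩

variable [MeasurableSpace X]

/-- A bound on the errors of the hypotheses in the support by weighted empirical errors yields one
on the error of the randomized hypothesis. -/
lemma error_le_of_forall_support {D : Measure X} {H : PMF (X → Bool)} {c : X → Bool} {n : ℕ}
    (S : Fin n → X × Bool) (β : Fin n → ℝ) (hβ : ∀ i, 0 ≤ β i) {u : ℝ} (hu : 0 ≤ u)
    (h : ∀ f ∈ H.support, D {x | f x ≠ c x} ≤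
      ENNReal.ofReal (u + ∑ i, β i * if f (S i).1 ≠ (S i).2 then 1 else 0)) :
    error D H c ≤
      ENNReal.ofReal (u + ∑ i, β i * ((1 - mean H (S i).1 * sgn (S i).2) / 2)) := by
  have hnn : ∀ i, 0 ≤ (1 - mean H (S i).1 * sgn (S i).2) / 2 := by
    intro i
    have := abs_le.1 (abs_mean_le_one H (S i).1)
    cases (S i).2 <;> simp [sgn] <;> linarith
  have hind : ∀ (f : X → Bool) i, (0 : ℝ) ≤ if f (S i).1 ≠ (S i).2 then 1 else 0 := fun f i => by
    split_ifs <;> norm_num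
  calc error D H c ≤ ∑' f, H f * ENNReal.ofReal
        (u + ∑ i, β i * if f (S i).1 ≠ (S i).2 then 1 else 0) := by
        refine ENNReal.tsum_le_tsum fun f => ?_
        by_cases hf : H f = 0
        · simp [hf]
        · gcongr
          exact h f ((PMF.mem_support_iff _ _).2 hf)
    _ = ∑' f, (H f * ENNReal.ofReal u + ∑ i, ENNReal.ofReal (β i) *
          (H f * if f (S i).1 ≠ (S i).2 then 1 else 0)) := by
        refine tsum_congr fun f => ?_
        rw [ENNReal.ofReal_add hu (Finset.sum_nonneg fun i _ => mul_nonneg (hβ i) (hind f i)),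
          mul_add, ENNReal.ofReal_sum_of_nonneg fun i _ => mul_nonneg (hβ i) (hind f i),
          Finset.mul_sum]
        congr 1
        refine Finset.sum_congr rfl fun i _ => ?_
        rw [ENNReal.ofReal_mul (hβ i)]
        split_ifs
        · simp [mul_comm]
        · simp
    _ = ENNReal.ofReal u + ∑ i, ENNReal.ofReal (β i) *
          ENNReal.ofReal ((1 - mean H (S i).1 * sgn (S i).2) / 2) := by
        rw [ENNReal.tsum_add, ENNReal.tsum_mul_right, H.tsum_coe, one_mul,
          Summable.tsum_finsetSum fun i _ => ENNReal.summable]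
        congr 1
        refine Finset.sum_congr rfl fun i _ => ?_
        rw [ENNReal.tsum_mul_left, tsum_mul_wrong]
    _ = _ := by
        rw [ENNReal.ofReal_add hu (Finset.sum_nonneg fun i _ => mul_nonneg (hβ i) (hnn i)),
          ENNReal.ofReal_sum_of_nonneg fun i _ => mul_nonneg (hβ i) (hnn i)]
        congr 1
        exact Finset.sum_congr rfl fun i _ => (ENNReal.ofReal_mul (hβ i)).symm

lemma error_le_one {D : Measure X} [IsProbabilityMeasure D] (H : PMF (X → Bool)) (c : X → Bool) :
    error D H c ≤ 1 := by
  rw [← H.tsum_coe]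
  refine ENNReal.tsum_le_tsum fun f => ?_
  calc _ ≤ H f * 1 := by gcongr; exact prob_le_one
    _ = _ := mul_one _

end Mean

/-! ### The polynomial `g` -/

/-- The mean of `sign (s + z_1 + ⋯ + z_k)`, for independent signs of mean `t`. -/
noncomputable def shiftedM (t : ℝ) : ℕ → ℤ → ℝ
  | 0, s => if 0 ≤ s then 1 else -1
  | k + 1, s => (1 + t) / 2 * shiftedM t k (s + 1) + (1 - t) / 2 * shiftedM t k (s + -1)

lemma sum_signs_eq_shiftedM (t : ℝ) (k : ℕ) (s : ℤ) :
    ∑ z : Fin k → Bool, (∏ i, (1 + t * (sgn (z i) : ℝ)) / 2) *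
      (sgn (decide (0 ≤ s + ∑ i, sgn (z i))) : ℝ) = shiftedM t k s := by
  induction k generalizing s with
  | zero =>
    simp only [Finset.univ_unique, Finset.univ_eq_empty, Finset.prod_empty, Finset.sum_empty,
      add_zero, one_mul, Finset.sum_const, Finset.card_singleton, one_smul, shiftedM, sgn]
    by_cases h : 0 ≤ s <;> simp [h]
  | succ k ih =>
    rw [sum_bool_fun_succ, Fintype.sum_bool, shiftedM, ← ih, ← ih, Finset.mul_sum, Finset.mul_sum]
    simp only [Fin.prod_univ_succ, Fin.sum_univ_succ, Fin.cons_zero, Fin.cons_succ, ← add_assoc]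
    congr 1 <;> refine Finset.sum_congr rfl fun z _ => ?_
    · rw [show sgn true = 1 from rfl, Int.cast_one, mul_one]
      ring
    · rw [show sgn false = -1 from rfl, Int.cast_neg, Int.cast_one, mul_neg_one, ← sub_eq_add_neg]
      ring

/-- Tracking only the running sum of the signs, as `shiftedM` does, merges most of the 2^7 terms. -/
lemma M_seven (t : ℝ) : M 7 t = (35 * t - 35 * t ^ 3 + 21 * t ^ 5 - 5 * t ^ 7) / 16 := by
  have h := sum_signs_eq_shiftedM t 7 0
  simp only [zero_add] at h
  rw [M]
  simp only [signSum]
  rw [h]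
  simp only [shiftedM]
  norm_num
  ring

lemma g_eq (t : ℝ) : g t = (38 * t - 35 * t ^ 3 + 21 * t ^ 5 - 5 * t ^ 7) / 19 := by
  rw [g, M_seven]
  ring

lemma g_mul_sgn (t : ℝ) (b : Bool) : g t * sgn b = g (t * sgn b) := by
  rw [g_eq, g_eq]
  cases b <;> simp [sgn]
  ring

/-- The weight of a point of margin `m`, up to a constant. -/
def weight (m : ℝ) : ℝ := 1 + (1 - m) ^ 2

/-- The difference of the two sides is m²(1 - m). -/
lemma weight_mul_one_add_le {m : ℝ} (h1 : m ≤ 1) : weight m * (1 + m) ≤ 2 := by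
  unfold weight
  nlinarith [mul_nonneg (sq_nonneg m) (by linarith : 0 ≤ 1 - m)]

/-- The mixing weights 16/19 and 3/19 give g the slope 2 at 0, so the linear terms cancel. The
difference is m²(1 - m)(57 - m(1 + m)(32 - 10m²))/19. -/
lemma two_mul_one_sub_g_le {m : ℝ} (h0 : -1 ≤ m) (h1 : m ≤ 1) :
    2 * (1 - g m) ≤ weight m * (1 - m) := by
  rw [g_eq, weight]
  have h2 : m * (1 + m) ≤ 1 / 2 + 3 / 2 * m ^ 2 := by nlinarith [sq_nonneg (m - 1)]
  have h3 : m ^ 2 ≤ 1 := by nlinarith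
  have h4 : 0 ≤ 57 - m * (1 + m) * (32 - 10 * m ^ 2) := by
    nlinarith [mul_le_mul_of_nonneg_right h2 (by linarith : 0 ≤ 32 - 10 * m ^ 2), sq_nonneg m]
  have h5 : 0 ≤ m ^ 2 * ((1 - m) * (57 - m * (1 + m) * (32 - 10 * m ^ 2))) :=
    mul_nonneg (sq_nonneg m) (mul_nonneg (by linarith) h4)
  nlinarith

/-! ### The Frank–Wolfe method with integer weights -/

/-- The potential whose derivative is `-weight`. -/
noncomputable def potential (m : ℝ) : ℝ := -m + (1 - m) ^ 3 / 3

/-- The Taylor expansion of the cubic is exact; in its remainder (z - m)² is at most 4 and the other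
factor at most 2. -/
lemma potential_step_le {m z γ : ℝ} (hm0 : -1 ≤ m) (hm1 : m ≤ 1) (hz0 : -1 ≤ z) (hz1 : z ≤ 1)
    (hγ0 : 0 ≤ γ) (hγ1 : γ ≤ 1) :
    potential (m + γ * (z - m)) ≤ potential m - γ * (weight m * (z - m)) + 8 * γ ^ 2 := by
  have h1 : potential (m + γ * (z - m)) = potential m - γ * (weight m * (z - m)) +
      γ ^ 2 * ((z - m) ^ 2 * (1 - m - γ * (z - m) / 3)) := by
    unfold potential weight; ring
  have h2 : 1 - m - γ * (z - m) / 3 ≤ 2 := by nlinarith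
  have h3 : (z - m) ^ 2 ≤ 4 := by nlinarith
  have h4 : (z - m) ^ 2 * (1 - m - γ * (z - m) / 3) ≤ 8 := by nlinarith [sq_nonneg (z - m)]
  have h5 := mul_le_mul_of_nonneg_left h4 (sq_nonneg γ)
  rw [h1]
  linarith

/-- The tangent inequality for `potential`, which is convex to the left of 1. -/
lemma potential_sub_le {m u : ℝ} (hm1 : m ≤ 1) (hu1 : u ≤ 1) :
    potential m - potential u ≤ weight m * (u - m) := by
  have h1 : weight m * (u - m) - (potential m - potential u) =
      (u - m) ^ 2 * ((1 - m) * (2 / 3) + (1 - u) / 3) := by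
    unfold potential weight; ring
  have h2 : 0 ≤ (u - m) ^ 2 * ((1 - m) * (2 / 3) + (1 - u) / 3) :=
    mul_nonneg (sq_nonneg _) (by linarith)
  linarith

lemma potential_sub_le_const {m u : ℝ} (hm0 : -1 ≤ m) (hm1 : m ≤ 1) (hu1 : u ≤ 1) :
    potential m - potential u ≤ 32 / 3 := by
  have h1 : (1 - m) ^ 3 ≤ 2 ^ 3 := pow_le_pow_left₀ (by linarith) (by linarith) 3
  have h2 : 0 ≤ (1 - u) ^ 3 := pow_nonneg (by linarith) 3
  unfold potential
  linarith

/-- The total multiplicity of the first `t` concepts, of which number `j` is taken `j + 1` times. -/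
def triang (t : ℕ) : ℤ := ∑ j ∈ Finset.range t, ((j : ℤ) + 1)

/-- The total correctness of the first `t` concepts at the point `i`. -/
def score (z : ℕ → ℕ → ℤ) (t i : ℕ) : ℤ := ∑ j ∈ Finset.range t, ((j : ℤ) + 1) * z j i

/-- The integer weight of the point `i` after `t` concepts. -/
def wt (z : ℕ → ℕ → ℤ) (t i : ℕ) : ℤ :=
  triang t * triang t + (triang t - score z t i) * (triang t - score z t i)

/-- The scaled Frank–Wolfe gap of the concept number `t`. -/
def gap (z : ℕ → ℕ → ℤ) (n t : ℕ) : ℤ :=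
  ∑ i ∈ Finset.range n, wt z t i * (triang t * z t i - score z t i)

lemma triang_succ (t : ℕ) : triang (t + 1) = triang t + (t + 1) := Finset.sum_range_succ _ _

lemma two_mul_triang (t : ℕ) : 2 * triang t = t * (t + 1) := by
  induction t with
  | zero => simp [triang]
  | succ t ih => rw [triang_succ, mul_add, ih]; push_cast; ring

lemma triang_nonneg (t : ℕ) : 0 ≤ triang t := Finset.sum_nonneg fun _ _ => by positivity

lemma triang_pos {t : ℕ} (ht : 1 ≤ t) : 0 < triang t := by
  have := two_mul_triang t
  have h : (1 : ℤ) ≤ t := by exact_mod_cast ht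
  nlinarith

lemma abs_score_le {z : ℕ → ℕ → ℤ} (hz : ∀ j i, |z j i| ≤ 1) (t i : ℕ) :
    |score z t i| ≤ triang t := by
  refine (Finset.abs_sum_le_sum_abs _ _).trans (Finset.sum_le_sum fun j _ => ?_)
  rw [abs_mul, abs_of_nonneg (by positivity : (0 : ℤ) ≤ (j : ℤ) + 1)]
  nlinarith [hz j i]

lemma wt_nonneg (z : ℕ → ℕ → ℤ) (t i : ℕ) : 0 ≤ wt z t i :=
  add_nonneg (mul_self_nonneg _) (mul_self_nonneg _)

/-- The margin of the point `i` after `t` concepts. -/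
noncomputable def margin (z : ℕ → ℕ → ℤ) (t i : ℕ) : ℝ := (score z t i : ℝ) / triang t

section FrankWolfe
variable {z : ℕ → ℕ → ℤ}

lemma abs_margin_le (hz : ∀ j i, |z j i| ≤ 1) (t i : ℕ) : |margin z t i| ≤ 1 := by
  have h0 : (0 : ℝ) ≤ triang t := by exact_mod_cast triang_nonneg t
  rw [margin, abs_div, abs_of_nonneg h0]
  refine div_le_one_of_le₀ ?_ h0
  exact_mod_cast abs_score_le hz t i

/-- The new concept has multiplicity t + 1 out of (t + 1)(t + 2)/2. So integer multiplicities
reproduce the standard Frank–Wolfe step 2/(t + 2). -/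
lemma margin_succ {t : ℕ} (ht : 1 ≤ t) (i : ℕ) :
    margin z (t + 1) i = margin z t i + 2 / (t + 2) * (z t i - margin z t i) := by
  have h0 : (0 : ℝ) < triang t := by exact_mod_cast triang_pos ht
  have h1 : (0 : ℝ) < triang (t + 1) := by exact_mod_cast triang_pos (by omega : 1 ≤ t + 1)
  have h2 : (triang (t + 1) : ℝ) = triang t + (t + 1) := by exact_mod_cast triang_succ t
  have h3 : 2 * (triang t : ℝ) = t * (t + 1) := by exact_mod_cast two_mul_triang t
  have h4 : (score z (t + 1) i : ℝ) = score z t i + (t + 1) * z t i := by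
    exact_mod_cast Finset.sum_range_succ (fun j => ((j : ℤ) + 1) * z j i) t
  have ht' : (0 : ℝ) < t := by exact_mod_cast ht
  have h5 : (triang t : ℝ) = t * (t + 1) / 2 := by linarith
  rw [margin, margin, h4, h2, h5]
  field_simp
  ring

lemma wt_eq {t : ℕ} (ht : 1 ≤ t) (i : ℕ) :
    (wt z t i : ℝ) = (triang t : ℝ) ^ 2 * weight (margin z t i) := by
  have h0 : (0 : ℝ) < triang t := by exact_mod_cast triang_pos ht
  rw [wt, margin, weight]
  push_cast
  field_simp

/-- The Frank–Wolfe gap of the labels `v`. -/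
noncomputable def marginGap (z : ℕ → ℕ → ℤ) (n t : ℕ) (v : ℕ → ℝ) : ℝ :=
  ∑ i ∈ Finset.range n, weight (margin z t i) * (v i - margin z t i)

lemma gap_eq {t : ℕ} (ht : 1 ≤ t) (n : ℕ) :
    (gap z n t : ℝ) = (triang t : ℝ) ^ 3 * marginGap z n t fun i => z t i := by
  have h0 : (0 : ℝ) < triang t := by exact_mod_cast triang_pos ht
  rw [gap, marginGap, Finset.mul_sum, Int.cast_sum]
  refine Finset.sum_congr rfl fun i _ => ?_
  rw [Int.cast_mul, wt_eq ht, margin]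
  push_cast
  field_simp

lemma marginGap_le_of_sum_wt_le {t : ℕ} (ht : 1 ≤ t) {n : ℕ} {v w : ℕ → ℝ}
    (h : ∑ i ∈ Finset.range n, (wt z t i : ℝ) * v i ≤ ∑ i ∈ Finset.range n, (wt z t i : ℝ) * w i) :
    marginGap z n t v ≤ marginGap z n t w := by
  have h0 : (0 : ℝ) < triang t := by exact_mod_cast triang_pos ht
  have h1 : ∀ v : ℕ → ℝ, ∑ i ∈ Finset.range n, (wt z t i : ℝ) * v i =
      (triang t : ℝ) ^ 2 * (marginGap z n t v +
        ∑ i ∈ Finset.range n, weight (margin z t i) * margin z t i) := by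
    intro v
    rw [marginGap, ← Finset.sum_add_distrib, Finset.mul_sum]
    exact Finset.sum_congr rfl fun i _ => by rw [wt_eq ht]; ring
  rw [h1, h1, mul_le_mul_iff_right₀ (by positivity)] at h
  linarith

/-- If every concept is optimal for the weights at its time among the sequence, then the gap becomes
small in time proportional to its inverse. -/
theorem exists_small_gap (hz : ∀ j i, |z j i| ≤ 1) {n : ℕ}
    (hopt : ∀ t j, ∑ i ∈ Finset.range n, wt z t i * z j i ≤
      ∑ i ∈ Finset.range n, wt z t i * z t i) {k : ℕ} (hk : 1 ≤ k) :
    ∃ t, 1 ≤ t ∧ t ≤ 512 * k ∧ 4 * k * gap z n t ≤ n * triang t ^ 3 := by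
  by_contra! hcon
  have hn : 0 < n := by
    rcases Nat.eq_zero_or_pos n with rfl | h
    · have := hcon 1 le_rfl (by omega)
      simp [gap] at this
    · exact h
  have hn' : (0 : ℝ) < n := by exact_mod_cast hn
  have hk' : (1 : ℝ) ≤ k := by exact_mod_cast hk
  -- Suppose that the gap stays above n/(4k). The first a rounds bring the excess of the potential
  -- down to 32n/(a + 2). The next a + 1 rounds must lower it by n/(4k) in total, up to second-order
  -- terms of at most 32n/(a + 2). This is impossible, as 64/(a + 2) < 1/(4k) for this a.
  set a := 256 * k with ha
  have ha' : (a : ℝ) = 256 * k := by rw [ha]; push_cast; rfl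
  -- The comparison point is the last iterate instead of a minimiser. It is a mixture of concepts of
  -- the sequence, so `hopt` bounds the excess by the gap, and the final excess is exactly zero.
  set u := 2 * a + 1 with hu
  set f : ℕ → ℝ := fun t => ∑ i ∈ Finset.range n, potential (margin z t i) with hf
  set gp : ℕ → ℝ := fun t => marginGap z n t fun i => z t i with hgp
  have hm : ∀ t i, -1 ≤ margin z t i ∧ margin z t i ≤ 1 := fun t i => abs_le.1 (abs_margin_le hz t i)
  have hz' : ∀ j i, -1 ≤ (z j i : ℝ) ∧ (z j i : ℝ) ≤ 1 := fun j i => by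
    obtain ⟨h1, h2⟩ := abs_le.1 (hz j i)
    exact ⟨by exact_mod_cast h1, by exact_mod_cast h2⟩
  have hstep : ∀ t, 1 ≤ t → f (t + 1) ≤ f t - 2 / (t + 2) * gp t + 8 * (2 / (t + 2)) ^ 2 * n := by
    intro t ht
    have ht0 : (0 : ℝ) ≤ t := Nat.cast_nonneg t
    have h1 : (2 : ℝ) / (t + 2) ≤ 1 := by rw [div_le_one (by positivity)]; linarith
    calc f (t + 1) ≤ ∑ i ∈ Finset.range n, (potential (margin z t i) -
          2 / (t + 2) * (weight (margin z t i) * (z t i - margin z t i)) +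
          8 * (2 / (t + 2)) ^ 2) := by
          refine Finset.sum_le_sum fun i _ => ?_
          rw [margin_succ ht]
          exact potential_step_le (hm t i).1 (hm t i).2 (hz' t i).1 (hz' t i).2 (by positivity) h1
      _ = _ := by
          rw [Finset.sum_add_distrib, Finset.sum_sub_distrib, ← Finset.mul_sum]
          simp [hf, hgp, marginGap]
          ring
  have hconv : ∀ t, 1 ≤ t → f t - f u ≤ gp t := by
    intro t ht
    have h0 : (0 : ℝ) < triang u := by exact_mod_cast triang_pos (by omega : 1 ≤ u)
    have hsum : (∑ i ∈ Finset.range n, (wt z t i : ℝ) * margin z u i) ≤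
        ∑ i ∈ Finset.range n, (wt z t i : ℝ) * z t i := by
      have h1 : ∀ i, (wt z t i : ℝ) * margin z u i =
          (∑ j ∈ Finset.range u, ((j : ℝ) + 1) * ((wt z t i : ℝ) * z j i)) / triang u := by
        intro i
        rw [margin, score, mul_div_assoc', Int.cast_sum, Finset.mul_sum]
        congr 1
        refine Finset.sum_congr rfl fun j _ => ?_
        push_cast
        ring
      simp_rw [h1]
      rw [← Finset.sum_div, div_le_iff₀ h0, Finset.sum_comm]
      have h2 : (triang u : ℝ) = ∑ j ∈ Finset.range u, ((j : ℝ) + 1) := by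
        rw [triang]; push_cast; rfl
      rw [h2, Finset.mul_sum]
      refine Finset.sum_le_sum fun j _ => ?_
      rw [← Finset.mul_sum, mul_comm]
      refine mul_le_mul_of_nonneg_right ?_ (by positivity)
      exact_mod_cast hopt t j
    calc f t - f u = ∑ i ∈ Finset.range n, (potential (margin z t i) - potential (margin z u i)) := by
          rw [Finset.sum_sub_distrib]
      _ ≤ marginGap z n t fun i => margin z u i :=
          Finset.sum_le_sum fun i _ => potential_sub_le (hm t i).2 (hm u i).2
      _ ≤ gp t := marginGap_le_of_sum_wt_le ht hsum
  have hbig : ∀ t, 1 ≤ t → t ≤ 2 * a → 1 / (4 * k) * n ≤ gp t := by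
    intro t ht hta
    have h0 : (0 : ℝ) < triang t := by exact_mod_cast triang_pos ht
    have h1 : (n : ℝ) * (triang t : ℝ) ^ 3 < 4 * k * gap z n t := by
      exact_mod_cast hcon t ht (by omega)
    rw [gap_eq ht] at h1
    have h2 : (n : ℝ) * (triang t : ℝ) ^ 3 < (4 * k * gp t) * (triang t : ℝ) ^ 3 := by
      rw [hgp]; linarith
    have h3 := lt_of_mul_lt_mul_right h2 (by positivity)
    rw [div_mul_eq_mul_div, one_mul, div_le_iff₀ (by positivity)]
    linarith
  -- The excess h satisfies h(t+1) ≤ (1 - 2/(t+2)) h(t) + 32n/(t+2)². At t = 1 the bound is the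
  -- total variation 32/3 of `potential_sub_le_const`.
  have hdecay : ∀ t, 1 ≤ t → f t - f u ≤ 32 / (t + 2) * n := by
    intro t ht
    induction t, ht using Nat.le_induction with
    | base =>
      rw [hf]
      simp only
      rw [← Finset.sum_sub_distrib]
      refine (Finset.sum_le_card_nsmul _ _ (32 / 3) fun i _ => potential_sub_le_const (hm 1 i).1
        (hm 1 i).2 (hm u i).2).trans_eq ?_
      simp
      ring
    | succ t ht ih =>
      have h1 := hstep t ht
      have h2 := hconv t ht
      have ht0 : (0 : ℝ) ≤ t := Nat.cast_nonneg t
      have h3 : 2 / ((t : ℝ) + 2) * (f t - f u) ≤ 2 / (t + 2) * gp t :=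
        mul_le_mul_of_nonneg_left h2 (by positivity)
      have h4 : (1 - 2 / ((t : ℝ) + 2)) * (f t - f u) ≤
          (1 - 2 / (t + 2)) * (32 / (t + 2) * n) := by
        refine mul_le_mul_of_nonneg_left ih ?_
        rw [sub_nonneg, div_le_one (by positivity)]
        linarith
      have h5 : (1 - 2 / ((t : ℝ) + 2)) * (32 / (t + 2)) + 8 * (2 / (t + 2)) ^ 2 ≤ 32 / (t + 3) := by
        have : (1 - 2 / ((t : ℝ) + 2)) * (32 / (t + 2)) + 8 * (2 / (t + 2)) ^ 2 =
            32 * (t + 1) / (t + 2) ^ 2 := by field_simp; ring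
        rw [this, div_le_div_iff₀ (by positivity) (by positivity)]
        nlinarith
      have h6 := mul_le_mul_of_nonneg_right h5 hn'.le
      push_cast
      have h7 : (t : ℝ) + 1 + 2 = t + 3 := by ring
      rw [h7]
      linarith
  have hsum : ∀ s, s ≤ a + 1 → f (a + s) - f u ≤
      (32 / (a + 2) - s * (1 / (4 * k) / (a + 1)) + s * (32 / (a + 2) ^ 2)) * n := by
    intro s
    induction s with
    | zero =>
      intro _
      have := hdecay a (by omega)
      simpa using this
    | succ s ih =>
      intro hs
      have h1 := ih (by omega)
      have h2 := hstep (a + s) (by omega)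
      have h3 := hbig (a + s) (by omega) (by omega)
      have ha0 : (0 : ℝ) ≤ a := Nat.cast_nonneg a
      have hs0 : (0 : ℝ) ≤ s := Nat.cast_nonneg s
      have hsa : (s : ℝ) ≤ a := by exact_mod_cast (by omega : s ≤ a)
      push_cast at h2 ⊢
      have h4 : 1 / ((a : ℝ) + 1) ≤ 2 / (a + s + 2) := by
        rw [div_le_div_iff₀ (by positivity) (by positivity)]
        linarith
      have h5 : (1 / (4 * k) / (a + 1)) * n ≤ 2 / ((a : ℝ) + s + 2) * gp (a + s) := by
        calc (1 / (4 * k) / (a + 1)) * (n : ℝ) = 1 / ((a : ℝ) + 1) * (1 / (4 * k) * n) := by ring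
          _ ≤ _ := mul_le_mul h4 h3 (by positivity) (by positivity)
      have h6 : 8 * (2 / ((a : ℝ) + s + 2)) ^ 2 ≤ 32 / (a + 2) ^ 2 := by
        have : 8 * (2 / ((a : ℝ) + s + 2)) ^ 2 = 32 / (a + s + 2) ^ 2 := by
          rw [div_pow]; ring
        rw [this]
        gcongr
        linarith
      have h7 := mul_le_mul_of_nonneg_right h6 hn'.le
      rw [← add_assoc]
      linarith
  have hfin := hsum (a + 1) le_rfl
  have hau : a + (a + 1) = u := by omega
  rw [hau, sub_self] at hfin
  have hfin' : (0 : ℝ) ≤ 32 / (a + 2) - ((a + 1 : ℕ) : ℝ) * (1 / (4 * k) / (a + 1)) +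
      ((a + 1 : ℕ) : ℝ) * (32 / (a + 2) ^ 2) := nonneg_of_mul_nonneg_left hfin hn'
  have ha0 : (0 : ℝ) ≤ a := Nat.cast_nonneg a
  push_cast at hfin'
  have h1 : ((a : ℝ) + 1) * (1 / (4 * k) / (a + 1)) = 1 / (4 * k) := by field_simp
  have h2 : ((a : ℝ) + 1) * (32 / (a + 2) ^ 2) ≤ 32 / (a + 2) := by
    rw [mul_div_assoc', div_le_div_iff₀ (by positivity) (by positivity)]
    nlinarith
  have h3 : (64 : ℝ) / (a + 2) < 1 / (4 * k) := by
    rw [div_lt_div_iff₀ (by positivity) (by positivity), ha']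
    linarith
  have h4 : (64 : ℝ) / (a + 2) = 32 / (a + 2) + 32 / (a + 2) := by ring
  linarith

end FrankWolfe

/-! ### Bounding the running time of programs -/

namespace Expr

/-- If all variables are at most `V` in absolute value, then the value is at most `V ^ deg`. -/
def deg : Expr → ℕ
  | lit z => z.natAbs
  | var _ => 1
  | add a b => a.deg + b.deg + 1
  | sub a b => a.deg + b.deg + 1
  | mul a b => a.deg + b.deg
  | div a _ => a.deg
  | label _ => 0
  | value _ _ => 0

/-- If all variables are at most `V` in absolute value, then the cost is at most `V ^ costDeg`. -/
def costDeg : Expr → ℕ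
  | lit z => z.natAbs + 1
  | var _ => 2
  | add a b => a.costDeg + b.costDeg + a.deg + b.deg + 4
  | sub a b => a.costDeg + b.costDeg + a.deg + b.deg + 4
  | mul a b => a.costDeg + b.costDeg + a.deg + b.deg + 4
  | div a b => a.costDeg + b.costDeg + a.deg + b.deg + 4
  | label i => i.costDeg + i.deg + 3
  | value j i => j.costDeg + i.costDeg + j.deg + i.deg + 4

end Expr

/-- Bounding the bit length by the number itself is wasteful, but enough for polynomial time. -/
lemma width_le {z : ℤ} {V m : ℕ} (hV : 2 ≤ V) (h : z.natAbs ≤ V ^ m) : width z ≤ V ^ (m + 1) := by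
  have h1 : z.natAbs.size ≤ z.natAbs := Nat.size_le.2 Nat.lt_two_pow_self
  have h2 : 1 ≤ V ^ m := Nat.one_le_pow _ _ (by omega)
  have h3 : 2 * V ^ m ≤ V * V ^ m := Nat.mul_le_mul_right _ hV
  rw [width, pow_succ, mul_comm]
  omega

lemma pow_add_pow_add_one_le {V a b m : ℕ} (hV : 4 ≤ V) (ha : a ≤ m) (hb : b ≤ m) :
    V ^ a + V ^ b + V ^ m ≤ V ^ (m + 1) := by
  have h1 : V ^ a ≤ V ^ m := Nat.pow_le_pow_right (by omega) ha
  have h2 : V ^ b ≤ V ^ m := Nat.pow_le_pow_right (by omega) hb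
  have h3 : 4 * V ^ m ≤ V * V ^ m := Nat.mul_le_mul_right _ hV
  rw [pow_succ, mul_comm]
  omega

lemma natAbs_sgn (b : Bool) : (sgn b).natAbs = 1 := by cases b <;> rfl

section Cost
variable {X : Type*} (S : List (X × Bool)) (s : State X) {V : ℕ}

lemma Expr.natAbs_eval_le (hV : 4 ≤ V) (hs : ∀ v, (s.vars v).natAbs ≤ V) (e : Expr) :
    (e.eval S s).natAbs ≤ V ^ e.deg := by
  have hadd : ∀ a b : ℕ, V ^ a + V ^ b ≤ V ^ (a + b + 1) := fun a b =>
    (Nat.le_add_right _ _).trans (pow_add_pow_add_one_le hV (Nat.le_add_right a b)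
      (Nat.le_add_left b a))
  induction e with
  | lit z =>
    exact (Nat.lt_pow_self (by omega : 1 < V)).le
  | var v => simpa [Expr.eval, Expr.deg] using hs v
  | add a b iha ihb =>
    exact ((Int.natAbs_add_le _ _).trans (add_le_add iha ihb)).trans (hadd _ _)
  | sub a b iha ihb =>
    exact ((Int.natAbs_sub_le _ _).trans (add_le_add iha ihb)).trans (hadd _ _)
  | mul a b iha ihb =>
    rw [Expr.eval, Int.natAbs_mul, Expr.deg, pow_add]
    exact Nat.mul_le_mul iha ihb
  | div a b iha ihb =>
    exact (Int.natAbs_ediv_le_natAbs _ _).trans iha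
  | label i ih =>
    rw [Expr.eval, Expr.deg, pow_zero]
    cases entry S (i.eval S s) <;> simp [natAbs_sgn]
  | value j i ihj ihi =>
    rw [Expr.eval, Expr.deg, pow_zero]
    cases entry s.concepts (j.eval S s) <;> cases entry S (i.eval S s) <;> simp [natAbs_sgn]

lemma Expr.cost_le (hV : 4 ≤ V) (hs : ∀ v, (s.vars v).natAbs ≤ V) (e : Expr) :
    e.cost S s ≤ V ^ e.costDeg := by
  have hw : ∀ e : Expr, width (e.eval S s) ≤ V ^ (e.deg + 1) := fun e =>
    width_le (by omega) (e.natAbs_eval_le S s hV hs)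
  have hop : ∀ a b : Expr, a.cost S s ≤ V ^ a.costDeg → b.cost S s ≤ V ^ b.costDeg →
      a.cost S s + b.cost S s + width (a.eval S s) * width (b.eval S s) ≤
        V ^ (a.costDeg + b.costDeg + a.deg + b.deg + 4) := by
    intro a b ha hb
    have h1 : width (a.eval S s) * width (b.eval S s) ≤
        V ^ (a.costDeg + b.costDeg + a.deg + b.deg + 3) :=
      (Nat.mul_le_mul (hw a) (hw b)).trans (by
        rw [← pow_add]
        exact Nat.pow_le_pow_right (by omega) (by omega))
    exact (add_le_add (add_le_add ha hb) h1).trans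
      (pow_add_pow_add_one_le hV (by omega) (by omega))
  induction e with
  | lit z => exact hw (.lit z)
  | var v => exact hw (.var v)
  | add a b iha ihb => exact hop a b iha ihb
  | sub a b iha ihb => exact hop a b iha ihb
  | mul a b iha ihb => exact hop a b iha ihb
  | div a b iha ihb => exact hop a b iha ihb
  | label i ih =>
    have h1 : width (i.eval S s) ≤ V ^ (i.costDeg + i.deg + 2) :=
      (hw i).trans (Nat.pow_le_pow_right (by omega) (by omega))
    have h2 : V ^ i.costDeg + V ^ 0 + V ^ (i.costDeg + i.deg + 2) ≤ V ^ (i.costDeg + i.deg + 3) :=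
      pow_add_pow_add_one_le hV (by omega) (Nat.zero_le _)
    rw [Expr.cost, Expr.costDeg]
    omega
  | value j i ihj ihi =>
    have h1 : width (j.eval S s) + width (i.eval S s) ≤
        V ^ (j.costDeg + i.costDeg + j.deg + i.deg + 3) :=
      (add_le_add (hw j) (hw i)).trans ((Nat.le_add_right _ _).trans
        ((pow_add_pow_add_one_le hV (by omega : j.deg + 1 ≤ j.deg + i.deg + 2)
          (by omega : i.deg + 1 ≤ j.deg + i.deg + 2)).trans
          (Nat.pow_le_pow_right (by omega) (by omega))))
    have h2 : V ^ j.costDeg + V ^ i.costDeg + V ^ (j.costDeg + i.costDeg + j.deg + i.deg + 3) ≤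
        V ^ (j.costDeg + i.costDeg + j.deg + i.deg + 4) :=
      pow_add_pow_add_one_le hV (by omega) (by omega)
    rw [Expr.cost, Expr.costDeg]
    omega

end Cost

/-! ### Total correctness with time bounds -/

section Runs
variable {X : Type*} (O : List (X × Bool) → X → Bool) (S : List (X × Bool))

/-- The program halts within the given time in the given state. -/
def Runs (p : Cmd) (s : State X) (T : ℕ) (s' : State X) : Prop := ∃ t ≤ T, Exec O S p s t s'

/-- The state whose variables are given by a list. -/
def memory (l : List ℤ) (q : List (X × Bool)) (cs out : List (X → Bool)) : State X where
  vars := fun v => l.getD v 0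
  query := q
  concepts := cs
  output := out

/-- All entries are at most `V` in absolute value. -/
def Bdd (V : ℕ) (l : List ℤ) : Prop := ∀ x ∈ l, x.natAbs ≤ V

variable {O S} {V : ℕ} {l : List ℤ} {q : List (X × Bool)} {cs out : List (X → Bool)}

lemma Bdd.vars_le (h : Bdd V l) (v : ℕ) : ((memory l q cs out).vars v).natAbs ≤ V := by
  change (l.getD v 0).natAbs ≤ V
  rw [List.getD_eq_getElem?_getD]
  rcases lt_or_ge v l.length with hv | hv
  · simpa [hv] using h _ (List.getElem_mem hv)
  · simp [hv]

lemma Bdd.set (h : Bdd V l) {x : ℤ} (hx : x.natAbs ≤ V) (v : ℕ) : Bdd V (l.set v x) := by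
  intro y hy
  rcases List.mem_or_eq_of_mem_set hy with h1 | rfl
  · exact h y h1
  · exact hx

lemma one_add_cost_le (hV : 4 ≤ V) (h : Bdd V l) (e : Expr) {p : ℕ} (hp : e.costDeg + 1 ≤ p) :
    1 + e.cost S (memory l q cs out) ≤ V ^ p := by
  have h1 := e.cost_le S (memory l q cs out) hV h.vars_le
  have h2 : 1 ≤ V ^ e.costDeg := Nat.one_le_pow _ _ (by omega)
  have h3 : 4 * V ^ e.costDeg ≤ V * V ^ e.costDeg := Nat.mul_le_mul_right _ hV
  calc _ ≤ V ^ (e.costDeg + 1) := by rw [pow_succ, mul_comm]; omega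
    _ ≤ _ := Nat.pow_le_pow_right (by omega) hp

lemma Runs.mono {p : Cmd} {s s' : State X} {T T' : ℕ} (h : Runs O S p s T s') (hT : T ≤ T') :
    Runs O S p s T' s' :=
  let ⟨t, ht, he⟩ := h
  ⟨t, ht.trans hT, he⟩

lemma Runs.seq {p q : Cmd} {s₁ s₂ s₃ : State X} {T₁ T₂ : ℕ} (h₁ : Runs O S p s₁ T₁ s₂)
    (h₂ : Runs O S q s₂ T₂ s₃) : Runs O S (.seq p q) s₁ (T₁ + T₂) s₃ :=
  let ⟨t₁, ht₁, he₁⟩ := h₁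
  let ⟨t₂, ht₂, he₂⟩ := h₂
  ⟨t₁ + t₂, add_le_add ht₁ ht₂, .seq p q _ _ _ _ _ he₁ he₂⟩

lemma runs_assign (hV : 4 ≤ V) (h : Bdd V l) {p v : ℕ} {e : Expr} (hp : e.costDeg + 1 ≤ p)
    (hv : v < l.length) {x : ℤ} (hx : e.eval S (memory l q cs out) = x) :
    Runs O S (.assign v e) (memory l q cs out) (V ^ p) (memory (l.set v x) q cs out) := by
  refine ⟨_, one_add_cost_le (S := S) (q := q) (cs := cs) (out := out) hV h e hp, ?_⟩
  convert! Exec.assign (O := O) (S := S) (memory l q cs out) v e using 1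
  rw [hx]
  simp only [memory, State.mk.injEq, and_true]
  funext w
  rw [Function.update_apply, List.getD_eq_getElem?_getD, List.getElem?_set]
  by_cases hw : w = v
  · simp [hw, hv]
  · simp [hw, Ne.symm hw]

lemma runs_push (hV : 4 ≤ V) (h : Bdd V l) {p : ℕ} {i b : Expr} (hi : i.costDeg + 1 ≤ p)
    (hb : b.costDeg + 1 ≤ p) {x : X × Bool} (hx : entry S (i.eval S (memory l q cs out)) = some x)
    (hbx : decide (0 < b.eval S (memory l q cs out)) = x.2) :
    Runs O S (.push i b) (memory l q cs out) (2 * V ^ p) (memory l (q ++ [x]) cs out) := by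
  refine ⟨1 + i.cost S (memory l q cs out) + b.cost S (memory l q cs out), ?_, ?_⟩
  rotate_left
  · convert! Exec.push (O := O) (S := S) (memory l q cs out) i b x hx using 1
    rw [hbx]
    rfl
  · have h1 := one_add_cost_le (S := S) (q := q) (cs := cs) (out := out) hV h i hi
    have h2 := one_add_cost_le (S := S) (q := q) (cs := cs) (out := out) hV h b hb
    omega

lemma runs_call : Runs O S .call (memory l q cs out) 1 (memory l [] (cs ++ [O q]) out) :=
  ⟨1, le_rfl, .call _⟩

lemma runs_emit (hV : 4 ≤ V) (h : Bdd V l) {p : ℕ} {j : Expr} (hp : j.costDeg + 1 ≤ p)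
    {c : X → Bool} (hc : entry cs (j.eval S (memory l q cs out)) = some c) :
    Runs O S (.emit j) (memory l q cs out) (V ^ p) (memory l q cs (out ++ [c])) :=
  ⟨_, one_add_cost_le (S := S) (q := q) (cs := cs) (out := out) hV h j hp,
    .emit (memory l q cs out) j c hc⟩

lemma runs_loop {e : Expr} {p : Cmd} {N T c : ℕ} (f : ℕ → State X)
    (hpos : ∀ i < N, 0 < e.eval S (f i)) (hend : e.eval S (f N) ≤ 0)
    (hcost : ∀ i ≤ N, 1 + e.cost S (f i) ≤ c)
    (hbody : ∀ i < N, Runs O S p (f i) T (f (i + 1))) :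
    Runs O S (.loop e p) (f 0) (N * (c + T) + c) (f N) := by
  induction N generalizing f with
  | zero =>
    refine ⟨_, ?_, Exec.loop_done e p (f 0) hend⟩
    simpa using hcost 0 le_rfl
  | succ N ih =>
    obtain ⟨t₂, ht₂, he₂⟩ := ih (fun i => f (i + 1)) (fun i hi => hpos _ (by omega)) hend
      (fun i hi => hcost _ (by omega)) (fun i hi => hbody _ (by omega))
    obtain ⟨t₁, ht₁, he₁⟩ := hbody 0 (by omega)
    refine ⟨_, ?_, Exec.loop_step e p _ _ _ _ _ (hpos 0 (by omega)) he₁ he₂⟩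
    have := hcost 0 (by omega)
    rw [add_mul, one_mul]
    omega

end Runs

/-! ### The learning program

The variables `0, …, 9` hold the sample size `n`, the accuracy `k`, the number `t` of concepts, the
indices `i` of a point and `j` of a concept, the score of a point, `triang t`, the weight of a point,
the sign that tells whether the gap is still large, and the gap. -/

section Program
open MaliciousLearning.Cmd MaliciousLearning.Expr

/-- Compute the score and the weight of the point `i`. -/
def scoreCmd : Cmd :=
  seq (assign 5 (lit 0)) <| seq (assign 4 (lit 0)) <|
  seq (loop (sub (var 2) (var 4)) <|
    seq (assign 5 (add (var 5) (mul (add (var 4) (lit 1))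
      (mul (label (var 3)) (value (var 4) (var 3)))))) <|
    assign 4 (add (var 4) (lit 1))) <|
  assign 7 (add (mul (var 6) (var 6)) (mul (sub (var 6) (var 5)) (sub (var 6) (var 5))))

/-- Push the point `i` with its weight as multiplicity. -/
def pushCmd : Cmd :=
  seq scoreCmd <|
  seq (loop (var 7) <| seq (push (var 3) (label (var 3))) <| assign 7 (sub (var 7) (lit 1))) <|
  assign 3 (add (var 3) (lit 1))

/-- Build the weighted dataset. -/
def queryCmd : Cmd := seq (assign 3 (lit 0)) <| loop (sub (var 0) (var 3)) pushCmd

/-- Add the contribution of the point `i` to the gap. -/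
def gapStepCmd : Cmd :=
  seq scoreCmd <|
  seq (assign 9 (add (var 9) (mul (var 7)
    (sub (mul (var 6) (mul (label (var 3)) (value (var 2) (var 3)))) (var 5))))) <|
  assign 3 (add (var 3) (lit 1))

/-- Compute the gap of the last concept. -/
def gapCmd : Cmd :=
  seq (assign 3 (lit 0)) <| seq (assign 9 (lit 0)) <| loop (sub (var 0) (var 3)) gapStepCmd

/-- One step of the Frank–Wolfe method. -/
def roundCmd : Cmd :=
  seq (assign 6 (add (var 6) (var 2))) <| seq queryCmd <| seq call <| seq gapCmd <|
  seq (assign 8 (sub (mul (mul (lit 4) (var 1)) (var 9))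
    (mul (var 0) (mul (var 6) (mul (var 6) (var 6)))))) <|
  assign 2 (add (var 2) (lit 1))

/-- Output concept number `j` with multiplicity `j + 1`, for all concepts but the last. -/
def outputCmd : Cmd :=
  seq (assign 4 (lit 0)) <| loop (sub (sub (var 2) (lit 1)) (var 4)) <|
  seq (assign 3 (lit 0)) <|
  seq (loop (sub (add (var 4) (lit 1)) (var 3)) <|
    seq (emit (var 4)) <| assign 3 (add (var 3) (lit 1))) <|
  assign 4 (add (var 4) (lit 1))

/-- The learning program. -/
def learnerCmd : Cmd :=
  seq call <| seq (assign 2 (lit 1)) <| seq (assign 8 (lit 1)) <| seq (loop (var 8) roundCmd) outputCmd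

end Program

/-! ### Correctness and running time of the learning program. -/

section Correctness
variable {X : Type*}

lemma entry_natCast {A : Type*} (l : List A) (i : ℕ) : entry l (i : ℤ) = l[i]? := by
  simp [entry]

/-- The label of the point `i`, as a sign. -/
def labelAt (S : List (X × Bool)) (i : ℕ) : ℤ := ((S[i]?).map fun p => sgn p.2).getD 0

/-- The sign of a concept at the point `i`. -/
def valueAt (S : List (X × Bool)) (c : X → Bool) (i : ℕ) : ℤ :=
  ((S[i]?).map fun p => sgn (c p.1)).getD 0

/-- Whether the concepts of a sequence are correct at the points of the sample. -/
def correctness (S : List (X × Bool)) (c : ℕ → X → Bool) (j i : ℕ) : ℤ :=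
  labelAt S i * valueAt S (c j) i

/-- The dataset that takes the point `i` with multiplicity `w i`, for `i < m`. -/
def weightedSample (S : List (X × Bool)) (w : ℕ → ℤ) (m : ℕ) : List (X × Bool) :=
  (List.range m).flatMap fun i => ((S[i]?).map fun p => List.replicate (w i).toNat p).getD []

lemma weightedSample_succ (S : List (X × Bool)) (w : ℕ → ℤ) {i : ℕ} {p : X × Bool}
    (hp : S[i]? = some p) :
    weightedSample S w (i + 1) = weightedSample S w i ++ List.replicate (w i).toNat p := by
  simp [weightedSample, List.range_succ, hp]

lemma natAbs_le_of_abs_le {x : ℤ} {V : ℕ} (h : |x| ≤ V) : x.natAbs ≤ V := by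
  rw [← Int.natCast_natAbs] at h
  exact_mod_cast h

/-- The counterpart of `runs_loop` for an invariant instead of an explicit sequence of states. It
serves loops whose scratch variables end with values that need no name. -/
lemma runs_loop_inv {O : List (X × Bool) → X → Bool} {S : List (X × Bool)} {e : Expr} {p : Cmd}
    {N T c : ℕ} (I : ℕ → State X → Prop) {s : State X} (h0 : I 0 s)
    (hstep : ∀ i < N, ∀ s, I i s → 0 < e.eval S s ∧ 1 + e.cost S s ≤ c ∧
      ∃ s', I (i + 1) s' ∧ Runs O S p s T s')
    (hend : ∀ s, I N s → e.eval S s ≤ 0 ∧ 1 + e.cost S s ≤ c) :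
    ∃ s', I N s' ∧ Runs O S (.loop e p) s (N * (c + T) + c) s' := by
  induction N generalizing I s with
  | zero =>
    obtain ⟨h1, h2⟩ := hend s h0
    exact ⟨s, h0, _, by simpa using h2, Exec.loop_done e p s h1⟩
  | succ N ih =>
    obtain ⟨hpos, hc, s₁, hI, t₁, ht₁, he₁⟩ := hstep 0 (by omega) s h0
    obtain ⟨s₂, hI₂, t₂, ht₂, he₂⟩ := ih (fun i => I (i + 1)) hI
      (fun i hi => hstep (i + 1) (by omega)) hend
    refine ⟨s₂, hI₂, _, ?_, Exec.loop_step e p _ _ _ _ _ hpos he₁ he₂⟩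
    rw [add_mul, one_mul]
    omega

/-- All numbers that occur in a run of at most `T` rounds are at most `V`. -/
structure RunBounds (n k T V : ℕ) (z : ℕ → ℕ → ℤ) : Prop where
  four_le : 4 ≤ V
  sample : n ≤ V
  accuracy : k ≤ V
  rounds : T + 1 ≤ V
  correct : ∀ j i, |z j i| ≤ 1
  triang : ∀ t ≤ T, |triang t| ≤ V
  wt : ∀ t ≤ T, ∀ i, |wt z t i| ≤ V
  gap : ∀ t ≤ T, ∀ m ≤ n, |gap z m t| ≤ V
  test : ∀ t ≤ T, |4 * k * MaliciousLearning.gap z n t - n * (MaliciousLearning.triang t *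
    (MaliciousLearning.triang t * MaliciousLearning.triang t))| ≤ V

variable {O : List (X × Bool) → X → Bool} {S : List (X × Bool)} {c : ℕ → X → Bool}
  {k T V : ℕ} {q : List (X × Bool)} {cs out : List (X → Bool)} {t i : ℕ}
  {j x w F G D : ℤ}

lemma triang_mono {a b : ℕ} (h : a ≤ b) : triang a ≤ triang b :=
  Finset.sum_le_sum_of_subset_of_nonneg (Finset.range_subset_range.2 h) fun _ _ _ => by positivity

lemma score_succ (z : ℕ → ℕ → ℤ) (t i : ℕ) :
    score z (t + 1) i = score z t i + (t + 1) * z t i := Finset.sum_range_succ _ _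

lemma runs_score (hB : RunBounds S.length k T V (correctness S c)) (ht : t ≤ T)
    (hcs : ∀ j < t, cs[j]? = some (c j))
    (hb : Bdd V [S.length, k, t, i, j, x, triang t, w, F, G]) :
    Bdd V [S.length, k, t, i, t, score (correctness S c) t i, triang t,
      wt (correctness S c) t i, F, G] ∧
    Runs O S scoreCmd (memory [S.length, k, t, i, j, x, triang t, w, F, G] q cs out)
      (7 * (V * V ^ 80))
      (memory [S.length, k, t, i, t, score (correctness S c) t i, triang t,
        wt (correctness S c) t i, F, G] q cs out) := by
  have hV := hB.four_le
  have hscore : ∀ j ≤ t, (score (correctness S c) j i).natAbs ≤ V := fun j hj =>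
    natAbs_le_of_abs_le ((abs_score_le hB.correct j i).trans ((triang_mono hj).trans
      ((le_abs_self _).trans (hB.triang t ht))))
  have h1 : Bdd V [S.length, k, t, i, j, 0, triang t, w, F, G] := hb.set (x := 0) (by simp) 5
  have hbj : ∀ j ≤ t, Bdd V [S.length, k, t, i, j, score (correctness S c) j i, triang t, w, F, G] :=
    fun j hj => (h1.set (x := (j : ℤ)) (by have := hB.rounds; omega) 4).set (hscore j hj) 5
  have hbj' : ∀ j, j < t → Bdd V [S.length, k, t, i, j, score (correctness S c) (j + 1) i,
    triang t, w, F, G] := fun j hj => (hbj j hj.le).set (hscore (j + 1) hj) 5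
  -- The exponent 80 exceeds `costDeg` of every expression in the program, as `decide` checks at
  -- each use. So V^80 bounds the cost of any single evaluation.
  have hloop := runs_loop (O := O) (S := S) (N := t) (c := V ^ 80) (T := 2 * V ^ 80)
    (e := .sub (.var 2) (.var 4))
    (p := .seq (.assign 5 (.add (.var 5) (.mul (.add (.var 4) (.lit 1))
      (.mul (.label (.var 3)) (.value (.var 4) (.var 3)))))) (.assign 4 (.add (.var 4) (.lit 1))))
    (fun j => memory [S.length, k, t, i, j, score (correctness S c) j i, triang t, w, F, G] q cs out)
    (fun j hj => by simp [Expr.eval, memory]; omega) (by simp [Expr.eval, memory])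
    (fun j hj => one_add_cost_le hV (hbj j hj) _ (by decide))
    (fun j hj => by
      refine ((runs_assign hV (hbj j hj.le) (p := 80) (by decide) (by simp)
        (x := score (correctness S c) (j + 1) i) ?_).seq
        (runs_assign hV (hbj' j hj) (p := 80) (by decide) (by simp) (x := (j + 1 : ℕ)) ?_)).mono
        (by omega)
      · rw [score_succ]
        simp [Expr.eval, memory, entry_natCast, hcs j hj, correctness, labelAt, valueAt]
      · simp [Expr.eval, memory])
  have hwt : (wt (correctness S c) t i).natAbs ≤ V := natAbs_le_of_abs_le (hB.wt t ht i)
  refine ⟨(hbj t le_rfl).set hwt 7, ?_⟩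
  refine ((runs_assign hV hb (p := 80) (by decide) (by simp) (x := 0) rfl).seq
    ((runs_assign hV h1 (p := 80) (by decide) (by simp) (x := 0) rfl).seq
    (hloop.seq (runs_assign hV (hbj t le_rfl) (p := 80) (by decide) (by simp)
      (x := wt (correctness S c) t i) rfl)))).mono ?_
  · have h3 : t * (V ^ 80 + 2 * V ^ 80) ≤ V * (3 * V ^ 80) := by
      rw [show V ^ 80 + 2 * V ^ 80 = 3 * V ^ 80 by ring]
      exact Nat.mul_le_mul_right _ (by have := hB.rounds; omega)
    have h4 : 4 * V ^ 80 ≤ V * V ^ 80 := Nat.mul_le_mul_right _ hV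
    have h5 : V * (3 * V ^ 80) = 3 * (V * V ^ 80) := by ring
    omega

end Correctness

section Correctness
variable {X : Type*} {O : List (X × Bool) → X → Bool} {S : List (X × Bool)} {c : ℕ → X → Bool}
  {k T V : ℕ} {q : List (X × Bool)} {cs out : List (X → Bool)} {t i : ℕ}
  {a j x w F G : ℤ}

/-- Variable 7 counts the weight of the point down to 0, one pushed copy at a time, so the number of
passes is the weight and not its bit length. -/
lemma runs_push_step (hB : RunBounds S.length k T V (correctness S c)) (ht : t ≤ T)
    (hcs : ∀ j < t, cs[j]? = some (c j)) {p : X × Bool} (hp : S[i]? = some p)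
    (hb : Bdd V [S.length, k, t, i, j, x, triang t, w, F, G]) :
    Bdd V [S.length, k, t, (i + 1 : ℕ), t, score (correctness S c) t i, triang t, 0, F, G] ∧
    Runs O S pushCmd (memory [S.length, k, t, i, j, x, triang t, w, F, G] q cs out)
      (13 * (V * V ^ 80))
      (memory [S.length, k, t, (i + 1 : ℕ), t, score (correctness S c) t i, triang t, 0, F, G]
        (q ++ List.replicate (wt (correctness S c) t i).toNat p) cs out) := by
  have hV := hB.four_le
  obtain ⟨hb1, hrun⟩ := runs_score (O := O) (q := q) (out := out) hB ht hcs hb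
  have hi : i < S.length := (List.getElem?_eq_some_iff.1 hp).1
  have hw := wt_nonneg (correctness S c) t i
  have hwV := natAbs_le_of_abs_le (hB.wt t ht i)
  generalize hwdef : wt (correctness S c) t i = wi at *
  have hbu : ∀ u : ℕ, u ≤ wi.toNat → Bdd V [S.length, k, t, i, t, score (correctness S c) t i,
      triang t, wi - u, F, G] := fun u hu => hb1.set (x := wi - u) (by omega) 7
  have hloop := runs_loop (O := O) (S := S) (N := wi.toNat) (c := V ^ 80) (T := 3 * V ^ 80)
    (e := .var 7)
    (p := .seq (.push (.var 3) (.label (.var 3))) (.assign 7 (.sub (.var 7) (.lit 1))))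
    (fun u => memory [S.length, k, t, i, t, score (correctness S c) t i, triang t, wi - u, F, G]
      (q ++ List.replicate u p) cs out)
    (fun u hu => by simp [Expr.eval, memory]; omega)
    (by simp [Expr.eval, memory])
    (fun u hu => one_add_cost_le hV (hbu u hu) _ (by decide))
    (fun u hu => by
      have h := (runs_push (O := O) (S := S) (q := q ++ List.replicate u p) (cs := cs) (out := out)
        hV (hbu u hu.le) (p := 80) (i := .var 3) (b := .label (.var 3)) (by decide) (by decide)
        (x := p) (by simp [Expr.eval, memory, entry_natCast, hp]) (by
          simp only [Expr.eval, memory, List.getD_cons_succ, List.getD_cons_zero, entry_natCast, hp]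
          cases h2 : p.2 <;> simp [sgn, h2])).seq
        (runs_assign hV (hbu u hu.le) (p := 80) (v := 7) (e := .sub (.var 7) (.lit 1)) (by decide)
          (by simp) (x := wi - (u + 1 : ℕ)) (by simp [Expr.eval, memory]; ring))
      rw [List.append_assoc, ← List.replicate_succ'] at h
      exact h.mono (by omega))
  have hwi : wi - (wi.toNat : ℤ) = 0 := by omega
  have hb2 := hbu wi.toNat le_rfl
  simp only [hwi] at hloop hb2
  have hb3 : Bdd V [S.length, k, t, (i + 1 : ℕ), t, score (correctness S c) t i, triang t, 0, F, G] :=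
    hb2.set (x := ((i + 1 : ℕ) : ℤ)) (by have := hB.sample; omega) 3
  refine ⟨hb3, ?_⟩
  have h0 : memory [S.length, k, t, i, t, score (correctness S c) t i, triang t, wi, F, G] q cs out =
      memory [S.length, k, t, i, t, score (correctness S c) t i, triang t, wi - (0 : ℕ), F, G]
        (q ++ List.replicate 0 p) cs out := by simp
  rw [h0] at hrun
  refine (hrun.seq (hloop.seq (runs_assign hV hb2 (p := 80) (by decide) (by simp)
    (x := ((i + 1 : ℕ) : ℤ)) (by simp [Expr.eval, memory])))).mono ?_
  have h3 : wi.toNat * (V ^ 80 + 3 * V ^ 80) ≤ V * (4 * V ^ 80) := by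
    rw [show V ^ 80 + 3 * V ^ 80 = 4 * V ^ 80 by ring]
    exact Nat.mul_le_mul_right _ (by omega)
  have h4 : 4 * V ^ 80 ≤ V * V ^ 80 := Nat.mul_le_mul_right _ hV
  have h5 : V * (4 * V ^ 80) = 4 * (V * V ^ 80) := by ring
  omega

lemma runs_query (hB : RunBounds S.length k T V (correctness S c)) (ht : t ≤ T)
    (hcs : ∀ j < t, cs[j]? = some (c j))
    (hb : Bdd V [S.length, k, t, a, j, x, triang t, w, F, G]) :
    ∃ a' j' x' w' : ℤ, Bdd V [S.length, k, t, a', j', x', triang t, w', F, G] ∧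
    Runs O S queryCmd (memory [S.length, k, t, a, j, x, triang t, w, F, G] [] cs out)
      (16 * (V * (V * V ^ 80)))
      (memory [S.length, k, t, a', j', x', triang t, w', F, G]
        (weightedSample S (wt (correctness S c) t) S.length) cs out) := by
  have hV := hB.four_le
  have hb0 : Bdd V [S.length, k, t, (0 : ℕ), j, x, triang t, w, F, G] :=
    hb.set (x := ((0 : ℕ) : ℤ)) (by simp) 3
  obtain ⟨s', ⟨j', x', w', hb', rfl⟩, hrun⟩ := runs_loop_inv (O := O) (S := S) (N := S.length)
    (c := V ^ 80) (T := 13 * (V * V ^ 80)) (e := .sub (.var 0) (.var 3)) (p := pushCmd)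
    (fun i s => ∃ j x w : ℤ, Bdd V [S.length, k, t, i, j, x, triang t, w, F, G] ∧
      s = memory [S.length, k, t, i, j, x, triang t, w, F, G]
        (weightedSample S (wt (correctness S c) t) i) cs out)
    (s := memory [S.length, k, t, (0 : ℕ), j, x, triang t, w, F, G] [] cs out)
    ⟨j, x, w, hb0, rfl⟩
    (by
      rintro i hi s ⟨j, x, w, hb, rfl⟩
      refine ⟨by simp [Expr.eval, memory]; omega, one_add_cost_le hV hb _ (by decide), ?_⟩
      obtain ⟨hb', hrun⟩ := runs_push_step (O := O) (out := out)
        (q := weightedSample S (wt (correctness S c) t) i) hB ht hcs (p := S[i]) (by simp [hi]) hb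
      exact ⟨_, ⟨_, _, _, hb', by rw [weightedSample_succ _ _ (p := S[i]) (by simp [hi])]⟩, hrun⟩)
    (by
      rintro s ⟨j, x, w, hb, rfl⟩
      exact ⟨by simp [Expr.eval, memory], one_add_cost_le hV hb _ (by decide)⟩)
  refine ⟨_, j', x', w', hb', ((runs_assign hV hb (p := 80) (by decide) (by simp)
    (x := ((0 : ℕ) : ℤ)) rfl).seq hrun).mono ?_⟩
  have h3 : S.length * (V ^ 80 + 13 * (V * V ^ 80)) ≤ V * (V ^ 80 + 13 * (V * V ^ 80)) :=
    Nat.mul_le_mul_right _ hB.sample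
  have h4 : 4 * V ^ 80 ≤ V * V ^ 80 := Nat.mul_le_mul_right _ hV
  have h5 : V * (V ^ 80 + 13 * (V * V ^ 80)) = V * V ^ 80 + 13 * (V * (V * V ^ 80)) := by ring
  have h6 : 4 * (V * V ^ 80) ≤ V * (V * V ^ 80) := Nat.mul_le_mul_right _ hV
  omega

lemma runs_gap (hB : RunBounds S.length k T V (correctness S c)) (ht : t ≤ T)
    (hcs : ∀ j < t + 1, cs[j]? = some (c j))
    (hb : Bdd V [S.length, k, t, a, j, x, triang t, w, F, G]) :
    ∃ a' j' x' w' : ℤ, Bdd V [S.length, k, t, a', j', x', triang t, w', F,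
      gap (correctness S c) S.length t] ∧
    Runs O S gapCmd (memory [S.length, k, t, a, j, x, triang t, w, F, G] q cs out)
      (13 * (V * (V * V ^ 80)))
      (memory [S.length, k, t, a', j', x', triang t, w', F,
        gap (correctness S c) S.length t] q cs out) := by
  have hV := hB.four_le
  have hb0 : Bdd V [S.length, k, t, (0 : ℕ), j, x, triang t, w, F, G] :=
    hb.set (x := ((0 : ℕ) : ℤ)) (by simp) 3
  have hb1 : Bdd V [S.length, k, t, (0 : ℕ), j, x, triang t, w, F, 0] :=
    hb0.set (x := 0) (by simp) 9
  obtain ⟨s', ⟨j', x', w', hb', rfl⟩, hrun⟩ := runs_loop_inv (O := O) (S := S) (N := S.length)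
    (c := V ^ 80) (T := 9 * (V * V ^ 80)) (e := .sub (.var 0) (.var 3)) (p := gapStepCmd)
    (fun i s => ∃ j x w : ℤ, Bdd V [S.length, k, t, i, j, x, triang t, w, F,
        gap (correctness S c) i t] ∧
      s = memory [S.length, k, t, i, j, x, triang t, w, F, gap (correctness S c) i t] q cs out)
    (s := memory [S.length, k, t, (0 : ℕ), j, x, triang t, w, F, 0] q cs out)
    ⟨j, x, w, hb1, rfl⟩
    (by
      rintro i hi s ⟨j, x, w, hb, rfl⟩
      refine ⟨by simp [Expr.eval, memory]; omega, one_add_cost_le hV hb _ (by decide), ?_⟩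
      obtain ⟨hb', hrun⟩ := runs_score (O := O) (out := out) (q := q) hB ht
        (fun j hj => hcs j (by omega)) hb
      have hb2 := hb'.set (x := gap (correctness S c) (i + 1) t)
        (natAbs_le_of_abs_le (hB.gap t ht (i + 1) hi)) 9
      have hb3 := hb2.set (x := ((i + 1 : ℕ) : ℤ)) (by have := hB.sample; omega) 3
      refine ⟨_, ⟨_, _, _, hb3, rfl⟩, (hrun.seq ((runs_assign hV hb' (p := 80) (by decide) (by simp)
        (x := gap (correctness S c) (i + 1) t) ?_).seq (runs_assign hV hb2 (p := 80) (by decide)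
        (by simp) (x := ((i + 1 : ℕ) : ℤ)) (by simp [Expr.eval, memory])))).mono ?_⟩
      · have hgap : gap (correctness S c) (i + 1) t = gap (correctness S c) i t +
            wt (correctness S c) t i * (triang t * correctness S c t i -
              score (correctness S c) t i) := Finset.sum_range_succ _ _
        rw [hgap]
        simp [Expr.eval, memory, entry_natCast, hcs t (by omega), correctness, labelAt, valueAt]
      · have h4 : 4 * V ^ 80 ≤ V * V ^ 80 := Nat.mul_le_mul_right _ hV
        omega)
    (by
      rintro s ⟨j, x, w, hb, rfl⟩
      exact ⟨by simp [Expr.eval, memory], one_add_cost_le hV hb _ (by decide)⟩)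
  refine ⟨_, j', x', w', hb', ((runs_assign hV hb (p := 80) (by decide) (by simp)
    (x := ((0 : ℕ) : ℤ)) rfl).seq ((runs_assign hV hb0 (p := 80) (by decide) (by simp)
    (x := 0) rfl).seq hrun)).mono ?_⟩
  have h3 : S.length * (V ^ 80 + 9 * (V * V ^ 80)) ≤ V * (V ^ 80 + 9 * (V * V ^ 80)) :=
    Nat.mul_le_mul_right _ hB.sample
  have h4 : 4 * V ^ 80 ≤ V * V ^ 80 := Nat.mul_le_mul_right _ hV
  have h5 : V * (V ^ 80 + 9 * (V * V ^ 80)) = V * V ^ 80 + 9 * (V * (V * V ^ 80)) := by ring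
  have h6 : 4 * (V * V ^ 80) ≤ V * (V * V ^ 80) := Nat.mul_le_mul_right _ hV
  omega

/-- The number whose sign tells whether the gap is still large after `t` concepts. -/
def gapTest (S : List (X × Bool)) (c : ℕ → X → Bool) (k t : ℕ) : ℤ :=
  4 * k * gap (correctness S c) S.length t - S.length * (triang t * (triang t * triang t))

/-- The sequence of concepts is produced by the Frank–Wolfe method. -/
def IsFrankWolfe (O : List (X × Bool) → X → Bool) (S : List (X × Bool)) (c : ℕ → X → Bool) : Prop :=
  ∀ t, c t = O (weightedSample S (wt (correctness S c) t) S.length)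

lemma runs_round (hB : RunBounds S.length k T V (correctness S c)) (hc : IsFrankWolfe O S c)
    (ht : t + 1 ≤ T) (hb : Bdd V [S.length, k, (t + 1 : ℕ), a, j, x, triang t, w, F, G]) :
    ∃ a' j' x' w' G' : ℤ, Bdd V [S.length, k, (t + 2 : ℕ), a', j', x', triang (t + 1), w',
      gapTest S c k (t + 1), G'] ∧
    Runs O S roundCmd (memory [S.length, k, (t + 1 : ℕ), a, j, x, triang t, w, F, G] []
        ((List.range (t + 1)).map c) out)
      (33 * (V * (V * V ^ 80)))
      (memory [S.length, k, (t + 2 : ℕ), a', j', x', triang (t + 1), w',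
        gapTest S c k (t + 1), G'] [] ((List.range (t + 2)).map c) out) := by
  have hV := hB.four_le
  have hb0 : Bdd V [S.length, k, (t + 1 : ℕ), a, j, x, triang (t + 1), w, F, G] :=
    hb.set (x := triang (t + 1)) (natAbs_le_of_abs_le (hB.triang _ ht)) 6
  obtain ⟨a₁, j₁, x₁, w₁, hb₁, hrun₁⟩ := runs_query (O := O) (out := out)
    (cs := (List.range (t + 1)).map c) hB ht (fun j hj => by simp [hj]) hb0
  obtain ⟨a₂, j₂, x₂, w₂, hb₂, hrun₂⟩ := runs_gap (O := O) (out := out) (q := [])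
    (cs := (List.range (t + 2)).map c) hB ht (fun j hj => by simp [hj]) hb₁
  have hb₃ : Bdd V [S.length, k, (t + 1 : ℕ), a₂, j₂, x₂, triang (t + 1), w₂,
      gapTest S c k (t + 1), gap (correctness S c) S.length (t + 1)] :=
    hb₂.set (x := gapTest S c k (t + 1)) (natAbs_le_of_abs_le (hB.test _ ht)) 8
  have hb₄ : Bdd V [S.length, k, (t + 2 : ℕ), a₂, j₂, x₂, triang (t + 1), w₂,
      gapTest S c k (t + 1), gap (correctness S c) S.length (t + 1)] :=
    hb₃.set (x := ((t + 2 : ℕ) : ℤ)) (by have := hB.rounds; omega) 2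
  have hcall := runs_call (O := O) (S := S) (out := out) (cs := (List.range (t + 1)).map c)
    (l := [S.length, k, (t + 1 : ℕ), a₁, j₁, x₁, triang (t + 1), w₁, F, G])
    (q := weightedSample S (wt (correctness S c) (t + 1)) S.length)
  have hcs : (List.range (t + 1)).map c ++
      [O (weightedSample S (wt (correctness S c) (t + 1)) S.length)] =
      (List.range (t + 2)).map c := by
    rw [← hc (t + 1), List.range_succ (n := t + 1), List.map_append, List.map_singleton]
  rw [hcs] at hcall
  refine ⟨_, _, _, _, _, hb₄, ((runs_assign hV hb (p := 80) (by decide) (by simp)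
    (x := triang (t + 1)) (by simp [Expr.eval, memory, triang_succ])).seq (hrun₁.seq (hcall.seq
    (hrun₂.seq ((runs_assign hV hb₂ (p := 80) (by decide) (by simp) (x := gapTest S c k (t + 1))
    (by simp [Expr.eval, memory, gapTest])).seq (runs_assign hV hb₃ (p := 80) (by decide) (by simp)
    (x := ((t + 2 : ℕ) : ℤ)) (by simp [Expr.eval, memory]; ring))))))).mono ?_⟩
  have h4 : 4 * V ^ 80 ≤ V * V ^ 80 := Nat.mul_le_mul_right _ hV
  have h6 : 4 * (V * V ^ 80) ≤ V * (V * V ^ 80) := Nat.mul_le_mul_right _ hV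
  have h7 : 1 ≤ V ^ 80 := Nat.one_le_pow _ _ (by omega)
  omega

/-- The output of the first `t` concepts, concept number `j` being repeated `j + 1` times. -/
def repeated (c : ℕ → X → Bool) (t : ℕ) : List (X → Bool) :=
  (List.range t).flatMap fun j => List.replicate (j + 1) (c j)

lemma repeated_succ (c : ℕ → X → Bool) (t : ℕ) :
    repeated c (t + 1) = repeated c t ++ List.replicate (t + 1) (c t) := by
  simp [repeated, List.range_succ]

lemma runs_output (hB : RunBounds S.length k T V (correctness S c)) (ht : t ≤ T)
    (hcs : ∀ j < t, cs[j]? = some (c j)) {D : ℤ}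
    (hb : Bdd V [S.length, k, (t + 1 : ℕ), a, j, x, D, w, F, G]) :
    ∃ l, Runs O S outputCmd (memory [S.length, k, (t + 1 : ℕ), a, j, x, D, w, F, G] q cs [])
      (9 * (V * (V * V ^ 80))) (memory l q cs (repeated c t)) := by
  have hV := hB.four_le
  have hTV := hB.rounds
  have hb0 : Bdd V [S.length, k, (t + 1 : ℕ), a, (0 : ℕ), x, D, w, F, G] :=
    hb.set (x := ((0 : ℕ) : ℤ)) (by simp) 4
  obtain ⟨s', ⟨a', hb', rfl⟩, hrun⟩ := runs_loop_inv (O := O) (S := S) (N := t)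
    (c := V ^ 80) (T := 6 * (V * V ^ 80)) (e := .sub (.sub (.var 2) (.lit 1)) (.var 4))
    (p := .seq (.assign 3 (.lit 0)) <|
      .seq (.loop (.sub (.add (.var 4) (.lit 1)) (.var 3)) <|
        .seq (.emit (.var 4)) <| .assign 3 (.add (.var 3) (.lit 1))) <|
      .assign 4 (.add (.var 4) (.lit 1)))
    (fun j s => ∃ a : ℤ, Bdd V [S.length, k, (t + 1 : ℕ), a, j, x, D, w, F, G] ∧
      s = memory [S.length, k, (t + 1 : ℕ), a, j, x, D, w, F, G] q cs (repeated c j))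
    (s := memory [S.length, k, (t + 1 : ℕ), a, (0 : ℕ), x, D, w, F, G] q cs [])
    ⟨a, hb0, rfl⟩
    (by
      rintro j hj s ⟨a, hb, rfl⟩
      refine ⟨by simp [Expr.eval, memory]; omega, one_add_cost_le hV hb _ (by decide), ?_⟩
      have hbu : ∀ u : ℕ, u ≤ j + 1 → Bdd V [S.length, k, (t + 1 : ℕ), u, j, x, D, w, F, G] :=
        fun u hu => hb.set (x := (u : ℤ)) (by omega) 3
      have hloop := runs_loop (O := O) (S := S) (N := j + 1) (c := V ^ 80) (T := 2 * V ^ 80)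
        (e := .sub (.add (.var 4) (.lit 1)) (.var 3))
        (p := .seq (.emit (.var 4)) <| .assign 3 (.add (.var 3) (.lit 1)))
        (fun u => memory [S.length, k, (t + 1 : ℕ), u, j, x, D, w, F, G] q cs
          (repeated c j ++ List.replicate u (c j)))
        (fun u hu => by simp [Expr.eval, memory]; omega)
        (by simp [Expr.eval, memory])
        (fun u hu => one_add_cost_le hV (hbu u hu) _ (by decide))
        (fun u hu => by
          have h := (runs_emit (O := O) (S := S) (q := q) (cs := cs)
            (out := repeated c j ++ List.replicate u (c j)) hV (hbu u hu.le) (p := 80)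
            (j := .var 4) (by decide) (c := c j)
            (by simp [Expr.eval, memory, entry_natCast, hcs j hj])).seq
            (runs_assign hV (hbu u hu.le) (p := 80) (v := 3) (e := .add (.var 3) (.lit 1))
              (by decide) (by simp) (x := ((u + 1 : ℕ) : ℤ)) (by simp [Expr.eval, memory]))
          rw [List.append_assoc, ← List.replicate_succ'] at h
          exact h.mono (by omega))
      rw [← repeated_succ] at hloop
      simp only [List.replicate_zero, List.append_nil] at hloop
      have hb1 := hbu (j + 1) le_rfl
      refine ⟨_, ⟨_, hb1.set (x := ((j + 1 : ℕ) : ℤ)) (by omega) 4, rfl⟩,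
        ((runs_assign hV hb (p := 80) (by decide) (by simp) (x := ((0 : ℕ) : ℤ)) rfl).seq
          (hloop.seq (runs_assign hV hb1 (p := 80) (by decide) (by simp)
          (x := ((j + 1 : ℕ) : ℤ)) (by simp [Expr.eval, memory])))).mono ?_⟩
      · have h3 : (j + 1) * (V ^ 80 + 2 * V ^ 80) ≤ V * (3 * V ^ 80) := by
          rw [show V ^ 80 + 2 * V ^ 80 = 3 * V ^ 80 by ring]
          exact Nat.mul_le_mul_right _ (by omega)
        have h4 : 4 * V ^ 80 ≤ V * V ^ 80 := Nat.mul_le_mul_right _ hV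
        have h5 : V * (3 * V ^ 80) = 3 * (V * V ^ 80) := by ring
        omega)
    (by
      rintro s ⟨a, hb, rfl⟩
      exact ⟨by simp [Expr.eval, memory], one_add_cost_le hV hb _ (by decide)⟩)
  refine ⟨_, ((runs_assign hV hb (p := 80) (by decide) (by simp)
    (x := ((0 : ℕ) : ℤ)) rfl).seq hrun).mono ?_⟩
  have h3 : t * (V ^ 80 + 6 * (V * V ^ 80)) ≤ V * (V ^ 80 + 6 * (V * V ^ 80)) :=
    Nat.mul_le_mul_right _ (by omega)
  have h4 : 4 * V ^ 80 ≤ V * V ^ 80 := Nat.mul_le_mul_right _ hV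
  have h5 : V * (V ^ 80 + 6 * (V * V ^ 80)) = V * V ^ 80 + 6 * (V * (V * V ^ 80)) := by ring
  have h6 : 4 * (V * V ^ 80) ≤ V * (V * V ^ 80) := Nat.mul_le_mul_right _ hV
  omega

/-- The run of the program, up to the first time that the gap is small. -/
theorem runs_learner (hB : RunBounds S.length k T V (correctness S c)) (hc : IsFrankWolfe O S c)
    (ht : t + 1 ≤ T) (hbig : ∀ u, 1 ≤ u → u ≤ t → 0 < gapTest S c k u)
    (hsmall : gapTest S c k (t + 1) ≤ 0) :
    ∃ l, Runs O S learnerCmd (start X S.length k) (50 * V ^ 83)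
      (memory l [] ((List.range (t + 2)).map c) (repeated c (t + 1))) := by
  have hV := hB.four_le
  have hTV := hB.rounds
  have hstart : start X S.length k = memory [S.length, k, 0, 0, 0, 0, 0, 0, 0, 0] [] [] [] := by
    simp only [start, memory, State.mk.injEq, and_true]
    funext v
    match v with
    | 0 | 1 | 2 | 3 | 4 | 5 | 6 | 7 | 8 | 9 => rfl
    | _ + 10 => simp
  have hb0 : Bdd V [S.length, k, 0, 0, 0, 0, 0, 0, 0, 0] := by
    have h1 := hB.sample
    have h2 := hB.accuracy
    simp [Bdd, h1, h2]
  have hb1 : Bdd V [S.length, k, 1, 0, 0, 0, 0, 0, 0, 0] := hb0.set (x := 1) (by simp; omega) 2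
  have hb2 : Bdd V [S.length, k, 1, 0, 0, 0, 0, 0, 1, 0] := hb1.set (x := 1) (by simp; omega) 8
  have hcall := runs_call (O := O) (S := S) (out := []) (cs := [])
    (l := [(S.length : ℤ), k, 0, 0, 0, 0, 0, 0, 0, 0]) (q := [])
  -- All weights vanish at time 0, because `triang 0 = 0`. Hence the call on the empty dataset is
  -- round 0 of the Frank–Wolfe sequence.
  have hc0 : [] ++ [O []] = (List.range 1).map c := by
    have hempty : weightedSample S (wt (correctness S c) 0) S.length = [] := by
      rw [weightedSample, List.flatMap_eq_nil_iff]
      intro i _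
      have hw : wt (correctness S c) 0 i = 0 := by simp [wt, triang, score]
      cases S[i]? <;> simp [hw]
    rw [show List.range 1 = [0] from rfl, List.map_singleton, hc 0, hempty]
    rfl
  rw [hc0, ← hstart] at hcall
  -- After u passes u + 1 concepts are known, but `triang` and, once u ≥ 1, the stopping test refer
  -- to the first u of them. The initial value 1 of variable 8 forces the first pass.
  obtain ⟨s', ⟨a, j, x, w, F, G, hF, hF0, hb', rfl⟩, hrun⟩ := runs_loop_inv (O := O) (S := S)
    (N := t + 1) (c := V ^ 80) (T := 33 * (V * (V * V ^ 80))) (e := .var 8) (p := roundCmd)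
    (fun u s => ∃ a j x w F G : ℤ, (u ≤ t → 0 < F) ∧ (u = t + 1 → F ≤ 0) ∧
      Bdd V [S.length, k, (u + 1 : ℕ), a, j, x, triang u, w, F, G] ∧
      s = memory [S.length, k, (u + 1 : ℕ), a, j, x, triang u, w, F, G] []
        ((List.range (u + 1)).map c) [])
    (s := memory [S.length, k, 1, 0, 0, 0, 0, 0, 1, 0] [] ((List.range 1).map c) [])
    ⟨0, 0, 0, 0, 1, 0, fun _ => one_pos, fun h => by omega, hb2, rfl⟩
    (by
      rintro u hu s ⟨a, j, x, w, F, G, hF, -, hb, rfl⟩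
      refine ⟨hF (by omega), one_add_cost_le hV hb _ (by decide), ?_⟩
      obtain ⟨a', j', x', w', G', hb', hrun⟩ := runs_round (out := []) hB hc (by omega) hb
      exact ⟨_, ⟨a', j', x', w', _, G', fun h => hbig (u + 1) (by omega) h,
        fun h => by rw [h]; exact hsmall, hb', rfl⟩, hrun⟩)
    (by
      rintro s ⟨a, j, x, w, F, G, -, hF, hb, rfl⟩
      exact ⟨hF rfl, one_add_cost_le hV hb _ (by decide)⟩)
  -- The last concept only served to evaluate the gap. The margins at which the gap is small are
  -- those of the concepts before it, so it is not output.
  obtain ⟨l, hout⟩ := runs_output (O := O) (q := []) (cs := (List.range (t + 2)).map c) hB ht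
    (fun j hj => by rw [List.getElem?_map, List.getElem?_range (by omega)]; rfl) hb'
  refine ⟨l, (hcall.seq ((runs_assign hV hb0 (p := 80) (by decide) (by simp) (x := 1) rfl).seq
    ((runs_assign hV hb1 (p := 80) (by decide) (by simp) (x := 1) rfl).seq
    (hrun.seq hout)))).mono ?_⟩
  have h3 : (t + 1) * (V ^ 80 + 33 * (V * (V * V ^ 80))) ≤
      V * (V ^ 80 + 33 * (V * (V * V ^ 80))) := Nat.mul_le_mul_right _ (by omega)
  have h4 : 4 * V ^ 80 ≤ V * V ^ 80 := Nat.mul_le_mul_right _ hV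
  have h5 : V * (V ^ 80 + 33 * (V * (V * V ^ 80))) =
    V * V ^ 80 + 33 * (V * (V * (V * V ^ 80))) := by ring
  have h6 : 4 * (V * V ^ 80) ≤ V * (V * V ^ 80) := Nat.mul_le_mul_right _ hV
  have h7 : 4 * (V * (V * V ^ 80)) ≤ V * (V * (V * V ^ 80)) := Nat.mul_le_mul_right _ hV
  have h8 : 1 ≤ V ^ 80 := Nat.one_le_pow _ _ (by omega)
  have h9 : V ^ 83 = V * (V * (V * V ^ 80)) := by ring
  rw [h9]
  omega

end Correctness

/-! ### The learner -/

section Learner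
variable {X : Type*} {O : List (X × Bool) → X → Bool} {S : List (X × Bool)}

/-- Weights at time t depend only on earlier concepts, so the default value `O []` in
`frankWolfeList` never matters. -/
lemma wt_congr {z z' : ℕ → ℕ → ℤ} {t i : ℕ} (h : ∀ j < t, z j i = z' j i) :
    wt z t i = wt z' t i := by
  have hs : score z t i = score z' t i :=
    Finset.sum_congr rfl fun j hj => by rw [h j (Finset.mem_range.1 hj)]
  rw [wt, wt, hs]

/-- The first `t` concepts of the Frank–Wolfe method. -/
def frankWolfeList (O : List (X × Bool) → X → Bool) (S : List (X × Bool)) : ℕ → List (X → Bool)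
  | 0 => []
  | t + 1 => frankWolfeList O S t ++ [O (weightedSample S
      (wt (correctness S fun j => (frankWolfeList O S t).getD j (O [])) t) S.length)]

lemma length_frankWolfeList (t : ℕ) : (frankWolfeList O S t).length = t := by
  induction t with
  | zero => rfl
  | succ t ih => simp [frankWolfeList, ih]

lemma getD_frankWolfeList {j t : ℕ} (h : j < t) :
    (frankWolfeList O S t).getD j (O []) = (frankWolfeList O S (j + 1)).getD j (O []) := by
  induction t with
  | zero => omega
  | succ t ih =>
    rcases Nat.lt_succ_iff_lt_or_eq.1 h with h1 | rfl
    · rw [← ih h1, frankWolfeList, List.getD_append _ _ _ _ (by rwa [length_frankWolfeList])]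
    · rfl

lemma exists_isFrankWolfe (O : List (X × Bool) → X → Bool) (S : List (X × Bool)) :
    ∃ c, IsFrankWolfe O S c := by
  refine ⟨fun t => (frankWolfeList O S (t + 1)).getD t (O []), fun t => ?_⟩
  have h1 : (frankWolfeList O S (t + 1)).getD t (O []) = O (weightedSample S
      (wt (correctness S fun j => (frankWolfeList O S t).getD j (O [])) t) S.length) := by
    rw [frankWolfeList, List.getD_append_right _ _ _ _ (length_frankWolfeList t).le,
      length_frankWolfeList, Nat.sub_self]
    rfl
  refine h1.trans ?_
  congr 2
  funext i
  exact wt_congr fun j hj => by simp only [correctness, getD_frankWolfeList hj]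

lemma agreement_append (c : X → Bool) (S S' : List (X × Bool)) :
    agreement c (S ++ S') = agreement c S + agreement c S' := by
  simp [agreement]

lemma agreement_weightedSample (c : X → Bool) {w : ℕ → ℤ} (hw : ∀ i, 0 ≤ w i) (m : ℕ) :
    agreement c (weightedSample S w m) =
      ∑ i ∈ Finset.range m, w i * (labelAt S i * valueAt S c i) := by
  induction m with
  | zero => rfl
  | succ m ih =>
    have h1 : weightedSample S w (m + 1) = weightedSample S w m ++
        ((S[m]?).map fun p => List.replicate (w m).toNat p).getD [] := by
      simp [weightedSample, List.range_succ]
    rw [h1, agreement_append, ih, Finset.sum_range_succ]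
    congr 1
    cases h : S[m]? with
    | none => simp [agreement, labelAt, h]
    | some p =>
      simp only [agreement, labelAt, valueAt, h, Option.map_some, Option.getD_some,
        List.map_replicate, List.sum_replicate, nsmul_eq_mul]
      rw [Int.toNat_of_nonneg (hw m)]
      ring

lemma abs_correctness_le (S : List (X × Bool)) (c : ℕ → X → Bool) (j i : ℕ) :
    |correctness S c j i| ≤ 1 := by
  rw [correctness, labelAt, valueAt]
  cases S[i]? with
  | none => simp
  | some p => cases h1 : p.2 <;> cases h2 : c j p.1 <;> simp [sgn, h1, h2]

lemma IsFrankWolfe.sum_wt_le {C : Set (X → Bool)} (hO : IsERMOracle C O) {c : ℕ → X → Bool}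
    (hc : IsFrankWolfe O S c) {c' : X → Bool} (hc' : c' ∈ C) (t : ℕ) :
    ∑ i ∈ Finset.range S.length, wt (correctness S c) t i * (labelAt S i * valueAt S c' i) ≤
      ∑ i ∈ Finset.range S.length, wt (correctness S c) t i * correctness S c t i := by
  have h := (hO (weightedSample S (wt (correctness S c) t) S.length)).2 c' hc'
  rwa [← hc t, agreement_weightedSample _ (wt_nonneg _ t),
    agreement_weightedSample _ (wt_nonneg _ t)] at h

/-- The largest quantity is the stopping test. Weights are at most 5(T+1)^4 and gaps at most
10n(T+1)^6, which bounds the test by (40kn + n)(T+1)^6 and explains the 41. -/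
lemma runBounds {z : ℕ → ℕ → ℤ} (hz : ∀ j i, |z j i| ≤ 1) (n k T : ℕ) :
    RunBounds n k T (41 * ((n + 1) * (k + 1) * (T + 1) ^ 6)) z := by
  have hT : ∀ p ≤ 6, (T + 1) ^ p ≤ (n + 1) * (k + 1) * (T + 1) ^ 6 := fun p hp =>
    (Nat.pow_le_pow_right (by omega) hp).trans (Nat.le_mul_of_pos_left _ (by positivity))
  have hT' : ∀ p ≤ 6, ((T : ℤ) + 1) ^ p ≤ (n + 1) * (k + 1) * (T + 1) ^ 6 := fun p hp => by
    exact_mod_cast hT p hp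
  have h1 : ∀ a b : ℕ, a ≤ n + 1 → b ≤ k + 1 → a * b * (T + 1) ^ 6 ≤
    (n + 1) * (k + 1) * (T + 1) ^ 6 := fun a b ha hb =>
      Nat.mul_le_mul_right _ (Nat.mul_le_mul ha hb)
  have hD : ∀ t ≤ T, triang t ≤ ((T : ℤ) + 1) ^ 2 := fun t ht => by
    have h1 := two_mul_triang t
    have h2 : (t : ℤ) ≤ T := by exact_mod_cast ht
    nlinarith
  have hs : ∀ t ≤ T, ∀ i, |triang t - score z t i| ≤ 2 * ((T : ℤ) + 1) ^ 2 := fun t ht i => by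
    have h1 := abs_le.1 (abs_score_le hz t i)
    have h2 := hD t ht
    have h3 := triang_nonneg t
    rw [abs_le]
    constructor <;> linarith
  have hw : ∀ t ≤ T, ∀ i, |wt z t i| ≤ 5 * ((T : ℤ) + 1) ^ 4 := fun t ht i => by
    rw [abs_of_nonneg (wt_nonneg z t i), wt]
    have h1 := mul_self_le_mul_self (triang_nonneg t) (hD t ht)
    have h2 := abs_mul_abs_self (triang t - score z t i) ▸
      mul_self_le_mul_self (abs_nonneg _) (hs t ht i)
    linarith
  have hg : ∀ t ≤ T, ∀ m ≤ n, |gap z m t| ≤ n * (10 * ((T : ℤ) + 1) ^ 6) := fun t ht m hm => by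
    have h1 : |gap z m t| ≤ ∑ i ∈ Finset.range m, 10 * ((T : ℤ) + 1) ^ 6 := by
      refine (Finset.abs_sum_le_sum_abs _ _).trans (Finset.sum_le_sum fun i _ => ?_)
      have h2 : |triang t * z t i - score z t i| ≤ 2 * ((T : ℤ) + 1) ^ 2 := by
        have h1 := abs_le.1 (abs_score_le hz t i)
        have h2 := hD t ht
        have h3 := triang_nonneg t
        have h4 := abs_le.1 (hz t i)
        rw [abs_le]
        constructor <;> nlinarith
      rw [abs_mul]
      have h3 := mul_le_mul (hw t ht i) h2 (abs_nonneg _) (by positivity)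
      have h4 : (0 : ℤ) ≤ ((T : ℤ) + 1) ^ 6 := by positivity
      linarith
    rw [Finset.sum_const, Finset.card_range, nsmul_eq_mul] at h1
    refine h1.trans (mul_le_mul_of_nonneg_right (by exact_mod_cast hm) (by positivity))
  have hgn : (n : ℤ) * ((T : ℤ) + 1) ^ 6 ≤ (n + 1) * (k + 1) * ((T : ℤ) + 1) ^ 6 := by
    refine mul_le_mul_of_nonneg_right ?_ (by positivity)
    nlinarith
  refine ⟨?_, ?_, ?_, ?_, hz, fun t ht => ?_, fun t ht i => ?_, fun t ht m hm => ?_, fun t ht => ?_⟩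
  · have := hT 0 (by omega); rw [pow_zero] at this; omega
  · have := h1 n 1 (by omega) (by omega)
    have := Nat.le_mul_of_pos_right n (show 0 < (T + 1) ^ 6 by positivity)
    grind
  · have := h1 1 k (by omega) (by omega)
    have := Nat.le_mul_of_pos_right k (show 0 < (T + 1) ^ 6 by positivity)
    grind
  · have := hT 1 (by omega); rw [pow_one] at this; omega
  · rw [abs_of_nonneg (triang_nonneg t)]
    push_cast
    linarith [hD t ht, hT' 2 (by omega), hT' 0 (by omega)]
  · push_cast
    linarith [hw t ht i, hT' 4 (by omega), hT' 0 (by omega)]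
  · push_cast
    linarith [hg t ht m hm, hT' 0 (by omega)]
  · have h2 : triang t * (triang t * triang t) ≤ ((T : ℤ) + 1) ^ 6 := by
      have h3 := triang_nonneg t
      have h4 := pow_le_pow_left₀ h3 (hD t ht) 3
      calc triang t * (triang t * triang t) = triang t ^ 3 := by ring
        _ ≤ _ := h4
        _ = _ := by ring
    have h3 : 0 ≤ triang t * (triang t * triang t) :=
      mul_nonneg (triang_nonneg t) (mul_self_nonneg _)
    have h4 := hg t ht n le_rfl
    have h5 : |4 * (k : ℤ) * gap z n t - n * (triang t * (triang t * triang t))| ≤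
        4 * k * (n * (10 * ((T : ℤ) + 1) ^ 6)) + n * ((T : ℤ) + 1) ^ 6 := by
      refine (abs_sub _ _).trans (add_le_add ?_ ?_)
      · rw [abs_mul, abs_of_nonneg (by positivity : (0 : ℤ) ≤ 4 * k)]
        exact mul_le_mul_of_nonneg_left h4 (by positivity)
      · rw [abs_mul, abs_of_nonneg h3, Nat.abs_cast]
        exact mul_le_mul_of_nonneg_left h2 (by positivity)
    refine h5.trans ?_
    push_cast
    have h6 : (0 : ℤ) ≤ ((T : ℤ) + 1) ^ 6 := by positivity
    have h7 : (0 : ℤ) ≤ (n + 41 * k + 40) * ((T : ℤ) + 1) ^ 6 := by positivity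
    have h8 : (0 : ℤ) ≤ (40 * n + 1) * ((T : ℤ) + 1) ^ 6 := by positivity
    have h9 : (0 : ℤ) ≤ (n * k) * ((T : ℤ) + 1) ^ 6 := by positivity
    nlinarith

lemma ofMultiset_mean (s : Multiset (X → Bool)) (hs : s ≠ 0) (x : X) :
    mean (PMF.ofMultiset s hs) x = ((s.map fun c => sgn (c x)).sum : ℤ) / (Multiset.card s : ℝ) := by
  classical
  rw [mean, tsum_eq_sum (s := s.toFinset) (fun c hc => by
    rw [PMF.ofMultiset_apply_of_notMem hs (by simpa using hc)]
    simp), Finset.sum_multiset_map_count, Int.cast_sum, Finset.sum_div]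
  refine Finset.sum_congr rfl fun c _ => ?_
  rw [PMF.ofMultiset_apply]
  simp only [ENNReal.toReal_div, ENNReal.toReal_natCast, nsmul_eq_mul, Int.cast_mul,
    Int.cast_natCast]
  rw [div_mul_eq_mul_div]

lemma sum_map_repeated (f : (X → Bool) → ℤ) (c : ℕ → X → Bool) (t : ℕ) :
    ((repeated c t).map f).sum = ∑ j ∈ Finset.range t, ((j : ℤ) + 1) * f (c j) := by
  induction t with
  | zero => rfl
  | succ t ih =>
    rw [repeated_succ, List.map_append, List.sum_append, ih, Finset.sum_range_succ]
    simp

lemma length_repeated (c : ℕ → X → Bool) (t : ℕ) : ((repeated c t).length : ℤ) = triang t := by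
  have h := sum_map_repeated (fun _ => 1) c t
  simpa [triang] using h

lemma mem_repeated {c : ℕ → X → Bool} {t : ℕ} {f : X → Bool} (h : f ∈ repeated c t) :
    ∃ j, f = c j := by
  obtain ⟨j, -, hj⟩ := List.mem_flatMap.1 h
  exact ⟨j, (List.mem_replicate.1 hj).2⟩

lemma labelAt_ofFn {n : ℕ} (S : Fin n → X × Bool) (i : Fin n) :
    labelAt (List.ofFn S) i = sgn (S i).2 := by
  simp [labelAt]

lemma valueAt_ofFn {n : ℕ} (S : Fin n → X × Bool) (c : X → Bool) (i : Fin n) :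
    valueAt (List.ofFn S) c i = sgn (c (S i).1) := by
  simp [valueAt]

/-- The program outputs concepts whose uniform distribution is almost optimal for the weights that
its margins determine. -/
theorem exists_runsTo {C : Set (X → Bool)} (hO : IsERMOracle C O) {k : ℕ} (hk : 1 ≤ k) {n : ℕ}
    (S : Fin n → X × Bool) :
    ∃ μ : PMF (X → Bool),
      RunsTo learnerCmd O k S
        ((50 * (41 * ((n + 1) * (k + 1) * (512 * k + 1) ^ 6)) ^ 83 : ℕ) : ℝ)
        ((512 * k + 1 : ℕ) : ℝ) μ ∧
      μ.support ⊆ C ∧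
      ∀ c ∈ C, ∑ i, weight (mean μ (S i).1 * sgn (S i).2) *
        ((sgn (S i).2 * sgn (c (S i).1) : ℝ) - mean μ (S i).1 * sgn (S i).2) ≤ n / (4 * k) := by
  obtain ⟨c, hc⟩ := exists_isFrankWolfe O (List.ofFn S)
  set z := correctness (List.ofFn S) c with hz
  have hlen : (List.ofFn S).length = n := List.length_ofFn
  have hz1 : ∀ j i, |z j i| ≤ 1 := abs_correctness_le _ c
  have hcC : ∀ j, c j ∈ C := fun j => by rw [hc j]; exact (hO _).1
  have hopt : ∀ c' ∈ C, ∀ t, ∑ i ∈ Finset.range n,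
      wt z t i * (labelAt (List.ofFn S) i * valueAt (List.ofFn S) c' i) ≤
      ∑ i ∈ Finset.range n, wt z t i * z t i := fun c' hc' t => by
    simpa only [hlen] using hc.sum_wt_le hO hc' t
  have hex := exists_small_gap hz1 (fun t j => hopt (c j) (hcC j) t) hk
  have hex' : ∃ t, 1 ≤ t ∧ t ≤ 512 * k ∧ gapTest (List.ofFn S) c k t ≤ 0 := by
    obtain ⟨t, h1, h2, h3⟩ := hex
    refine ⟨t, h1, h2, ?_⟩
    rw [gapTest, hlen, sub_nonpos]
    linarith
  classical
  -- The program halts at the first time that the test is not positive, so the least such time is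
  -- needed, not just one within the bound.
  obtain ⟨ht1, htk, htest⟩ := Nat.find_spec hex'
  have hmin := fun u (hu : u < Nat.find hex') => Nat.find_min hex' hu
  generalize Nat.find hex' = t₀ at *
  obtain ⟨t, rfl⟩ : ∃ t, t₀ = t + 1 := ⟨t₀ - 1, by omega⟩
  have hB : RunBounds (List.ofFn S).length k (512 * k) _ z := runBounds hz1 _ k (512 * k)
  obtain ⟨l, T, hT, hrun⟩ := runs_learner hB hc htk (fun u h1 h2 => by
    by_contra! h
    exact hmin u (by omega) ⟨h1, by omega, h⟩) htest
  rw [hlen] at hrun hT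
  have hD : 0 < triang (t + 1) := triang_pos (by omega)
  have hne : ((repeated c (t + 1) : List (X → Bool)) : Multiset (X → Bool)) ≠ 0 := by
    intro h
    rw [Multiset.coe_eq_zero] at h
    have h1 := length_repeated c (t + 1)
    rw [h] at h1
    simp only [List.length_nil] at h1
    omega
  have hmargin : ∀ i : Fin n, mean (PMF.ofMultiset _ hne) (S i).1 * sgn (S i).2 =
      margin z (t + 1) i := by
    intro i
    rw [ofMultiset_mean, Multiset.map_coe, Multiset.sum_coe, sum_map_repeated, Multiset.coe_card,
      margin, div_mul_eq_mul_div, score]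
    have h1 : ((repeated c (t + 1)).length : ℝ) = triang (t + 1) := by
      exact_mod_cast length_repeated c (t + 1)
    rw [h1]
    congr 1
    rw [← Int.cast_mul, Finset.sum_mul]
    congr 1
    refine Finset.sum_congr rfl fun j _ => ?_
    rw [hz, correctness, labelAt_ofFn, valueAt_ofFn]
    ring
  refine ⟨PMF.ofMultiset _ hne, ⟨T, _, hne, hrun, by exact_mod_cast hT, ?_, rfl⟩, ?_, ?_⟩
  · simp only [memory, List.length_map, List.length_range]
    exact_mod_cast (by omega : t + 2 ≤ 512 * k + 1)
  · intro f hf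
    rw [PMF.support_ofMultiset] at hf
    obtain ⟨j, rfl⟩ := mem_repeated (by simpa using hf)
    exact hcC j
  · intro c' hc'
    have hk' : (0 : ℝ) < 4 * k := by positivity
    have h1 := marginGap_le_of_sum_wt_le (z := z) (t := t + 1) (by omega) (n := n)
      (v := fun i => ((labelAt (List.ofFn S) i * valueAt (List.ofFn S) c' i : ℤ) : ℝ))
      (w := fun i => z (t + 1) i) (by exact_mod_cast hopt c' hc' (t + 1))
    have h2 : 4 * k * marginGap z n (t + 1) (fun i => z (t + 1) i) ≤ n := by
      rw [gapTest, hlen, sub_nonpos] at htest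
      have h3 : (4 * k * gap z n (t + 1) : ℝ) ≤ n * (triang (t + 1) : ℝ) ^ 3 := by
        rw [pow_succ', pow_two]
        exact_mod_cast htest
      rw [gap_eq (by omega)] at h3
      have h4 : (0 : ℝ) < (triang (t + 1) : ℝ) ^ 3 := pow_pos (by exact_mod_cast hD) 3
      refine le_of_mul_le_mul_right ?_ h4
      linarith
    rw [le_div_iff₀ hk', mul_comm]
    refine le_trans (mul_le_mul_of_nonneg_left ?_ hk'.le) h2
    refine le_trans (le_of_eq ?_) h1
    rw [marginGap, Finset.sum_range]
    refine Finset.sum_congr rfl fun i _ => ?_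
    rw [hmargin, labelAt_ofFn, valueAt_ofFn, Int.cast_mul]

end Learner

/-! ### The law of flagged examples -/

section FlaggedLaw

lemma aemeasurable_example {X : Type*} [MeasurableSpace X] {D : Measure X} {c : X → Bool}
    (hc : AEMeasurable c D) : AEMeasurable (fun x => (x, c x)) D :=
  aemeasurable_id.prodMk hc

variable {X : Type*} [MeasurableSpace X] {D : Measure X} [IsProbabilityMeasure D] {c : X → Bool}
  {η : ℝ}

lemma isProbabilityMeasure_flaggedLaw (hc : AEMeasurable c D) (h0 : 0 ≤ η) (h1 : η < 1) :
    IsProbabilityMeasure (flaggedLaw D c η) := by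
  have := isProbabilityMeasure_exampleLaw hc
  have := isProbabilityMeasure_flagLaw h0 h1
  unfold flaggedLaw
  infer_instance

lemma measurePreserving_point (hc : AEMeasurable c D) (h0 : 0 ≤ η) (h1 : η < 1) :
    MeasurePreserving (fun z : Round X => z.2.1) (flaggedLaw D c η) D := by
  have := isProbabilityMeasure_exampleLaw hc
  have := isProbabilityMeasure_flagLaw h0 h1
  have h2 : MeasurePreserving (Prod.fst : X × Bool → X) (exampleLaw D c) D := by
    refine ⟨measurable_fst, ?_⟩
    rw [exampleLaw, AEMeasurable.map_map_of_aemeasurable measurable_fst.aemeasurable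
      (aemeasurable_example hc)]
    exact Measure.map_id
  exact h2.comp measurePreserving_snd

lemma nullMeasurableSet_patterns {C : Set (X → Bool)} (hC : MeasurableClass C D)
    (hc : AEMeasurable c D) (h0 : 0 ≤ η) (h1 : η < 1) (m : ℕ) (b : Fin m → Bool) :
    NullMeasurableSet {z : Fin m → Round X | ∃ c ∈ C, ∀ i, c (z i).2.1 = b i}
      (Measure.pi fun _ => flaggedLaw D c η) := by
  have := isProbabilityMeasure_flaggedLaw hc h0 h1
  exact (hC.2 m b).preimage (measurePreserving_pi (fun _ : Fin m => flaggedLaw D c η) (fun _ => D)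
    fun _ => measurePreserving_point hc h0 h1).quasiMeasurePreserving

/-- The target is only almost everywhere measurable, so the set where label and target agree need
not be measurable; the proof goes through a measurable modification. -/
lemma ae_label_eq (hc : AEMeasurable c D) (h0 : 0 ≤ η) (h1 : η < 1) :
    ∀ᵐ z ∂flaggedLaw D c η, z.2.2 = c z.2.1 := by
  have := isProbabilityMeasure_exampleLaw hc
  have := isProbabilityMeasure_flagLaw h0 h1
  have h2 : ∀ᵐ p ∂exampleLaw D c, p.2 = hc.mk c p.1 := by
    exact (ae_map_iff (aemeasurable_example hc) (measurableSet_eq_fun measurable_snd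
      (hc.measurable_mk.comp measurable_fst))).2 hc.ae_eq_mk
  have h3 := (measurePreserving_snd (μ := flagLaw η) (ν := exampleLaw D c)
    ).quasiMeasurePreserving.ae h2
  have h4 := (measurePreserving_point hc h0 h1).quasiMeasurePreserving.ae hc.ae_eq_mk
  filter_upwards [h3, h4] with z hz hz'
  rw [hz, hz']

lemma flagLaw_false (η : ℝ) : flagLaw η {false} = ENNReal.ofReal (1 - η) := by
  simp [flagLaw]

lemma flagLaw_true (η : ℝ) : flagLaw η {true} = ENNReal.ofReal η := by
  simp [flagLaw]

/-- A round is wrong when it is clean, which has probability 1 - η independently of its point, and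
the majority errs at the point. -/
lemma one_sub_mul_le_measureReal_wrong (hc : AEMeasurable c D) (h0 : 0 ≤ η) (h1 : η < 1)
    (h : Fin 7 → X → Bool) :
    (1 - η) * D.real {x | maj h x ≠ c x} ≤ (flaggedLaw D c η).real {z | wrong h z = true} := by
  have := isProbabilityMeasure_exampleLaw hc
  have := isProbabilityMeasure_flagLaw h0 h1
  have := isProbabilityMeasure_flaggedLaw hc h0 h1
  have h2 : ENNReal.ofReal (1 - η) * D {x | maj h x ≠ c x} ≤
      flaggedLaw D c η {z | wrong h z = true} := by
    calc ENNReal.ofReal (1 - η) * D {x | maj h x ≠ c x}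
        ≤ flagLaw η {false} * exampleLaw D c (Prod.fst ⁻¹' {x | maj h x ≠ c x}) := by
          rw [flagLaw_false]
          gcongr
          exact Measure.le_map_apply (aemeasurable_example hc) _
      _ = flaggedLaw D c η ({false} ×ˢ (Prod.fst ⁻¹' {x | maj h x ≠ c x})) :=
          (Measure.prod_prod _ _).symm
      _ ≤ _ := by
          refine measure_mono_ae ?_
          filter_upwards [ae_label_eq hc h0 h1] with z hz hz'
          obtain ⟨h3, h4⟩ := hz'
          have h3 : z.1 = false := h3
          have h4 : maj h z.2.1 ≠ c z.2.1 := h4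
          show wrong h z = true
          rw [wrong, hz, h3]
          simpa using h4
  have h3 := ENNReal.toReal_mono (measure_ne_top _ _) h2
  rwa [ENNReal.toReal_mul, ENNReal.toReal_ofReal (by linarith)] at h3

lemma measureReal_flag (hc : AEMeasurable c D) (h0 : 0 ≤ η) (h1 : η < 1) :
    (flaggedLaw D c η).real {z | z.1 = true} = η := by
  have := isProbabilityMeasure_exampleLaw hc
  have := isProbabilityMeasure_flagLaw h0 h1
  have h2 : {z : Round X | z.1 = true} = Prod.fst ⁻¹' {true} := rfl
  rw [measureReal_def, h2, flaggedLaw,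
    measurePreserving_fst.measure_preimage (measurableSet_singleton true).nullMeasurableSet,
    flagLaw_true, ENNReal.toReal_ofReal h0]

lemma measure_pi_exists_label_ne (hc : AEMeasurable c D) (h0 : 0 ≤ η) (h1 : η < 1) (n : ℕ) :
    (Measure.pi fun _ : Fin n => flaggedLaw D c η) {z | ∃ i, (z i).2.2 ≠ c (z i).2.1} = 0 := by
  have := isProbabilityMeasure_flaggedLaw hc h0 h1
  have h2 : ∀ᵐ z ∂(Measure.pi fun _ : Fin n => flaggedLaw D c η), ∀ i, (z i).2.2 = c (z i).2.1 := by
    rw [ae_all_iff]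
    exact fun i => (measurePreserving_eval (fun _ : Fin n => flaggedLaw D c η) i
      ).quasiMeasurePreserving.ae (ae_label_eq hc h0 h1)
  simpa [ae_iff] using h2

end FlaggedLaw

/-! ### The error of the learner on a good sample -/

section GoodSample
variable {X : Type*}

/-- Termwise lower bounds on the gap against the target: a clean point contributes at least four
times its error probability, a corrupted one at least -2. Dividing by four charges each corrupted
point one half. -/
lemma sum_clean_one_sub_g_le {n k : ℕ} {μ : PMF (X → Bool)} {r : Fin n → Round X} {c : X → Bool}
    (hgap : ∑ i, weight (mean μ (r i).2.1 * sgn (r i).2.2) *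
      ((sgn (r i).2.2 * sgn (c (r i).2.1) : ℝ) - mean μ (r i).2.1 * sgn (r i).2.2) ≤ n / (4 * k))
    (hlabel : ∀ i, (r i).1 = false → (r i).2.2 = c (r i).2.1) :
    ∑ i, (1 - ind (r i).1) * ((1 - g (mean μ (r i).2.1 * sgn (r i).2.2)) / 2) ≤
      n / (16 * k) + (∑ i, ind (r i).1) / 2 := by
  have h1 : ∀ i, 4 * ((1 - ind (r i).1) * ((1 - g (mean μ (r i).2.1 * sgn (r i).2.2)) / 2)) -
      2 * ind (r i).1 ≤ weight (mean μ (r i).2.1 * sgn (r i).2.2) *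
      ((sgn (r i).2.2 * sgn (c (r i).2.1) : ℝ) - mean μ (r i).2.1 * sgn (r i).2.2) := by
    intro i
    have hm : |mean μ (r i).2.1 * sgn (r i).2.2| ≤ 1 := by
      have h2 := abs_mean_le_one μ (r i).2.1
      cases (r i).2.2 <;> simpa [sgn] using h2
    have hs := hlabel i
    generalize mean μ (r i).2.1 * sgn (r i).2.2 = m at *
    obtain ⟨h2, h3⟩ := abs_le.1 hm
    cases hf : (r i).1 with
    | false =>
      rw [hs hf]
      have h4 : (sgn (c (r i).2.1) * sgn (c (r i).2.1) : ℝ) = 1 := by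
        cases c (r i).2.1 <;> simp [sgn]
      rw [h4]
      have h5 := two_mul_one_sub_g_le h2 h3
      simp only [ind, Bool.false_eq_true, if_false]
      linarith
    | true =>
      have h4 : (-1 : ℝ) ≤ sgn (r i).2.2 * sgn (c (r i).2.1) := by
        cases (r i).2.2 <;> cases c (r i).2.1 <;> simp [sgn]
      have h5 := weight_mul_one_add_le h3
      have h6 : 0 ≤ weight m := by unfold weight; positivity
      have h7 := mul_le_mul_of_nonneg_left h4 h6
      simp only [ind, if_true]
      linarith
  have h2 := (Finset.sum_le_sum fun i _ => h1 i).trans hgap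
  rw [Finset.sum_sub_distrib, ← Finset.mul_sum, ← Finset.mul_sum] at h2
  have h3 : (n : ℝ) / (16 * k) = n / (4 * k) / 4 := by rw [div_div]; ring_nf
  rw [h3]
  linarith

/-- The deviation bound controls each majority in the support by its errors on clean points.
Averaging over the mixture turns these into (1 - g(m))/2, to which the gap estimate applies. As μ
depends on the sample, `hdev` must be uniform. -/
lemma error_majMixture_le [MeasurableSpace X] {D : Measure X} [IsProbabilityMeasure D]
    {C : Set (X → Bool)} {c : X → Bool} {n k : ℕ} (hn : 0 < n) {μ : PMF (X → Bool)}
    (hμ : μ.support ⊆ C) {r : Fin n → Round X} {η a e : ℝ} (h1 : η < 1) (ha : 0 ≤ a) (he : 0 < e)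
    (hgap : ∑ i, weight (mean μ (r i).2.1 * sgn (r i).2.2) *
      ((sgn (r i).2.2 * sgn (c (r i).2.1) : ℝ) - mean μ (r i).2.1 * sgn (r i).2.2) ≤ n / (4 * k))
    (hlabel : ∀ i, (r i).1 = false → (r i).2.2 = c (r i).2.1)
    (hnoise : ∑ i, ind (r i).1 ≤ n * ((1 + a) * η + e))
    (hdev : ∀ h : Fin 7 → X → Bool, (∀ j, h j ∈ C) →
      n * ((1 - η) * D.real {x | maj h x ≠ c x}) ≤
        (1 + a) * ∑ i, ind (wrong h (r i)) + e * n) :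
    error D (majMixture μ) c ≤ ENNReal.ofReal
      ((e + (1 + a) * (1 / (16 * k) + ((1 + a) * η + e) / 2)) / (1 - η)) := by
  have hn' : (0 : ℝ) < n := by exact_mod_cast hn
  have hη : 0 < 1 - η := by linarith
  refine (error_le_of_forall_support (H := majMixture μ) (fun i => (r i).2)
    (fun i => (1 + a) / (n * (1 - η)) * (1 - ind (r i).1))
    (fun i => mul_nonneg (by positivity) (by linarith [ind_le_one (r i).1]))
    (u := e / (1 - η)) (by positivity) fun f hf => ?_).trans (ENNReal.ofReal_le_ofReal ?_)
  · obtain ⟨h, hC, rfl⟩ := support_majMixture_subset hμ hf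
    have h2 := hdev h hC
    rw [← ofReal_measureReal]
    refine ENNReal.ofReal_le_ofReal ?_
    have h3 : ∑ i, (1 + a) / (n * (1 - η)) * (1 - ind (r i).1) *
        (if maj h (r i).2.1 ≠ (r i).2.2 then (1 : ℝ) else 0) =
        (1 + a) / (n * (1 - η)) * ∑ i, ind (wrong h (r i)) := by
      rw [Finset.mul_sum]
      refine Finset.sum_congr rfl fun i _ => ?_
      rw [mul_assoc]
      congr 1
      cases h4 : (r i).1 <;> by_cases h5 : maj h (r i).2.1 = (r i).2.2 <;> simp [wrong, ind, h4, h5]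
    rw [h3]
    have h4 : e / (1 - η) + (1 + a) / (n * (1 - η)) * ∑ i, ind (wrong h (r i)) =
        ((1 + a) * ∑ i, ind (wrong h (r i)) + e * n) / (n * (1 - η)) := by
      field_simp
      ring
    rw [h4, le_div_iff₀ (by positivity)]
    linarith
  · have h2 := sum_clean_one_sub_g_le hgap hlabel
    have h3 : ∑ i, (1 + a) / (n * (1 - η)) * (1 - ind (r i).1) *
        ((1 - mean (majMixture μ) (r i).2.1 * sgn (r i).2.2) / 2) =
        (1 + a) / (n * (1 - η)) * ∑ i, (1 - ind (r i).1) *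
          ((1 - g (mean μ (r i).2.1 * sgn (r i).2.2)) / 2) := by
      rw [Finset.mul_sum]
      refine Finset.sum_congr rfl fun i _ => ?_
      rw [mean_majMixture, g_mul_sgn, mul_assoc]
    rw [h3]
    have h4 : (n : ℝ) / (16 * k) = n * (1 / (16 * k)) := by ring
    have h5 := mul_le_mul_of_nonneg_left (h2.trans (by rw [h4]; linarith :
      _ ≤ n * (1 / (16 * k) + ((1 + a) * η + e) / 2))) (by positivity : 0 ≤ (1 + a) / (n * (1 - η)))
    refine (add_le_add_right h5 _).trans (le_of_eq ?_)
    field_simp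

end GoodSample

/-! ### The main theorem -/

section Main

/-- Two distinct concepts shatter a point at which they differ. -/
lemma subsingleton_of_vcDim_eq_zero {X : Type*} {C : Set (X → Bool)} (hd : vcDim C = 0)
    {c c' : X → Bool} (hc : c ∈ C) (hc' : c' ∈ C) : c = c' := by
  by_contra h
  obtain ⟨x, hx⟩ := Function.ne_iff.1 h
  have hs : Shatters C {x} := by
    intro f
    by_cases h1 : c x = f x
    · exact ⟨c, hc, by simpa using h1⟩
    · refine ⟨c', hc', ?_⟩
      simp only [Finset.mem_singleton, forall_eq]
      revert hx h1
      cases c x <;> cases c' x <;> cases f x <;> simp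
  have h2 := card_le_of_shatters (d := 0) (by simpa using hd) hs
  simp at h2

lemma maj_const {X : Type*} (c : X → Bool) : (maj fun _ : Fin 7 => c) = c := by
  funext x
  show signSum (fun _ : Fin 7 => c x) = c x
  generalize c x = b
  cases b <;> simp [signSum, sgn]

lemma error_eq_zero_of_vcDim_eq_zero {X : Type*} [MeasurableSpace X] {D : Measure X}
    {C : Set (X → Bool)} (hd : vcDim C = 0) {H : PMF (X → Bool)} (hH : H.support ⊆ Maj 7 C)
    {c : X → Bool} (hc : c ∈ C) : error D H c = 0 := by
  rw [error, ENNReal.tsum_eq_zero]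
  intro h
  by_cases h0 : H h = 0
  · simp [h0]
  · obtain ⟨c', hC, rfl⟩ := hH ((H.mem_support_iff h).2 h0)
    have h1 : c' = fun _ => c := funext fun j => subsingleton_of_vcDim_eq_zero hd (hC j) hc
    simp [h1, maj_const]

/-- The noise term needs (1 + α/4)²/2 ≤ 1/2 + α. The other terms are at most ε/8 + (5/4)(ε/16 +
ε/16) = 9ε/32, below ε(1 - η) because η < 2/3. -/
lemma error_bound_le {ε α η q : ℝ} (hε : 0 < ε) (hα : 0 ≤ α) (hα1 : α < 1) (hη : 0 ≤ η)
    (hη1 : η < 2 / 3) (hq : q ≤ ε / 16) :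
    (ε / 8 + (1 + α / 4) * (q + ((1 + α / 4) * η + ε / 8) / 2)) / (1 - η) ≤
      (1 / 2 + α) * (η / (1 - η)) + ε := by
  have h1 : 0 < 1 - η := by linarith
  rw [div_le_iff₀ h1]
  have h2 : ((1 / 2 + α) * (η / (1 - η)) + ε) * (1 - η) = (1 / 2 + α) * η + ε * (1 - η) := by
    field_simp
  rw [h2]
  have h3 : (1 + α / 4) * (1 + α / 4) ≤ 1 + 2 * α := by nlinarith
  have h4 := mul_le_mul_of_nonneg_right h3 hη
  have h5 : (1 + α / 4) * q ≤ (1 + α / 4) * (ε / 16) := mul_le_mul_of_nonneg_left hq (by linarith)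
  have h6 : α * ε ≤ ε := by nlinarith
  have h7 : ε * (1 / 3) ≤ ε * (1 - η) := mul_le_mul_of_nonneg_left (by linarith) hε.le
  nlinarith

/-- The constant is 691200·128: passing to α/4 and ε/8 at most doubles the logarithm and loses at
most a factor 64 in the product ε(α + ε). -/
lemma sample_size_le {ε α l d n : ℝ} (hε : 0 < ε) (hα : 0 ≤ α) (hd : 0 ≤ d) (hl : 0 ≤ l)
    (hn : 88473600 * ((d * Real.log (2 + α / ε) + l) / (ε * (α + ε))) ≤ n) :
    691200 * (d * Real.log (2 + α / 4 / (ε / 8)) + l) ≤ ε / 8 * (α / 4 + ε / 8) * n := by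
  have h0 : 0 ≤ α / ε := by positivity
  have h1 : Real.log (2 + α / 4 / (ε / 8)) ≤ 2 * Real.log (2 + α / ε) := by
    have h2 : 2 * Real.log (2 + α / ε) = Real.log ((2 + α / ε) ^ 2) := by
      rw [Real.log_pow]; norm_num
    rw [h2]
    refine Real.log_le_log (by positivity) ?_
    have h3 : α / 4 / (ε / 8) = 2 * (α / ε) := by field_simp; ring
    rw [h3]
    nlinarith
  have h2 : 0 < ε * (α + ε) := by positivity
  rw [mul_div_assoc', div_le_iff₀ h2] at hn
  have h3 := mul_le_mul_of_nonneg_left h1 hd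
  have hn0 : 0 ≤ n := by
    by_contra! h
    have h4 : 0 ≤ Real.log (2 + α / ε) := Real.log_nonneg (by linarith)
    nlinarith [mul_nonneg hd h4, mul_neg_of_neg_of_pos h h2]
  have h4 : 0 ≤ n * (ε * α) := by positivity
  have h5 : 0 ≤ n * (ε * ε) := by positivity
  nlinarith

/-- A learner that outputs almost optimal mixtures of concepts is robust against malicious noise. -/
theorem learnsMalicious_majMixture {X : Type*} [MeasurableSpace X] {C : Set (X → Bool)} {d : ℕ}
    (hd : vcDim C = d) (hd1 : 1 ≤ d) {ε δ α η : ℝ} (hε : 0 < ε) (hε1 : ε < 1) (hδ : 0 < δ)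
    (hδ1 : δ < 1) (hα : 0 ≤ α) (hα1 : α < 1) (h0 : 0 ≤ η) (h1 : η < 2 / 3) {n k : ℕ}
    (hk : 1 / ε ≤ k)
    (hn : 88473600 * ((d * Real.log (2 + α / ε) + Real.log (1 / δ)) / (ε * (α + ε))) ≤ (n : ℝ))
    (μ : (Fin n → X × Bool) → PMF (X → Bool)) (hμ : ∀ S, (μ S).support ⊆ C)
    (hgap : ∀ S, ∀ c ∈ C, ∑ i, weight (mean (μ S) (S i).1 * sgn (S i).2) *
      ((sgn (S i).2 * sgn (c (S i).1) : ℝ) - mean (μ S) (S i).1 * sgn (S i).2) ≤ n / (4 * k)) :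
    LearnsMalicious C (fun S => majMixture (μ S)) η ((1 / 2 + α) * (η / (1 - η)) + ε) δ := by
  intro D _ hCD c hc adv
  have hcD := hCD.1 c hc
  have hη1 : η < 1 := by linarith
  have := isProbabilityMeasure_flaggedLaw hcD h0 hη1
  set ν := flaggedLaw D c η with hν
  set l := Real.log (1 / δ) with hl
  have hl0 : 0 ≤ l := Real.log_nonneg (by rw [le_div_iff₀ hδ]; linarith)
  have hexp : Real.exp (-l) = δ := by
    rw [hl, one_div, Real.log_inv, neg_neg, Real.exp_log hδ]
  have hN := sample_size_le (d := d) hε hα (Nat.cast_nonneg d) hl0 hn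
  set a := α / 4 with ha
  set e := ε / 8 with he
  have ha0 : 0 ≤ a := by positivity
  have he0 : 0 < e := by positivity
  have hdlog : 1 / 2 ≤ d * Real.log (2 + a / e) := by
    have h2 : 1 / 2 ≤ Real.log (2 + a / e) := by
      have h3 := Real.log_two_gt_d9
      have h4 : Real.log 2 ≤ Real.log (2 + a / e) :=
        Real.log_le_log (by norm_num) (le_add_of_nonneg_right (by positivity))
      linarith
    have h3 : (1 : ℝ) ≤ d := by exact_mod_cast hd1
    nlinarith
  have hn0 : 0 < n := by
    rcases Nat.eq_zero_or_pos n with rfl | h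
    · rw [Nat.cast_zero, mul_zero] at hN
      linarith
    · exact h
  -- The bad events in the independent model: a majority deviates (probability at most δ/4), too
  -- many rounds are flagged (at most δ/2), some label differs from the target (null).
  set B₁ : Set (Fin n → Round X) := {z | ∃ c : Fin 7 → X → Bool, (∀ j, c j ∈ C) ∧
    (1 + a) * ∑ i, ind (wrong c (z i)) + e * n < n * ν.real {z | wrong c z = true}} with hB₁
  set B₂ : Set (Fin n → Round X) :=
    {z | n * ((1 + a) * ν.real {z | z.1 = true} + e) ≤ ∑ i, ind (z i).1} with hB₂
  set B₃ : Set (Fin n → Round X) := {z | ∃ i, (z i).2.2 ≠ c (z i).2.1} with hB₃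
  have hm₁ : (Measure.pi fun _ => ν) B₁ ≤ ENNReal.ofReal (δ / 4) := by
    have h2 := measure_deviation_le (ν := ν) hd hd1 ha0 (by linarith) he0 hl0 hN
      (fun c' hc' => (hCD.1 c' hc').comp_quasiMeasurePreserving
        (measurePreserving_point hcD h0 hη1).quasiMeasurePreserving)
      (nullMeasurableSet_patterns hCD hcD h0 hη1)
    rwa [hexp] at h2
  have hm₂ : (Measure.pi fun _ => ν) B₂ ≤ ENNReal.ofReal (δ / 2) := by
    have h2 := measureReal_upper_tail_le (ν := ν) (f := Prod.fst) measurable_fst.aemeasurable n ha0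
      (by linarith) he0 (by linarith)
    have h3 : Real.exp (-(e * (a + e) * n) / 8) ≤ δ / 2 := by
      have h4 : -(e * (a + e) * n) / 8 ≤ -l + -1 := by linarith
      have h5 : Real.exp (-1) ≤ 1 / 2 := by
        have := Real.exp_neg_one_lt_d9
        linarith
      calc _ ≤ Real.exp (-l + -1) := Real.exp_le_exp.2 h4
        _ = δ * Real.exp (-1) := by rw [Real.exp_add, hexp]
        _ ≤ δ / 2 := by nlinarith
    rw [← ofReal_measureReal]
    exact ENNReal.ofReal_le_ofReal (h2.trans h3)
  have hm₃ : (Measure.pi fun _ => ν) B₃ = 0 := measure_pi_exists_label_ne hcD h0 hη1 n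
  refine (roundsLaw_le_pi hcD h0 hη1 adv (B' := B₁ ∪ B₂ ∪ B₃) fun r hr w => ?_).trans ?_
  · by_contra hcon
    simp only [Set.mem_union, not_or] at hcon
    obtain ⟨⟨hb₁, hb₂⟩, hb₃⟩ := hcon
    have hflag : ∀ i, (redraw (r i) (w i)).1 = (r i).1 := fun i => by
      unfold redraw
      split_ifs with h
      · exact h.symm
      · rfl
    have hclean : ∀ i, (r i).1 = false → redraw (r i) (w i) = r i := fun i hi => by
      simp [redraw, hi]
    -- Flagged rounds are never counted as wrong, so redrawing them changes no count.
    have hwrong : ∀ (h : Fin 7 → X → Bool) i, wrong h (redraw (r i) (w i)) = wrong h (r i) := by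
      intro h i
      cases hi : (r i).1 with
      | false => rw [hclean i hi]
      | true =>
        have h2 := hflag i
        rw [hi] at h2
        simp [wrong, hi, h2]
    have hkpos : (0 : ℝ) < k := lt_of_lt_of_le (by positivity) hk
    have hbound := error_majMixture_le (D := D) (c := c) (k := k) hn0
      (hμ fun i => (r i).2) (r := r) hη1 ha0 he0 (hgap (fun i => (r i).2) c hc) (fun i hi => by
        by_contra h2
        refine hb₃ ⟨i, ?_⟩
        show (redraw (r i) (w i)).2.2 ≠ c (redraw (r i) (w i)).2.1
        rwa [hclean i hi])
      (by
        have h2 : ¬ n * ((1 + a) * ν.real {z | z.1 = true} + e) ≤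
          ∑ i, ind (redraw (r i) (w i)).1 := hb₂
        simp only [hflag, hν, measureReal_flag hcD h0 hη1] at h2
        exact (not_le.1 h2).le)
      (fun h hC => by
        have h2 : ¬ (1 + a) * ∑ i, ind (wrong h (redraw (r i) (w i))) + e * n <
          n * ν.real {z | wrong h z = true} := fun h3 => hb₁ ⟨h, hC, h3⟩
        simp only [hwrong] at h2
        refine le_trans (mul_le_mul_of_nonneg_left ?_ (Nat.cast_nonneg n)) (not_lt.1 h2)
        exact one_sub_mul_le_measureReal_wrong hcD h0 hη1 h)
    have hq : (1 : ℝ) / (16 * k) ≤ ε / 16 := by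
      rw [div_le_iff₀ hε] at hk
      rw [div_le_iff₀ (by positivity)]
      linarith
    exact absurd (hbound.trans (ENNReal.ofReal_le_ofReal
      (error_bound_le hε hα hα1 h0 h1 hq))) (not_le.2 hr)
  · calc (Measure.pi fun _ => ν) (B₁ ∪ B₂ ∪ B₃)
        ≤ (Measure.pi fun _ => ν) B₁ + (Measure.pi fun _ => ν) B₂ + (Measure.pi fun _ => ν) B₃ :=
          (measure_union_le _ _).trans (add_le_add_left (measure_union_le _ _) _)
      _ ≤ ENNReal.ofReal (δ / 4) + ENNReal.ofReal (δ / 2) + 0 := by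
          rw [hm₃]
          gcongr
      _ = ENNReal.ofReal (δ / 4 + δ / 2) := by
          rw [add_zero, ENNReal.ofReal_add (by positivity) (by positivity)]
      _ ≤ ENNReal.ofReal δ := ENNReal.ofReal_le_ofReal (by linarith)

/-- The base has degree 8 in x, namely 1 + 1 + 6, and 664 = 8·83. -/
lemma exists_time_bound : ∃ K : ℕ, ∀ (n k : ℕ) (x : ℝ), (n : ℝ) + 1 ≤ x → (k : ℝ) ≤ 2 * x →
    ((50 * (41 * ((n + 1) * (k + 1) * (512 * k + 1) ^ 6)) ^ 83 : ℕ) : ℝ) ≤ K * x ^ 664 := by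
  obtain ⟨K, hK⟩ := exists_nat_ge (50 * (41 * (3 * 1025 ^ 6)) ^ 83 : ℝ)
  refine ⟨K, fun n k x hn hk => ?_⟩
  have hx : 1 ≤ x := by linarith [(Nat.cast_nonneg n : (0 : ℝ) ≤ n)]
  have h1 : ((n : ℝ) + 1) * (k + 1) * (512 * k + 1) ^ 6 ≤ x * (3 * x) * (1025 * x) ^ 6 := by
    gcongr <;> linarith
  have h2 : x * (3 * x) * (1025 * x) ^ 6 = 3 * 1025 ^ 6 * x ^ 8 := by ring
  rw [h2] at h1
  push_cast
  calc 50 * (41 * (((n : ℝ) + 1) * (k + 1) * (512 * k + 1) ^ 6)) ^ 83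
      ≤ 50 * (41 * (3 * 1025 ^ 6 * x ^ 8)) ^ 83 := by gcongr
    _ = 50 * (41 * (3 * 1025 ^ 6)) ^ 83 * x ^ 664 := by
        rw [← mul_assoc 41, mul_pow _ (x ^ 8), ← pow_mul, mul_assoc 50]
    _ ≤ K * x ^ 664 := mul_le_mul_of_nonneg_right hK (by positivity)

end Main

end MaliciousLearning

theorem mainTheorem1 :
    ∃ (P : Cmd) (K : ℕ), ∀ (X : Type*) [MeasurableSpace X] (C : Set (X → Bool)) (d : ℕ),
      vcDim C = d →
      ∀ O : List (X × Bool) → X → Bool, IsERMOracle C O →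
      ∀ ε δ α : ℝ, 0 < ε → ε < 1 → 0 < δ → δ < 1 → 0 ≤ α → α < 1 →
      ∀ n : ℕ,
        (K : ℝ) * ((d * Real.log (2 + α / ε) + Real.log (1 / δ)) / (ε * (α + ε))) ≤ n →
        ∃ A : (Fin n → X × Bool) → PMF (X → Bool),
          (∀ S, ∃ μ : PMF (X → Bool),
            RunsTo P O ⌈1 / ε⌉₊ S (K * (n + 1 / ε) ^ K) (K / ε) μ ∧
            μ.support ⊆ C ∧
            A S = majMixture μ ∧
            (A S).support ⊆ Maj 7 C ∧
            ∀ x, mean (A S) x = g (mean μ x)) ∧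
          ∀ η : ℝ, 0 ≤ η → η < 1 →
            LearnsMalicious C A η ((1 / 2 + α) * (η / (1 - η)) + ε) δ := by
  obtain ⟨K₀, hK₀⟩ := exists_time_bound
  obtain ⟨K, hK₀', hK, hK'⟩ : ∃ K : ℕ, (K₀ : ℝ) ≤ K ∧ (88473600 : ℝ) ≤ K ∧ 664 ≤ K := by
    refine ⟨K₀ + 88473600, ?_, ?_, by omega⟩
    · push_cast; linarith
    · push_cast; linarith [K₀.cast_nonneg (α := ℝ)]
  refine ⟨learnerCmd, K, ?_⟩
  intro X _ C d hd O hO ε δ α hε hε1 hδ hδ1 hα hα1 n hn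
  have h1ε : 1 < 1 / ε := by rw [lt_div_iff₀ hε]; linarith
  have hk : 1 ≤ ⌈1 / ε⌉₊ := Nat.one_le_ceil_iff.2 (by linarith)
  have hk2 : (⌈1 / ε⌉₊ : ℝ) ≤ 2 * (1 / ε) := by
    have := Nat.ceil_lt_add_one (by linarith : 0 ≤ 1 / ε)
    linarith
  choose μ hrun hμ hgap using fun S : Fin n → X × Bool => exists_runsTo hO hk S
  have hn0 : (0 : ℝ) ≤ n := Nat.cast_nonneg n
  refine ⟨fun S => majMixture (μ S), fun S => ⟨μ S, ?_, hμ S, rfl,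
    support_majMixture_subset (hμ S), mean_majMixture (μ S)⟩, fun η h0 h1 => ?_⟩
  · have h3 : (1 : ℝ) ≤ n + 1 / ε := by linarith
    have htime := (hK₀ n ⌈1 / ε⌉₊ (n + 1 / ε) (by linarith) (by linarith)).trans
      (mul_le_mul hK₀' (pow_le_pow_right₀ h3 hK') (by positivity) K.cast_nonneg)
    have hcalls : ((512 * ⌈1 / ε⌉₊ + 1 : ℕ) : ℝ) ≤ K / ε := by
      have h2 : 1025 / ε ≤ K / ε := by gcongr; linarith
      push_cast
      linarith [mul_one_div 1025 ε]
    obtain ⟨t, s, hs, hexec, ht, hQ, hμs⟩ := hrun S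
    exact ⟨t, s, hs, hexec, ht.trans htime, hQ.trans hcalls, hμs⟩
  · have hlog : 0 ≤ d * Real.log (2 + α / ε) + Real.log (1 / δ) := by
      have h2 : 0 ≤ α / ε := by positivity
      have h3 : 0 ≤ Real.log (2 + α / ε) := Real.log_nonneg (by linarith)
      have h4 : 0 ≤ Real.log (1 / δ) := Real.log_nonneg (by rw [le_div_iff₀ hδ]; linarith)
      positivity
    have hη : 0 ≤ η / (1 - η) := div_nonneg h0 (by linarith)
    have htriv : (∀ (D : Measure X) [IsProbabilityMeasure D], ∀ c ∈ C, ∀ S,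
        error D (majMixture (μ S)) c ≤ ENNReal.ofReal ((1 / 2 + α) * (η / (1 - η)) + ε)) →
        LearnsMalicious C (fun S => majMixture (μ S)) η ((1 / 2 + α) * (η / (1 - η)) + ε) δ := by
      intro h D _ _ c hc adv
      have h2 : {r : Fin n → Round X | ENNReal.ofReal ((1 / 2 + α) * (η / (1 - η)) + ε) <
          error D (majMixture (μ fun i => (r i).2)) c} = ∅ :=
        Set.eq_empty_of_forall_notMem fun r hr => absurd (h D c hc _) (not_le.2 hr)
      show roundsLaw D c η adv n {r | _} ≤ _
      rw [h2, measure_empty]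
      exact zero_le
    -- The deviation bound requires d ≥ 1; for d = 0 every majority of concepts equals the target.
    rcases Nat.eq_zero_or_pos d with rfl | hd1
    · refine htriv fun D _ c hc S => ?_
      rw [error_eq_zero_of_vcDim_eq_zero (by simpa using hd) (support_majMixture_subset (hμ S)) hc]
      exact zero_le
    -- From η = 2/3 on, η/(1 - η) ≥ 2, so the claimed error is at least 1.
    rcases lt_or_ge η (2 / 3) with h2 | h2
    · refine learnsMalicious_majMixture hd hd1 hε hε1 hδ hδ1 hα hα1 h0 h2 (Nat.le_ceil _)
        (le_trans (mul_le_mul_of_nonneg_right hK (by positivity)) hn) μ hμ hgap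
    · refine htriv fun D _ c hc S => (error_le_one _ _).trans ?_
      rw [← ENNReal.ofReal_one]
      refine ENNReal.ofReal_le_ofReal ?_
      have h3 : 2 ≤ η / (1 - η) := by
        rw [le_div_iff₀ (by linarith)]
        linarith
      nlinarith
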